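/- **Setting.** Let $\Omega=S\times(-L,L)\subset\mathbb R^3$ with $L>0$ and $S\subset\mathbb R^2$ a bounded open set with Lipschitz boundary, and let $Y=[0,1]^3$. For $d>0$ put $\Sigma^d=\bigcup\{S\times\{kd\}: k\in\mathbb Z,\ kd\in(-L,L-d)\}$. Let $\omega,\mu,\lambda>0$ be constants and $J_a\in L^2(\Omega;\mathbb C^3)$. Let $\varepsilon,\sigma$ be complex-valued functions of $(x,y)\in\Omega\times\mathbb R^3$ that are $Y$-periodic in $y$, with $\sigma$ Lipschitz continuous in $(x,y)$, and put $\varepsilon^d(x)=\varepsilon(x,x/d)$ and $\sigma^d(x)=d\,\sigma(x,x/d)$. Assume that $\varepsilon^d$ is measurable on $\Omega$ for all $d>0$ and that there are constants $0<c\le C$ such that, for all $d>0$, $$c\le \operatorname{Im}\varepsilon^d\le C,\quad |\operatorname{Re}\varepsilon^d|\le C\ \text{ on }\Omega,\qquad c\le \tfrac1d\operatorname{Re}\sigma^d\le C,\quad \bigl|\tfrac1d\operatorname{Im}\sigma^d\bigr|\le C\ \text{ on }\Sigma^d .$$ With $u_T=(\nu\times u)\times\nu$ the tangential trace ($\nu$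 the unit normal), let $X^d$ be the space of all $u\in H(\mathrm{curl};\Omega)$ (complex vector fields) with $u_T\in L^2(\partial\Omega;\mathbb C^3)$ and $u_T\in L^2(\Sigma^d;\mathbb C^3)$. For $d>0$ let $E^d\in X^d$ be the solution of $$\int_\Omega \tfrac1\mu\,(\nabla\times E^d)\cdot(\nabla\times\overline\Psi)\,dx-\int_\Omega\omega^2\varepsilon^dE^d\cdot\overline\Psi\,dx-\int_{\Sigma^d}i\omega\sigma^dE^d_T\cdot\overline\Psi_T\,do_x-\int_{\partial\Omega}i\omega\lambda E^d_T\cdot\overline\Psi_T\,do_x=i\omega\int_\Omega J_a\cdot\overline\Psi\,dx\qquad\forall\,\Psi\in X^d,$$ and let $H^d=\frac1{i\omega\mu}\nabla\times E^d$. A sequence $u^{d_n}\in L^2(\Omega;\mathbb C^3)$, where $d_n>0$ and $d_n\to0$, two-scale converges to $u^{(0)}\in L^2(\Omega\times Y;\mathbb C^3)$ if $$\lim_{n\to\infty}\int_\Omega u^{d_n}(x)\cdot\Psi(x,x/d_n)\,dx=\int_\Omega\int_Y u^{(0)}(x,y)\cdot\Psi(x,y)\,dy\,dx\qquad\text{for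 all }\Psi\in C_0(\Omega;C_\#(Y;\mathbb C^3)),$$ where $C_\#$ denotes continuous $Y$-periodic functions. Let $H^1_\#(Y;\mathbb C)$ be the closure of the smooth $Y$-periodic functions in the $H^1(Y)$ norm. **Lemma 4.1.** For every sequence $d_n>0$ with $d_n\to0$ there are a subsequence (still denoted $d_n$), functions $\mathcal E,\mathcal H\in L^2(\Omega;\mathbb C^3)$ and a function $\varphi\in L^2(\Omega;H^1_\#(Y;\mathbb C))$ such that, along this subsequence, $E^{d_n}$ two-scale converges to $$E^{(0)}(x,y)=\mathcal E(x)+\nabla_y\varphi(x,y)$$ and $H^{d_n}$ two-scale converges to $H^{(0)}(x,y)=\mathcal H(x)$, which does not depend on $y$. -/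

import Mathlib

open MeasureTheory Set Filter Topology
open scoped ContDiff NNReal

noncomputable section

namespace LayeredMaxwell

/-- The plane `ℝ²`. -/
abbrev E2 := EuclideanSpace ℝ (Fin 2)

/-- Physical space `ℝ³`. -/
abbrev E3 := EuclideanSpace ℝ (Fin 3)

/-- The space `ℂ³` in which the vector fields take their values. -/
abbrev C3 := EuclideanSpace ℂ (Fin 3)

/-! ### Vector calculus -/

/-- The bilinear product `u · v = ∑ uᵢ vᵢ` on `ℂ³` (no complex conjugation). -/
def dot (u v : C3) : ℂ := ∑ i, u i * v i

/-- A real vector, viewed as a complex one. -/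
def toC (v : E3) : C3 := WithLp.toLp 2 fun i => (v i : ℂ)

/-- The vector product on `ℂ³`. -/
def cross (u v : C3) : C3 := WithLp.toLp 2 (crossProduct u.ofLp v.ofLp)

/-- The third unit vector, which is the unit normal of the horizontal sheets. -/
def e3 : E3 := EuclideanSpace.single 2 1

/-- The partial derivative `∂ⱼ φᵢ` of a `ℂ³`-valued function. -/
def pderivComp (φ : E3 → C3) (j i : Fin 3) (x : E3) : ℂ :=
  (fderiv ℝ φ x (EuclideanSpace.single j 1)) i

/-- The classical curl of a differentiable vector field. -/
def curlOf (φ : E3 → C3) (x : E3) : C3 :=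
  !₂[pderivComp φ 1 2 x - pderivComp φ 2 1 x,
     pderivComp φ 2 0 x - pderivComp φ 0 2 x,
     pderivComp φ 0 1 x - pderivComp φ 1 0 x]

/-- The classical gradient of a differentiable scalar function. -/
def gradOf (w : E3 → ℂ) (y : E3) : C3 :=
  WithLp.toLp 2 fun i => fderiv ℝ w y (EuclideanSpace.single i 1)

/-- Smooth compactly supported vector fields on `ℝ³`. -/
def IsTestField (φ : E3 → C3) : Prop := ContDiff ℝ ∞ φ ∧ HasCompactSupport φ

/-! ### Geometry -/

/-- A bounded open set of the plane that near each of its boundary points is, in a suitable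
Cartesian coordinate system, the strict subgraph of a Lipschitz function. -/
def IsBoundedLipschitzDomain (S : Set E2) : Prop :=
  IsOpen S ∧ Bornology.IsBounded S ∧
    ∀ p ∈ frontier S, ∃ (A : E2 ≃ᵢ E2) (f : ℝ → ℝ) (K : ℝ≥0), LipschitzWith K f ∧
      ∀ᶠ q in 𝓝 p, (q ∈ S ↔ (A q) 1 < f ((A q) 0))

/-- The horizontal part `x'` of `x = (x', x₃)`. -/
def horiz (x : E3) : E2 := !₂[x 0, x 1]

/-- The cylinder `Ω = S × (-L, L)`. -/
def domainΩ (S : Set E2) (L : ℝ) : Set E3 := {x | horiz x ∈ S ∧ x 2 ∈ Ioo (-L) L}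

/-- The sheet `S × {k d}`. -/
def sheet (S : Set E2) (d : ℝ) (k : ℤ) : Set E3 := {x | horiz x ∈ S ∧ x 2 = k * d}

/-- The indices `k ∈ ℤ` with `k d ∈ (-L, L - d)`. -/
def sheetIndices (L d : ℝ) : Set ℤ := {k | (k : ℝ) * d ∈ Ioo (-L) (L - d)}

/-- The union `Σᵈ` of the sheets. -/
def layers (S : Set E2) (L d : ℝ) : Set E3 := ⋃ k ∈ sheetIndices L d, sheet S d k

/-- `ν` is the outer unit normal of `Ω` at `x`: near `x` the set `Ω` agrees, outside of
arbitrarily thin double cones around the tangent plane, with the half space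
`{y | ⟪ν, y - x⟫ < 0}`. -/
def IsOuterUnitNormal (Ω : Set E3) (x ν : E3) : Prop :=
  ‖ν‖ = 1 ∧ ∀ δ > 0, ∃ r > 0, ∀ y ∈ Metric.ball x r,
    (inner ℝ ν (y - x) < -δ * ‖y - x‖ → y ∈ Ω) ∧
    (δ * ‖y - x‖ < inner ℝ ν (y - x) → y ∉ Ω)

open Classical in
/-- The outer unit normal of `Ω` at `x`; it exists at almost every boundary point of a
Lipschitz domain, and it is set to `0` where it does not exist. -/
def outerNormal (Ω : Set E3) (x : E3) : E3 :=
  if h : ∃ ν, IsOuterUnitNormal Ω x ν then h.choose else 0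

/-- The surface measure on a surface `Λ` (the two-dimensional Hausdorff measure, normalized so
that it is the Lebesgue measure on planes). -/
def surfaceMeasure (Λ : Set E3) : Measure E3 := (μHE[2] : Measure E3).restrict Λ

/-! ### The energy space -/

/-- An element `u` of the space `Xᵈ` of all `u ∈ H(curl; Ω)` whose tangential traces on `∂Ω` and
on `Σᵈ` are square integrable. It is recorded by a representative of `u` together with
representatives of its weak curl and of its tangential traces `u_T = (ν × u) × ν`,
which are determined by `u` up to null sets.
The traces are those of `H(curl; Ω)`, given by Green's formula
`∫_D (curl u · φ - u · curl φ) = ∫_{∂D} (ν × u_T) · φ`. -/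
structure XSpace (S : Set E2) (L d : ℝ) where
  /-- the field `u` itself -/
  field : E3 → C3
  /-- the weak curl of `u` -/
  curl : E3 → C3
  /-- the tangential trace of `u` on `∂Ω` -/
  bdTrace : E3 → C3
  /-- the tangential trace of `u` on the sheets -/
  shTrace : E3 → C3
  memLp_field : MemLp field 2 (volume.restrict (domainΩ S L))
  memLp_curl : MemLp curl 2 (volume.restrict (domainΩ S L))
  memLp_bdTrace : MemLp bdTrace 2 (surfaceMeasure (frontier (domainΩ S L)))
  memLp_shTrace : MemLp shTrace 2 (surfaceMeasure (layers S L d))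
  /-- `curl` is the distributional curl of `field` in `Ω` -/
  weak_curl : ∀ φ, IsTestField φ → tsupport φ ⊆ domainΩ S L →
    ∫ x in domainΩ S L, dot (curl x) (φ x) = ∫ x in domainΩ S L, dot (field x) (curlOf φ x)
  /-- the boundary trace is tangential to `∂Ω` -/
  bd_tangential : ∀ᵐ x ∂(surfaceMeasure (frontier (domainΩ S L))),
    dot (toC (outerNormal (domainΩ S L) x)) (bdTrace x) = 0
  /-- Green's formula in `Ω` -/
  bd_green : ∀ φ, IsTestField φ →
    ∫ x in domainΩ S L, (dot (curl x) (φ x) - dot (field x) (curlOf φ x)) =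
      ∫ x, dot (cross (toC (outerNormal (domainΩ S L) x)) (bdTrace x)) (φ x)
        ∂(surfaceMeasure (frontier (domainΩ S L)))
  /-- the trace on the sheets is tangential -/
  sh_tangential : ∀ᵐ x ∂(surfaceMeasure (layers S L d)), dot (toC e3) (shTrace x) = 0
  /-- Green's formula in the part of `Ω` below a sheet, for fields vanishing near `∂Ω` -/
  sh_green : ∀ k ∈ sheetIndices L d, ∀ φ, IsTestField φ → tsupport φ ⊆ domainΩ S L →
    ∫ x in {x ∈ domainΩ S L | x 2 < k * d},
        (dot (curl x) (φ x) - dot (field x) (curlOf φ x)) =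
      ∫ x, dot (cross (toC e3) (shTrace x)) (φ x) ∂(surfaceMeasure (sheet S d k))

/-! ### The Maxwell problem -/

/-- The oscillating permittivity `εᵈ(x) = ε(x, x / d)`. -/
def epsD (ε : E3 → E3 → ℂ) (d : ℝ) (x : E3) : ℂ := ε x (d⁻¹ • x)

/-- The oscillating surface conductivity `σᵈ(x) = d σ(x, x / d)`. -/
def sigmaD (σ : E3 → E3 → ℂ) (d : ℝ) (x : E3) : ℂ := d * σ x (d⁻¹ • x)

/-- The sesquilinear form
`aᵈ(u, v) = ∫_Ω μ⁻¹ curl u · conj (curl v) - ∫_Ω freq² εᵈ u · conj v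
  - ∫_{Σᵈ} i freq σᵈ u_T · conj v_T - ∫_{∂Ω} i freq λ u_T · conj v_T`,
where `freq` is the angular frequency and `lam` stands for `λ`; note that `inner ℂ v u = ∑ uᵢ conj vᵢ`. -/
def form {S : Set E2} {L d : ℝ} (freq μ lam : ℝ) (epsd sigd : E3 → ℂ) (u v : XSpace S L d) : ℂ :=
  (∫ x in domainΩ S L, (1 / μ : ℂ) * inner ℂ (v.curl x) (u.curl x))
  - (∫ x in domainΩ S L, (freq : ℂ) ^ 2 * epsd x * inner ℂ (v.field x) (u.field x))
  - (∫ x, Complex.I * freq * sigd x * inner ℂ (v.shTrace x) (u.shTrace x)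
      ∂(surfaceMeasure (layers S L d)))
  - (∫ x, Complex.I * freq * lam * inner ℂ (v.bdTrace x) (u.bdTrace x)
      ∂(surfaceMeasure (frontier (domainΩ S L))))

/-- `E ∈ Xᵈ` solves the weak Maxwell problem
`aᵈ(E, Ψ) = i freq ∫_Ω J · conj Ψ` for all `Ψ ∈ Xᵈ`. -/
def IsMaxwellSolution {S : Set E2} {L d : ℝ} (freq μ lam : ℝ) (epsd sigd : E3 → ℂ) (J : E3 → C3)
    (E : XSpace S L d) : Prop :=
  ∀ Ψ : XSpace S L d, form freq μ lam epsd sigd E Ψ =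
    Complex.I * freq * ∫ x in domainΩ S L, inner ℂ (Ψ.field x) (J x)

/-- The magnetic field `H = (i freq μ)⁻¹ curl E`. -/
def magneticField {S : Set E2} {L d : ℝ} (freq μ : ℝ) (E : XSpace S L d) (x : E3) : C3 :=
  (1 / (Complex.I * freq * μ) : ℂ) • E.curl x

/-! ### Periodic functions and two-scale convergence -/

/-- The unit cell `Y = [0,1]³`. -/
def unitCell : Set E3 := {y | ∀ i, y i ∈ Icc (0 : ℝ) 1}

/-- `Y`-periodic functions on `ℝ³`. -/
def IsYPeriodic {α : Type*} (f : E3 → α) : Prop :=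
  ∀ (k : Fin 3 → ℤ) (y : E3), f (y + WithLp.toLp 2 fun i => (k i : ℝ)) = f y

/-- `v` belongs to the closure, with respect to the `H¹(Y)` norm, of the smooth `Y`-periodic
functions, and `g` is its gradient. -/
def IsH1PerWithGrad (v : E3 → ℂ) (g : E3 → C3) : Prop :=
  IsYPeriodic v ∧ IsYPeriodic g ∧
  MemLp v 2 (volume.restrict unitCell) ∧ MemLp g 2 (volume.restrict unitCell) ∧
  ∀ δ : ENNReal, 0 < δ → ∃ w : E3 → ℂ, ContDiff ℝ ∞ w ∧ IsYPeriodic w ∧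
    eLpNorm (v - w) 2 (volume.restrict unitCell) < δ ∧
    eLpNorm (g - gradOf w) 2 (volume.restrict unitCell) < δ

/-- `f ∈ L²(Ω × Y; F)`. -/
def MemL2Prod {F : Type*} [NormedAddCommGroup F] (Ω : Set E3) (f : E3 → E3 → F) : Prop :=
  MemLp (Function.uncurry f) 2 ((volume.restrict Ω).prod (volume.restrict unitCell))

/-- `φ ∈ L²(Ω; H¹_#(Y; ℂ))`, with `G(x, y) = ∇_y φ(x, y)`. -/
def MemL2H1PerWithGrad (Ω : Set E3) (φ : E3 → E3 → ℂ) (G : E3 → E3 → C3) : Prop :=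
  MemL2Prod Ω φ ∧ MemL2Prod Ω G ∧ ∀ᵐ x ∂(volume.restrict Ω), IsH1PerWithGrad (φ x) (G x)

/-- Test functions in `C₀(Ω; C_#(Y; ℂ³))`. For a bounded open set `Ω` these are, after extension
by zero, the jointly continuous functions that are `Y`-periodic in the second variable and vanish
for `x ∉ Ω`. -/
def IsTwoScaleTest (Ω : Set E3) (Ψ : E3 → E3 → C3) : Prop :=
  Continuous (Function.uncurry Ψ) ∧ (∀ x, IsYPeriodic (Ψ x)) ∧ ∀ x ∉ Ω, ∀ y, Ψ x y = 0

/-- Two-scale convergence of a sequence `u n ∈ L²(Ω; ℂ³)`, with scales `d n`, to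
`u₀ ∈ L²(Ω × Y; ℂ³)`. -/
def TwoScaleConverges (Ω : Set E3) (d : ℕ → ℝ) (u : ℕ → E3 → C3) (u₀ : E3 → E3 → C3) : Prop :=
  (∀ n, MemLp (u n) 2 (volume.restrict Ω)) ∧ MemL2Prod Ω u₀ ∧
  ∀ Ψ, IsTwoScaleTest Ω Ψ →
    Tendsto (fun n => ∫ x in Ω, dot (u n x) (Ψ x ((d n)⁻¹ • x))) atTop
      (𝓝 (∫ x in Ω, ∫ y in unitCell, dot (u₀ x y) (Ψ x y)))

end LayeredMaxwell

end

open LayeredMaxwell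

noncomputable section

namespace LayeredMaxwell

/-! The proof combines an energy estimate with Fourier analysis in the fast variable.

Testing the equation with `E` itself, the imaginary part controls the L² norm of the field and √d
times that of its sheet trace: Im ε and Re σ are bounded below, and the boundary term has the same
sign. The real part then controls the curl (`energy_bounds`, `exists_apriori_bound`).

L²-bounded sequences have two-scale limits (`exists_twoScaleConverges_subseq`). The measure
preserving map `unfold` turns the integral of u against Ψ(x, x/d) into a pairing on ℝ³ × Y in which
the test function is almost Ψ(x, y); there weak compactness in L² applies.

Let E₀ and W₀ be the limits of the fields and of their curls, with Fourier coefficients a_k(x) in y.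
The test fields d η(x) exp(2πi k·x/d) b are O(d), while their curls are 2πi η exp(2πi k·x/d) k × b
up to O(d). Three relations follow. (1) The definition of the weak curl gives k × a_k = 0 for E₀.
Hence E₀ is its mean plus a gradient, with potential coefficients k·a_k / (2πi|k|²)
(`exists_potential`). (2) The weak curl tested with gradients of oscillating scalars, which are
curl-free, gives k·a_k = 0 for W₀. (3) The Maxwell equation gives k × a_k = 0 for W₀, because all
its other terms are O(d) (`norm_integral_curl_test_le`). On the sheets the area is O(1/d) and the
trace of `E` is O(1/√d) in L², but the conductivity is O(d) and so is the test field. By (2) and (3)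
only the mean of W₀ survives (`eq_cellMean_of_curl_div`), and the magnetic field is a constant
multiple of the curl.

The equation may be tested with such fields because smooth compactly supported fields lie in the
energy space with the expected traces (`XSpace.ofTestField`); this rests on the divergence theorem
in half-spaces. -/

/-! ### The unit cell and the torus -/

/-- Lebesgue measure on the unit cell. -/
abbrev cellMeasure : Measure E3 := volume.restrict unitCell

/-- The three-dimensional torus. -/
abbrev Torus3 := UnitAddTorus (Fin 3)

/-- The Haar probability measure on the torus. -/
abbrev torusMeasure : Measure Torus3 :=
  @volume Torus3 (@MeasureSpace.pi (Fin 3) _ (fun _ => UnitAddCircle)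
    fun _ => ⟨AddCircle.haarAddCircle⟩)

/-- The half-open unit cell `(0,1]³`. -/
def halfOpenCell : Set E3 := {y | ∀ i, y i ∈ Ioc (0 : ℝ) 1}

lemma unitCell_eq_preimage :
    unitCell = (WithLp.ofLp : E3 → Fin 3 → ℝ) ⁻¹' (univ.pi fun _ => Icc (0 : ℝ) 1) := by
  ext y; simp only [unitCell, mem_ofPred_eq, mem_preimage, mem_univ_pi]

lemma halfOpenCell_eq_preimage :
    halfOpenCell = (WithLp.ofLp : E3 → Fin 3 → ℝ) ⁻¹' (univ.pi fun _ => Ioc (0 : ℝ) 1) := by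
  ext y; simp only [halfOpenCell, mem_ofPred_eq, mem_preimage, mem_univ_pi]

lemma measurableSet_halfOpenCell : MeasurableSet halfOpenCell := by
  rw [halfOpenCell_eq_preimage]
  exact (MeasurableSet.univ_pi fun _ => measurableSet_Ioc).preimage (by fun_prop)

/-- The faces of the cube are null. The half-open cube is preferable because the covering map of the
torus is a bijection on it. -/
lemma cellMeasure_eq_halfOpen : cellMeasure = volume.restrict halfOpenCell := by
  refine (Measure.restrict_congr_set ?_)
  rw [unitCell_eq_preimage, halfOpenCell_eq_preimage]
  refine (EuclideanSpace.volume_preserving_symm_measurableEquiv_toLp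
    (Fin 3)).quasiMeasurePreserving.preimage_ae_eq ?_
  rw [volume_pi]
  rw [pi_univ_Icc]
  exact (Measure.univ_pi_Ioc_ae_eq_Icc (μ := fun _ : Fin 3 => (volume : Measure ℝ))
    (f := fun _ => 0) (g := fun _ => 1)).symm

instance : IsProbabilityMeasure cellMeasure := by
  constructor
  rw [cellMeasure_eq_halfOpen, Measure.restrict_apply_univ, halfOpenCell_eq_preimage]
  have := (EuclideanSpace.volume_preserving_symm_measurableEquiv_toLp
    (Fin 3)).measure_preimage (s := univ.pi fun _ => Ioc (0 : ℝ) 1)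
    (MeasurableSet.univ_pi fun _ => measurableSet_Ioc).nullMeasurableSet
  refine this.trans ?_
  simp [Real.volume_pi_Ioc]

/-- The covering map of the torus. -/
def toTorus (y : E3) : Torus3 := fun i => (y i : UnitAddCircle)

/-- The representative in `(0,1]³` of a point of the torus. -/
def torusRep (t : Torus3) : E3 :=
  WithLp.toLp 2 (UnitAddTorus.measurableEquivPiIoc (fun _ : Fin 3 => (0 : ℝ)) t).1

lemma toTorus_torusRep (t : Torus3) : toTorus (torusRep t) = t := by
  ext i
  exact (AddCircle.equivIoc (1 : ℝ) 0).symm_apply_apply (t i)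

lemma torusRep_toTorus {y : E3} (hy : y ∈ halfOpenCell) : torusRep (toTorus y) = y := by
  ext i
  have h : y i ∈ Ioc (0 : ℝ) (0 + 1) := by simpa using hy i
  have := congrArg Subtype.val
    ((AddCircle.equivIoc (1 : ℝ) 0).apply_symm_apply ⟨y i, h⟩)
  exact this

lemma torusRep_mem (t : Torus3) : torusRep t ∈ halfOpenCell := fun i => by
  have := (UnitAddTorus.measurableEquivPiIoc (fun _ : Fin 3 => (0 : ℝ)) t).2 i
  simpa [torusRep] using this

lemma measurePreserving_torusRep : MeasurePreserving torusRep torusMeasure cellMeasure := by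
  have h1 := UnitAddTorus.measurePreserving_equivPiIoc (fun _ : Fin 3 => (0 : ℝ))
  have hms : MeasurableSet {x : Fin 3 → ℝ | ∀ i, x i ∈ Ioc (0 : ℝ) (0 + 1)} := by
    have : {x : Fin 3 → ℝ | ∀ i, x i ∈ Ioc (0 : ℝ) (0 + 1)} =
      univ.pi fun _ => Ioc (0 : ℝ) (0 + 1) := by ext; simp
    rw [this]
    exact MeasurableSet.univ_pi fun _ => measurableSet_Ioc
  have h2 := measurePreserving_subtype_coe (μa := (volume : Measure (Fin 3 → ℝ))) hms
  have h3 := (PiLp.volume_preserving_toLp (Fin 3)).restrict_preimage measurableSet_halfOpenCell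
  rw [← cellMeasure_eq_halfOpen] at h3
  have e : (WithLp.toLp 2 : (Fin 3 → ℝ) → E3) ⁻¹' halfOpenCell =
    {x : Fin 3 → ℝ | ∀ i, x i ∈ Ioc (0 : ℝ) (0 + 1)} := by
    ext x; simp [halfOpenCell]
  rw [e] at h3
  exact h3.comp (h2.comp h1)

lemma measurable_toTorus : Measurable toTorus :=
  measurable_pi_lambda _ fun i => AddCircle.measurable_mk'.comp (by fun_prop)

/-- The cell measure is the image of the torus measure under `torusRep`, and `toTorus` undoes
`torusRep`. -/
lemma measurePreserving_toTorus : MeasurePreserving toTorus cellMeasure torusMeasure := by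
  refine ⟨measurable_toTorus, ?_⟩
  rw [← measurePreserving_torusRep.map_eq,
    Measure.map_map measurable_toTorus measurePreserving_torusRep.measurable]
  have : toTorus ∘ torusRep = id := funext toTorus_torusRep
  rw [this, Measure.map_id]

/-- The periodic fractional part, with values in `(0,1]³`. -/
def cellPart (y : E3) : E3 := torusRep (toTorus y)

lemma measurable_cellPart : Measurable cellPart :=
  measurePreserving_torusRep.measurable.comp measurable_toTorus

lemma toTorus_sub (y z : E3) : toTorus (y - z) = toTorus y - toTorus z := rfl
lemma toTorus_add (y z : E3) : toTorus (y + z) = toTorus y + toTorus z := rfl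

lemma toTorus_eq_iff {y z : E3} :
    toTorus y = toTorus z ↔ ∃ k : Fin 3 → ℤ, z = y + WithLp.toLp 2 fun i => (k i : ℝ) := by
  constructor
  · intro h
    have : ∀ i, ∃ n : ℤ, (n : ℝ) = z i - y i := fun i => by
      have := congrFun h i
      have h2 : ((z i - y i : ℝ) : UnitAddCircle) = 0 := by
        rw [AddCircle.coe_sub]; exact sub_eq_zero.2 this.symm
      obtain ⟨n, hn⟩ := (AddCircle.coe_eq_zero_iff (1 : ℝ)).1 h2
      exact ⟨n, by simpa using hn⟩
    choose k hk using this
    refine ⟨k, ?_⟩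
    ext i
    simp [hk]
  · rintro ⟨k, rfl⟩
    ext i
    simp [toTorus]

lemma IsYPeriodic.eq_of_toTorus_eq {α : Type*} {f : E3 → α} (hf : IsYPeriodic f) {y z : E3}
    (h : toTorus y = toTorus z) : f y = f z := by
  obtain ⟨k, rfl⟩ := toTorus_eq_iff.1 h
  exact (hf k y).symm

lemma toTorus_cellPart (y : E3) : toTorus (cellPart y) = toTorus y := toTorus_torusRep _

lemma cellPart_of_mem {y : E3} (hy : y ∈ halfOpenCell) : cellPart y = y := torusRep_toTorus hy

lemma isYPeriodic_comp_cellPart {α : Type*} (f : E3 → α) : IsYPeriodic fun y => f (cellPart y) := by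
  intro k y
  have : toTorus y = toTorus (y + WithLp.toLp 2 fun i => (k i : ℝ)) := toTorus_eq_iff.2 ⟨k, rfl⟩
  simp only [cellPart, this]

lemma ae_mem_halfOpenCell : ∀ᵐ y ∂cellMeasure, y ∈ halfOpenCell := by
  rw [cellMeasure_eq_halfOpen]
  exact ae_restrict_mem measurableSet_halfOpenCell

/-- The diameter √3 of the cell, rounded up; only a finite bound matters. -/
lemma norm_cellPart_le (y : E3) : ‖cellPart y‖ ≤ 2 := by
  have h := torusRep_mem (toTorus y)
  rw [EuclideanSpace.norm_eq, Real.sqrt_le_left (by norm_num), Fin.sum_univ_three]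
  have : ∀ i, ‖cellPart y i‖ ^ 2 ≤ 1 := fun i => by
    have := h i
    rw [Real.norm_eq_abs, sq_abs]
    have h1 : 0 < cellPart y i := this.1
    have h2 : cellPart y i ≤ 1 := this.2
    nlinarith
  linarith [this 0, this 1, this 2]

/-- Seen on the torus, the map is a translation, which preserves Haar measure. -/
lemma measurePreserving_cellPart_sub (c : E3) :
    MeasurePreserving (fun y => cellPart (y - c)) cellMeasure cellMeasure := by
  have : (fun y => cellPart (y - c)) = torusRep ∘ (fun t => t - toTorus c) ∘ toTorus := rfl
  rw [this]
  refine measurePreserving_torusRep.comp (MeasurePreserving.comp ?_ measurePreserving_toTorus)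
  let _ : MeasureSpace UnitAddCircle := ⟨AddCircle.haarAddCircle⟩
  exact measurePreserving_pi (fun _ : Fin 3 => (AddCircle.haarAddCircle : Measure UnitAddCircle))
    (fun _ => AddCircle.haarAddCircle) (f := fun i t => t - toTorus c i)
    fun i => measurePreserving_sub_right _ _

/-- The map behind periodic unfolding: the point of `x + d (0,1]³` that is congruent to `d y`
modulo `d ℤ³`. -/
def unfold (d : ℝ) (p : E3 × E3) : E3 := p.1 + d • cellPart (p.2 - d⁻¹ • p.1)

/-- The map is a composition of two skew products: for fixed x the cell variable y is translated
modulo ℤ³ to t, then for fixed t the variable x is translated by d t. Discarding t preserves measure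
because the cell has total mass 1. -/
lemma measurePreserving_unfold (d : ℝ) :
    MeasurePreserving (unfold d) ((volume : Measure E3).prod cellMeasure) volume := by
  have h1 : MeasurePreserving (fun p : E3 × E3 => (p.1, cellPart (p.2 - d⁻¹ • p.1)))
      ((volume : Measure E3).prod cellMeasure) ((volume : Measure E3).prod cellMeasure) :=
    (MeasurePreserving.id volume).skew_product
      (g := fun x y => cellPart (y - d⁻¹ • x))
      (measurable_cellPart.comp (by fun_prop))
      (ae_of_all _ fun x => (measurePreserving_cellPart_sub _).map_eq)
  have h2 : MeasurePreserving (fun p : E3 × E3 => (p.1, p.2 + d • p.1))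
      (cellMeasure.prod (volume : Measure E3)) (cellMeasure.prod (volume : Measure E3)) :=
    (MeasurePreserving.id cellMeasure).skew_product (g := fun t x => x + d • t)
      (by fun_prop)
      (ae_of_all _ fun x => (measurePreserving_add_right _ _).map_eq)
  exact (measurePreserving_snd (μ := cellMeasure)).comp (h2.comp (Measure.measurePreserving_swap.comp h1))

lemma norm_unfold_sub_le {d : ℝ} (hd : 0 ≤ d) (p : E3 × E3) : ‖unfold d p - p.1‖ ≤ 2 * d := by
  rw [unfold, add_sub_cancel_left, norm_smul, Real.norm_of_nonneg hd, mul_comm]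
  exact mul_le_mul_of_nonneg_right (norm_cellPart_le _) hd

/-- For a periodic Ψ this makes Ψ(·, unfold/d) equal to Ψ(·, y) exactly, so that unfolding perturbs
the slow variable only. -/
lemma toTorus_unfold {d : ℝ} (hd : d ≠ 0) (p : E3 × E3) :
    toTorus (d⁻¹ • unfold d p) = toTorus p.2 := by
  rw [unfold, smul_add, inv_smul_smul₀ hd, toTorus_add, toTorus_cellPart, toTorus_sub]
  abel

/-! ### Fourier basis of the cell -/

/-- The character `exp (2 π i k · y)`. -/
def cellExp (k : Fin 3 → ℤ) (y : E3) : ℂ :=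
  Complex.exp (2 * Real.pi * Complex.I * ∑ i, (k i : ℂ) * (y i : ℂ))

lemma mFourier_toTorus (k : Fin 3 → ℤ) (y : E3) :
    UnitAddTorus.mFourier k (toTorus y) = cellExp k y := by
  simp only [UnitAddTorus.mFourier, ContinuousMap.coe_mk, toTorus, fourier_coe_apply, cellExp,
    ← Complex.exp_sum, Finset.mul_sum]
  congr 1
  refine Finset.sum_congr rfl fun i _ => ?_
  push_cast
  ring

lemma isYPeriodic_cellExp (k : Fin 3 → ℤ) : IsYPeriodic (cellExp k) := by
  intro m y
  rw [← mFourier_toTorus, ← mFourier_toTorus, ← toTorus_eq_iff.2 ⟨m, rfl⟩]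

lemma contDiff_cellExp (k : Fin 3 → ℤ) : ContDiff ℝ ∞ (cellExp k) := by
  unfold cellExp
  have h : ∀ i : Fin 3, ContDiff ℝ ∞ fun y : E3 => ((y i : ℝ) : ℂ) := fun i =>
    Complex.ofRealCLM.contDiff.comp (by fun_prop)
  exact (contDiff_const.mul (ContDiff.sum fun i _ => contDiff_const.mul (h i))).cexp

lemma norm_cellExp (k : Fin 3 → ℤ) (y : E3) : ‖cellExp k y‖ = 1 := by
  rw [cellExp, Complex.norm_exp]
  have : (2 * Real.pi * Complex.I * ∑ i, (k i : ℂ) * (y i : ℂ)) =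
    ((2 * Real.pi * ∑ i, (k i : ℝ) * y i : ℝ) : ℂ) * Complex.I := by
    push_cast; ring
  rw [this]
  simp

lemma conj_cellExp (k : Fin 3 → ℤ) (y : E3) :
    (starRingEnd ℂ) (cellExp k y) = cellExp (-k) y := by
  rw [← mFourier_toTorus, ← mFourier_toTorus, UnitAddTorus.mFourier_neg]

lemma memLp_cellExp (k : Fin 3 → ℤ) {p : ENNReal} : MemLp (cellExp k) p cellMeasure :=
  (memLp_top_of_bound (contDiff_cellExp k).continuous.aestronglyMeasurable 1
    (ae_of_all _ fun y => (norm_cellExp k y).le)).mono_exponent le_top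

/-- The Fourier basis of `L²(Y)`. -/
theorem exists_cellBasis : ∃ b : HilbertBasis (Fin 3 → ℤ) ℂ (Lp ℂ 2 cellMeasure),
    ∀ k, b k = (memLp_cellExp k).toLp (cellExp k) := by
  -- Composition with the covering map carries the Fourier basis of the torus to the functions
  -- `cellExp k`. It is onto because `torusRep` inverts the covering map almost everywhere on the
  -- cell.
  let V := Lp.compMeasurePreservingₗᵢ (E := ℂ) (p := 2) ℂ toTorus measurePreserving_toTorus
  have hV : ∀ k, V (UnitAddTorus.mFourierLp 2 k) = (memLp_cellExp k).toLp (cellExp k) := by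
    intro k
    apply Lp.ext
    refine (Lp.coeFn_compMeasurePreserving _ measurePreserving_toTorus).trans ?_
    refine (measurePreserving_toTorus.quasiMeasurePreserving.ae_eq_comp
      (UnitAddTorus.coeFn_mFourierLp 2 k)).trans ?_
    refine EventuallyEq.trans ?_ (MemLp.coeFn_toLp _).symm
    exact ae_of_all _ fun y => mFourier_toTorus k y
  have hsurj : Function.Surjective V := by
    intro f
    refine ⟨Lp.compMeasurePreserving torusRep measurePreserving_torusRep f, ?_⟩
    apply Lp.ext
    refine (Lp.coeFn_compMeasurePreserving _ measurePreserving_toTorus).trans ?_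
    refine (measurePreserving_toTorus.quasiMeasurePreserving.ae_eq_comp
      (Lp.coeFn_compMeasurePreserving f measurePreserving_torusRep)).trans ?_
    filter_upwards [ae_mem_halfOpenCell] with y hy
    simp [torusRep_toTorus hy]
  let e := LinearIsometryEquiv.ofSurjective V hsurj
  refine ⟨HilbertBasis.ofRepr (e.symm.trans UnitAddTorus.mFourierBasis.repr), fun k => ?_⟩
  rw [← hV]
  rw [← HilbertBasis.repr_symm_single]
  change e (UnitAddTorus.mFourierBasis.repr.symm (lp.single 2 k 1)) = _
  rw [HilbertBasis.repr_symm_single, UnitAddTorus.coe_mFourierBasis]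
  rfl

/-! ### Square integrable functions -/

section L2

variable {α : Type*} [MeasurableSpace α] {μ : Measure α}
  {F : Type*} [NormedAddCommGroup F] [InnerProductSpace ℂ F]

lemma inner_toLp {f g : α → F} (hf : MemLp f 2 μ) (hg : MemLp g 2 μ) :
    inner ℂ (hf.toLp f) (hg.toLp g) = ∫ x, inner ℂ (f x) (g x) ∂μ := by
  rw [L2.inner_def]
  refine integral_congr_ae ?_
  filter_upwards [hf.coeFn_toLp, hg.coeFn_toLp] with x h1 h2
  rw [h1, h2]

lemma integrable_inner_of_memLp {f g : α → F} (hf : MemLp f 2 μ) (hg : MemLp g 2 μ) :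
    Integrable (fun x => inner ℂ (f x) (g x)) μ := by
  refine (L2.integrable_inner (𝕜 := ℂ) (hf.toLp f) (hg.toLp g)).congr ?_
  filter_upwards [hf.coeFn_toLp, hg.coeFn_toLp] with x h1 h2
  rw [h1, h2]

lemma norm_integral_inner_le {f g : α → F} (hf : MemLp f 2 μ) (hg : MemLp g 2 μ) :
    ‖∫ x, inner ℂ (f x) (g x) ∂μ‖ ≤ (eLpNorm f 2 μ).toReal * (eLpNorm g 2 μ).toReal := by
  rw [← inner_toLp hf hg, ← Lp.norm_toLp f hf, ← Lp.norm_toLp g hg]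
  exact norm_inner_le_norm _ _

lemma tendsto_eLpNorm_two_of_dominated {E ι : Type*} [NormedAddCommGroup E] {l : Filter ι}
    [l.IsCountablyGenerated] {f : ι → α → E} (b : α → ENNReal)
    (hf : ∀ᶠ n in l, AEStronglyMeasurable (f n) μ) (hb : ∀ᶠ n in l, ∀ᵐ x ∂μ, ‖f n x‖ₑ ≤ b x)
    (hfin : ∫⁻ x, b x ^ 2 ∂μ ≠ ⊤) (hlim : ∀ᵐ x ∂μ, Tendsto (fun n => f n x) l (𝓝 0)) :
    Tendsto (fun n => eLpNorm (f n) 2 μ) l (𝓝 0) := by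
  have h : Tendsto (fun n => ∫⁻ x, ‖f n x‖ₑ ^ 2 ∂μ) l (𝓝 (∫⁻ _, 0 ∂μ)) := by
    refine tendsto_lintegral_filter_of_dominated_convergence' (fun x => b x ^ 2)
      (hf.mono fun n h => h.enorm.pow_const 2)
      (hb.mono fun n h => h.mono fun x hx => pow_le_pow_left' hx 2) hfin ?_
    filter_upwards [hlim] with x hx
    have := (ENNReal.continuous_pow 2).tendsto 0 |>.comp
      ((continuous_enorm.tendsto (0 : E)).comp hx |>.trans_eq (by simp))
    simpa [Function.comp_def] using this
  rw [lintegral_zero] at h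
  have h2 := (ENNReal.continuous_rpow_const (y := 1 / 2)).tendsto 0 |>.comp h
  rw [ENNReal.zero_rpow_of_pos (by norm_num)] at h2
  refine h2.congr fun n => ?_
  rw [eLpNorm_eq_lintegral_rpow_enorm_toReal (by norm_num) (by norm_num)]
  simp

end L2

/-- Bounded sequences in a separable Hilbert space have weakly convergent subsequences. -/
theorem exists_weakly_convergent_subseq {H : Type*} [NormedAddCommGroup H] [InnerProductSpace ℂ H]
    [CompleteSpace H] [TopologicalSpace.SeparableSpace H] (U : ℕ → H) (M : ℝ)
    (hM : ∀ n, ‖U n‖ ≤ M) :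
    ∃ ι : ℕ → ℕ, StrictMono ι ∧ ∃ u : H, ∀ g : H,
      Tendsto (fun n => inner ℂ g (U (ι n))) atTop (𝓝 (inner ℂ g u)) := by
  -- Sequential Banach–Alaoglu in the dual, transported by the Riesz isomorphism. That isomorphism
  -- is conjugate linear, hence the conjugations below.
  have hc := WeakDual.isSeqCompact_closedBall ℂ H 0 M
  obtain ⟨w, -, ι, hι, hw⟩ := hc
    (x := fun n => StrongDual.toWeakDual (InnerProductSpace.toDual ℂ H (U n)))
    (fun n => by simpa using hM n)
  refine ⟨ι, hι, (InnerProductSpace.toDual ℂ H).symm (WeakDual.toStrongDual w), fun g => ?_⟩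
  have h1 := (WeakDual.eval_continuous g).continuousAt.tendsto.comp hw
  have h2 := (Complex.continuous_conj.tendsto _).comp h1
  rw [← inner_conj_symm, InnerProductSpace.toDual_symm_apply]
  refine h2.congr fun n => ?_
  rw [← inner_conj_symm]
  rfl

/-! ### Conjugation on `ℂ³` -/

/-- Componentwise complex conjugation. -/
def conjV (v : C3) : C3 := WithLp.toLp 2 fun i => (starRingEnd ℂ) (v i)

/-- Converts the bilinear pairing of two-scale convergence into the Hermitian one, for which Hilbert
space tools are available. -/
lemma dot_eq_inner (u v : C3) : dot u v = inner ℂ (conjV v) u := by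
  simp [dot, conjV, PiLp.inner_apply]

lemma norm_conjV (v : C3) : ‖conjV v‖ = ‖v‖ := by
  simp [EuclideanSpace.norm_eq, conjV]

lemma continuous_conjV : Continuous conjV := by
  unfold conjV; fun_prop

lemma dot_zero (u : C3) : dot u 0 = 0 := by simp [dot]

lemma zero_dot (u : C3) : dot 0 u = 0 := by simp [dot]

lemma dot_sub (u v w : C3) : dot u (v - w) = dot u v - dot u w := by
  simp [dot, mul_sub, Finset.sum_sub_distrib]

section Dot

variable {α : Type*} [MeasurableSpace α] {μ : Measure α} {p : ENNReal}

lemma aestronglyMeasurable_dot {f g : α → C3} (hf : AEStronglyMeasurable f μ)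
    (hg : AEStronglyMeasurable g μ) : AEStronglyMeasurable (fun x => dot (f x) (g x)) μ := by
  simp only [dot_eq_inner]
  exact (continuous_conjV.comp_aestronglyMeasurable hg).inner hf

lemma memLp_conjV {f : α → C3} (hf : MemLp f p μ) : MemLp (fun x => conjV (f x)) p μ :=
  hf.congr_norm (continuous_conjV.comp_aestronglyMeasurable hf.1)
    (ae_of_all _ fun _ => (norm_conjV _).symm)

lemma eLpNorm_conjV (f : α → C3) : eLpNorm (fun x => conjV (f x)) p μ = eLpNorm f p μ :=
  eLpNorm_congr_norm_ae (ae_of_all _ fun _ => norm_conjV _)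

lemma integrable_dot {f g : α → C3} (hf : MemLp f 2 μ) (hg : MemLp g 2 μ) :
    Integrable (fun x => dot (f x) (g x)) μ := by
  simp_rw [dot_eq_inner]
  exact integrable_inner_of_memLp (memLp_conjV hg) hf

lemma norm_integral_dot_le {f g : α → C3} (hf : MemLp f 2 μ) (hg : MemLp g 2 μ) :
    ‖∫ x, dot (f x) (g x) ∂μ‖ ≤ (eLpNorm f 2 μ).toReal * (eLpNorm g 2 μ).toReal := by
  simp_rw [dot_eq_inner]
  refine (norm_integral_inner_le (memLp_conjV hg) hf).trans_eq ?_
  rw [eLpNorm_conjV, mul_comm]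

end Dot

/-! ### Two-scale compactness -/

/-- Periodicity confines y to a bounded set and the support confines x, so compactness gives the
bound. -/
lemma IsTwoScaleTest.exists_bound {Ω : Set E3} (hΩ : Bornology.IsBounded Ω) {Ψ : E3 → E3 → C3}
    (hΨ : IsTwoScaleTest Ω Ψ) : ∃ C : ℝ, 0 ≤ C ∧ ∀ x y, ‖Ψ x y‖ ≤ C := by
  obtain ⟨R, hR⟩ := hΩ.subset_closedBall 0
  obtain ⟨C, hC⟩ := ((isCompact_closedBall (0 : E3) R).prod
    (isCompact_closedBall (0 : E3) 2)).exists_bound_of_continuousOn hΨ.1.continuousOn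
  refine ⟨max C 0, le_max_right _ _, fun x y => ?_⟩
  by_cases hx : x ∈ Ω
  · rw [(hΨ.2.1 x).eq_of_toTorus_eq (toTorus_cellPart y).symm]
    refine (hC (x, cellPart y) ⟨hR hx, ?_⟩).trans (le_max_left _ _)
    simpa using norm_cellPart_le y
  · rw [hΨ.2.2 x hx y, norm_zero]; exact le_max_right _ _

lemma TwoScaleConverges.subseq {Ω : Set E3} {d : ℕ → ℝ} {u : ℕ → E3 → C3} {u₀ : E3 → E3 → C3}
    (h : TwoScaleConverges Ω d u u₀) {ι : ℕ → ℕ} (hι : StrictMono ι) :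
    TwoScaleConverges Ω (fun n => d (ι n)) (fun n => u (ι n)) u₀ :=
  ⟨fun _ => h.1 _, h.2.1, fun Ψ hΨ => (h.2.2 Ψ hΨ).comp hι.tendsto_atTop⟩

/-! ### Periodic unfolding -/

/-- The unfolded field `(x, y) ↦ u (unfold d (x, y))`, with `u` extended by zero outside `Ω`. -/
def unfoldField (Ω : Set E3) (d : ℝ) (u : E3 → C3) (p : E3 × E3) : C3 :=
  Ω.indicator u (unfold d p)

section

variable {Ω : Set E3} {d : ℝ} {u : E3 → C3}

lemma memLp_unfoldField (hΩ : MeasurableSet Ω) (hu : MemLp u 2 (volume.restrict Ω)) :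
    MemLp (unfoldField Ω d u) 2 ((volume : Measure E3).prod cellMeasure) :=
  ((memLp_indicator_iff_restrict hΩ).2 hu).comp_measurePreserving (measurePreserving_unfold d)

lemma eLpNorm_unfoldField (hΩ : MeasurableSet Ω) (hu : MemLp u 2 (volume.restrict Ω)) :
    eLpNorm (unfoldField Ω d u) 2 ((volume : Measure E3).prod cellMeasure) =
      eLpNorm u 2 (volume.restrict Ω) := by
  rw [← eLpNorm_indicator_eq_eLpNorm_restrict hΩ]
  exact eLpNorm_comp_measurePreserving ((memLp_indicator_iff_restrict hΩ).2 hu).1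
    (measurePreserving_unfold d)

/-- Change of variables along `unfold`, after which periodicity replaces the fast argument by y. -/
lemma integral_dot_eq_unfold (hΩ : MeasurableSet Ω) (hd : d ≠ 0)
    (hu : MemLp u 2 (volume.restrict Ω)) {Ψ : E3 → E3 → C3} (hΨ : IsTwoScaleTest Ω Ψ) :
    ∫ x in Ω, dot (u x) (Ψ x (d⁻¹ • x)) =
      ∫ p, dot (unfoldField Ω d u p) (Ψ (unfold d p) p.2)
        ∂((volume : Measure E3).prod cellMeasure) := by
  have h1 : ∫ x in Ω, dot (u x) (Ψ x (d⁻¹ • x)) =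
      ∫ x, dot (Ω.indicator u x) (Ψ x (d⁻¹ • x)) := by
    rw [← integral_indicator hΩ]
    refine integral_congr_ae (ae_of_all _ fun x => ?_)
    by_cases hx : x ∈ Ω <;> simp [hx, zero_dot]
  have hmp := measurePreserving_unfold d
  have hcont : Continuous fun x => Ψ x (d⁻¹ • x) :=
    hΨ.1.comp (continuous_id.prodMk (continuous_const_smul _))
  have hm : AEStronglyMeasurable (fun x => dot (Ω.indicator u x) (Ψ x (d⁻¹ • x))) volume :=
    aestronglyMeasurable_dot ((memLp_indicator_iff_restrict hΩ).2 hu).1 hcont.aestronglyMeasurable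
  have h2 := integral_map hmp.aemeasurable (by rwa [hmp.map_eq])
  rw [hmp.map_eq] at h2
  rw [h1, h2]
  refine integral_congr_ae (ae_of_all _ fun p => ?_)
  simp only [unfoldField]
  rw [(hΨ.2.1 _).eq_of_toTorus_eq (toTorus_unfold hd p)]

end

/-- Unfolding moves a point by at most 2d. The differences therefore tend to zero pointwise, are
bounded by 2C, and vanish for x outside the ball of radius R + 2D, where D bounds all scales;
dominated convergence applies. -/
lemma IsTwoScaleTest.tendsto_unfold {Ω : Set E3} (hΩb : Bornology.IsBounded Ω) {d : ℕ → ℝ}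
    (hd : ∀ n, 0 < d n) (hd0 : Tendsto d atTop (𝓝 0)) {Ψ : E3 → E3 → C3}
    (hΨ : IsTwoScaleTest Ω Ψ) :
    (∀ n, MemLp (fun p : E3 × E3 => Ψ (unfold (d n) p) p.2 - Ψ p.1 p.2) 2
      ((volume : Measure E3).prod cellMeasure)) ∧
    Tendsto (fun n => eLpNorm (fun p : E3 × E3 => Ψ (unfold (d n) p) p.2 - Ψ p.1 p.2) 2
      ((volume : Measure E3).prod cellMeasure)) atTop (𝓝 0) := by
  obtain ⟨C, hC0, hC⟩ := hΨ.exists_bound hΩb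
  obtain ⟨R, hR⟩ := hΩb.subset_closedBall 0
  obtain ⟨D, hD⟩ := hd0.bddAbove_range
  have hDn : ∀ n, d n ≤ D := fun n => hD ⟨n, rfl⟩
  let K : Set (E3 × E3) := Metric.closedBall 0 (R + 2 * D) ×ˢ univ
  have hK : MeasurableSet K := measurableSet_closedBall.prod MeasurableSet.univ
  have hKfin : ((volume : Measure E3).prod cellMeasure) K ≠ ⊤ := by
    rw [Measure.prod_prod]
    exact ENNReal.mul_ne_top measure_closedBall_lt_top.ne (measure_ne_top _ _)
  have hmeas : ∀ n, Measurable fun p : E3 × E3 => Ψ (unfold (d n) p) p.2 - Ψ p.1 p.2 := fun n => by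
    have h1 : Measurable fun p : E3 × E3 => (unfold (d n) p, p.2) :=
      (measurePreserving_unfold (d n)).measurable.prodMk measurable_snd
    exact (hΨ.1.measurable.comp h1).sub hΨ.1.measurable
  have hbound : ∀ n p, ‖Ψ (unfold (d n) p) p.2 - Ψ p.1 p.2‖ ≤ K.indicator (fun _ => 2 * C) p := by
    intro n p
    by_cases hp : p ∈ K
    · rw [indicator_of_mem hp]
      exact (norm_sub_le _ _).trans (by linarith [hC (unfold (d n) p) p.2, hC p.1 p.2])
    · have hp1 : R + 2 * D < ‖p.1‖ := by simpa [K] using hp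
      have h1 : p.1 ∉ Ω := fun h => by
        have := hR h
        rw [mem_closedBall_zero_iff] at this
        linarith [hd 0, hDn 0]
      have h2 : unfold (d n) p ∉ Ω := fun h => by
        have := hR h
        rw [mem_closedBall_zero_iff] at this
        have h3 := norm_unfold_sub_le (hd n).le p
        have h4 := norm_sub_norm_le p.1 (unfold (d n) p)
        rw [norm_sub_rev] at h4
        linarith [hDn n]
      rw [hΨ.2.2 _ h1, hΨ.2.2 _ h2, indicator_of_notMem hp]
      simp
  have hind : MemLp (K.indicator fun _ => 2 * C) 2 ((volume : Measure E3).prod cellMeasure) :=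
    memLp_indicator_const 2 hK _ (Or.inr hKfin)
  refine ⟨fun n => hind.mono (hmeas n).aestronglyMeasurable (ae_of_all _ fun p => ?_), ?_⟩
  · exact (hbound n p).trans (le_abs_self _)
  refine tendsto_eLpNorm_two_of_dominated (fun p => ‖K.indicator (fun _ => 2 * C) p‖ₑ)
    (Eventually.of_forall fun n => (hmeas n).aestronglyMeasurable)
    (Eventually.of_forall fun n => ae_of_all _ fun p => ?_) ?_ (ae_of_all _ fun p => ?_)
  · exact enorm_le_iff_norm_le.2 ((hbound n p).trans (le_abs_self _))
  · have := (lintegral_rpow_enorm_lt_top_of_eLpNorm_lt_top (by norm_num) (by norm_num) hind.2).ne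
    simpa using this
  · have hu : Tendsto (fun n => unfold (d n) p) atTop (𝓝 p.1) := by
      rw [tendsto_iff_norm_sub_tendsto_zero]
      refine squeeze_zero (fun _ => norm_nonneg _) (fun n => norm_unfold_sub_le (hd n).le p) ?_
      simpa using hd0.const_mul 2
    have h2 : Tendsto (fun n => (unfold (d n) p, p.2)) atTop (𝓝 p) :=
      hu.prodMk_nhds tendsto_const_nhds
    have h3 := (hΨ.1.tendsto p).comp h2
    have h4 := h3.sub_const (Ψ p.1 p.2)
    simpa [Function.uncurry] using h4

lemma IsTwoScaleTest.memLp {Ω : Set E3} (hΩb : Bornology.IsBounded Ω)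
    {Ψ : E3 → E3 → C3} (hΨ : IsTwoScaleTest Ω Ψ) :
    MemL2Prod Ω Ψ := by
  obtain ⟨C, -, hC⟩ := hΨ.exists_bound hΩb
  have : IsFiniteMeasure (volume.restrict Ω) := ⟨by
    rw [Measure.restrict_apply_univ]; exact hΩb.measure_lt_top⟩
  exact (memLp_top_of_bound hΨ.1.aestronglyMeasurable C
    (ae_of_all _ fun p => hC _ _)).mono_exponent le_top

lemma secondCountableTopology_Lp_two (P : Measure (E3 × E3)) [SFinite P] :
    SecondCountableTopology (Lp C3 2 P) := by
  have : Fact ((2 : ENNReal) ≠ ⊤) := ⟨by norm_num⟩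
  have : MeasureTheory.IsSeparable P := inferInstance
  exact Lp.SecondCountableTopology

/-- Bounded sequences in `L²(Ω)` have two-scale convergent subsequences. -/
theorem exists_twoScaleConverges_subseq {Ω : Set E3} (hΩ : MeasurableSet Ω)
    (hΩb : Bornology.IsBounded Ω) {d : ℕ → ℝ} (hd : ∀ n, 0 < d n) (hd0 : Tendsto d atTop (𝓝 0))
    {u : ℕ → E3 → C3} (hu : ∀ n, MemLp (u n) 2 (volume.restrict Ω)) (M : ℝ)
    (hM : ∀ n, (eLpNorm (u n) 2 (volume.restrict Ω)).toReal ≤ M) :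
    ∃ ι : ℕ → ℕ, StrictMono ι ∧ ∃ u₀ : E3 → E3 → C3,
      TwoScaleConverges Ω (fun n => d (ι n)) (fun n => u (ι n)) u₀ := by
  -- Unfolded fields may spill over ∂Ω by O(d). The change of variables therefore uses `Q` on all of
  -- ℝ³ × Y, while the weak limit is taken in L² of `P` on Ω × Y. The two agree against Ψ(x, y),
  -- which vanishes for x outside Ω.
  let Q := (volume : Measure E3).prod cellMeasure
  let P := (volume.restrict Ω).prod cellMeasure
  have hPQ : P = Q.restrict (Ω ×ˢ univ) := by
    rw [← Measure.prod_restrict, Measure.restrict_univ]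
  have hPle : P ≤ Q := hPQ ▸ Measure.restrict_le_self
  have hUQ := fun n => memLp_unfoldField (d := d n) hΩ (hu n)
  have hUP : ∀ n, MemLp (unfoldField Ω (d n) (u n)) 2 P := fun n => (hUQ n).mono_measure hPle
  have : IsFiniteMeasure (volume.restrict Ω) := ⟨by
    rw [Measure.restrict_apply_univ]; exact hΩb.measure_lt_top⟩
  have : IsFiniteMeasure P := inferInstanceAs (IsFiniteMeasure ((volume.restrict Ω).prod _))
  have : SecondCountableTopology (Lp C3 2 P) := secondCountableTopology_Lp_two P
  obtain ⟨ι, hι, v, hv⟩ := exists_weakly_convergent_subseq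
    (fun n => (hUP n).toLp (unfoldField Ω (d n) (u n))) M (fun n => by
      rw [Lp.norm_toLp]
      refine le_trans (ENNReal.toReal_mono (hUQ n).2.ne (eLpNorm_mono_measure _ hPle)) ?_
      rw [eLpNorm_unfoldField hΩ (hu n)]
      exact hM n)
  refine ⟨ι, hι, fun x y => v (x, y), fun n => hu _, Lp.memLp v, fun Ψ hΨ => ?_⟩
  have hΨP : MemLp (Function.uncurry Ψ) 2 P := hΨ.memLp hΩb
  have hlim : Tendsto (fun n => ∫ p, dot (unfoldField Ω (d (ι n)) (u (ι n)) p) (Ψ p.1 p.2) ∂P)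
      atTop (𝓝 (∫ x in Ω, ∫ y in unitCell, dot (v (x, y)) (Ψ x y))) := by
    have h1 := hv ((memLp_conjV hΨP).toLp _)
    have h2 : ∫ x in Ω, ∫ y in unitCell, dot (v (x, y)) (Ψ x y) =
        inner ℂ ((memLp_conjV hΨP).toLp _) v := by
      have := integral_prod (fun p => dot (v p) (Ψ p.1 p.2))
        (integrable_dot (Lp.memLp v) hΨP)
      rw [← this, L2.inner_def]
      refine integral_congr_ae ?_
      filter_upwards [(memLp_conjV hΨP).coeFn_toLp] with p hp
      rw [hp, dot_eq_inner]
      rfl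
    rw [h2]
    refine h1.congr fun n => ?_
    rw [inner_toLp]
    simp_rw [dot_eq_inner]
    rfl
  have hιd0 : Tendsto (fun n => d (ι n)) atTop (𝓝 0) := hd0.comp hι.tendsto_atTop
  obtain ⟨hW, hW0⟩ := hΨ.tendsto_unfold hΩb (fun n => hd (ι n)) hιd0
  have hΨQ : MemLp (Function.uncurry Ψ) 2 Q := by
    have hind : (Ω ×ˢ univ).indicator (Function.uncurry Ψ) = Function.uncurry Ψ := by
      refine indicator_eq_self.2 fun p hp => ⟨?_, mem_univ _⟩
      by_contra h
      exact hp (hΨ.2.2 _ h _)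
    rw [← hind, memLp_indicator_iff_restrict (hΩ.prod MeasurableSet.univ), ← hPQ]
    exact hΨP
  -- Cauchy–Schwarz: a bounded factor against the vanishing displacement error of the test function.
  have hdiff : Tendsto (fun n => ∫ p, dot (unfoldField Ω (d (ι n)) (u (ι n)) p)
      (Ψ (unfold (d (ι n)) p) p.2 - Ψ p.1 p.2) ∂Q) atTop (𝓝 0) := by
    have hW1 := (ENNReal.tendsto_toReal ENNReal.zero_ne_top).comp hW0
    have hW2 := hW1.const_mul M
    rw [ENNReal.toReal_zero, mul_zero] at hW2
    refine squeeze_zero_norm (fun n => ?_) hW2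
    refine (norm_integral_dot_le (hUQ _) (hW n)).trans ?_
    rw [eLpNorm_unfoldField hΩ (hu _)]
    exact mul_le_mul_of_nonneg_right (hM _) ENNReal.toReal_nonneg
  have hsum := hdiff.add hlim
  rw [zero_add] at hsum
  refine hsum.congr fun n => ?_
  rw [integral_dot_eq_unfold hΩ (hd _).ne' (hu _) hΨ]
  have hP2 : ∫ p, dot (unfoldField Ω (d (ι n)) (u (ι n)) p) (Ψ p.1 p.2) ∂P =
      ∫ p, dot (unfoldField Ω (d (ι n)) (u (ι n)) p) (Ψ p.1 p.2) ∂Q := by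
    rw [hPQ]
    refine setIntegral_eq_integral_of_forall_compl_eq_zero fun p hp => ?_
    have : p.1 ∉ Ω := fun h => hp ⟨h, mem_univ _⟩
    rw [hΨ.2.2 _ this, dot_zero]
  rw [hP2]
  refine (integral_add (integrable_dot (hUQ _) (hW n)) (integrable_dot (hUQ _) hΨQ)).symm.trans ?_
  refine integral_congr_ae (ae_of_all _ fun p => ?_)
  simp only [dot_sub, Function.uncurry, sub_add_cancel]

/-! ### Fourier series on the cell -/

/-! ### Square integrable functions on a product -/

section General

variable {α : Type*} [MeasurableSpace α] {μ : Measure α} {E : Type*} [NormedAddCommGroup E]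

lemma eLpNorm_two_sq (f : α → E) : eLpNorm f 2 μ ^ 2 = ∫⁻ x, ‖f x‖ₑ ^ 2 ∂μ := by
  have := eLpNorm_nnreal_pow_eq_lintegral (μ := μ) (f := f) (p := 2) (by norm_num)
  simpa using this

lemma tendsto_eLpNorm_two_of_sq {ι : Type*} {l : Filter ι} {f : ι → α → E}
    (h : Tendsto (fun n => eLpNorm (f n) 2 μ ^ 2) l (𝓝 0)) :
    Tendsto (fun n => eLpNorm (f n) 2 μ) l (𝓝 0) := by
  have h2 := (ENNReal.continuous_rpow_const (y := 1 / 2)).tendsto 0 |>.comp h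
  rw [ENNReal.zero_rpow_of_pos (by norm_num)] at h2
  refine h2.congr fun n => ?_
  rw [Function.comp_apply, ← ENNReal.rpow_natCast, ← ENNReal.rpow_mul]
  norm_num

/-- The infimum over s has integral zero. This supplies an approximant for almost every x, with an
index depending on x and δ, and avoids extracting an almost everywhere convergent subsequence. -/
lemma ae_forall_exists_lt {ι : Type*} [Countable ι] {l : Filter ι} [l.NeBot]
    {A : ι → α → ENNReal} (hA : ∀ s, AEMeasurable (A s) μ)
    (h : Tendsto (fun s => ∫⁻ x, A s x ∂μ) l (𝓝 0)) :
    ∀ᵐ x ∂μ, ∀ δ : ENNReal, 0 < δ → ∃ s, A s x < δ := by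
  have h1 : ∫⁻ x, ⨅ s, A s x ∂μ = 0 :=
    le_antisymm (ge_of_tendsto' h fun s => lintegral_mono fun x => iInf_le _ s) zero_le
  rw [lintegral_eq_zero_iff' (AEMeasurable.iInf hA)] at h1
  filter_upwards [h1] with x hx δ hδ
  simp only [Pi.zero_apply] at hx
  exact iInf_lt_iff.1 (hx ▸ hδ)

/-- The Cauchy criterion for unconditional sums; for orthogonal terms the hypothesis is Pythagoras.
-/
lemma summable_of_norm_sum_sq_le {ι : Type*} [CompleteSpace E] {v : ι → E} {g : ι → ℝ}
    (hg : Summable g) (h : ∀ t : Finset ι, ‖∑ k ∈ t, v k‖ ^ 2 ≤ ∑ k ∈ t, g k) : Summable v := by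
  rw [summable_iff_vanishing_norm]
  intro ε hε
  obtain ⟨s, hs⟩ := summable_iff_vanishing_norm.1 hg (ε ^ 2) (by positivity)
  refine ⟨s, fun t ht => ?_⟩
  have h1 := (h t).trans_lt ((le_abs_self _).trans_lt (hs t ht))
  exact lt_of_pow_lt_pow_left₀ 2 hε.le h1

lemma tendsto_sum_of_hasSum {ι : Type*} {v : ι → E} {w : E} (h : HasSum v w) :
    Tendsto (fun s : Finset ι => ∑ k ∈ s, v k) atTop (𝓝 w) := by
  simpa only [HasSum, SummationFilter.unconditional_filter] using h

lemma ae_memLp_slice {β : Type*} [MeasurableSpace β] {ν : Measure β} [SFinite ν] [SFinite μ]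
    {f : α → β → E} (hf : MemLp (Function.uncurry f) 2 (μ.prod ν)) :
    ∀ᵐ x ∂μ, MemLp (f x) 2 ν := by
  have h1 : ∫⁻ x, ∫⁻ y, ‖f x y‖ₑ ^ 2 ∂ν ∂μ ≠ ⊤ := by
    have := eLpNorm_two_sq (μ := μ.prod ν) (Function.uncurry f)
    rw [lintegral_prod _ (hf.1.enorm.pow_const 2)] at this
    exact (this ▸ ENNReal.pow_lt_top hf.2).ne
  filter_upwards [ae_lt_top' (hf.1.enorm.pow_const 2).lintegral_prod_right' h1,
    hf.1.prodMk_left] with x hx hm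
  refine ⟨hm, ?_⟩
  have := eLpNorm_two_sq (μ := ν) (f x)
  by_contra hcon
  rw [not_lt_top_iff] at hcon
  rw [hcon] at this
  simp [← this] at hx

lemma eLpNorm_prod_sq {β : Type*} [MeasurableSpace β] {ν : Measure β} [SFinite ν] [SFinite μ]
    {f : α × β → E} (hf : AEStronglyMeasurable f (μ.prod ν)) :
    eLpNorm f 2 (μ.prod ν) ^ 2 = ∫⁻ x, eLpNorm (fun y => f (x, y)) 2 ν ^ 2 ∂μ := by
  simp_rw [eLpNorm_two_sq]
  exact lintegral_prod _ (hf.enorm.pow_const 2)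

lemma aemeasurable_eLpNorm_slice_sq {β : Type*} [MeasurableSpace β] {ν : Measure β} [SFinite ν]
    [SFinite μ] {f : α × β → E} (hf : AEStronglyMeasurable f (μ.prod ν)) :
    AEMeasurable (fun x => eLpNorm (fun y => f (x, y)) 2 ν ^ 2) μ := by
  simp_rw [eLpNorm_two_sq]
  exact (hf.enorm.pow_const 2).lintegral_prod_right'

end General

/-- Fourier coefficients on the cell. -/
def cellCoeff (f : E3 → ℂ) (k : Fin 3 → ℤ) : ℂ := ∫ y, cellExp (-k) y * f y ∂cellMeasure

section Slices

variable {f : E3 → ℂ}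

lemma memLp_cellSum (c : (Fin 3 → ℤ) → ℂ) (s : Finset (Fin 3 → ℤ)) {p : ENNReal} :
    MemLp (fun y => ∑ k ∈ s, c k * cellExp k y) p cellMeasure :=
  memLp_finsetSum s fun k _ => (memLp_cellExp k).const_mul (c k)

lemma toLp_cellSum {b : HilbertBasis (Fin 3 → ℤ) ℂ (Lp ℂ 2 cellMeasure)}
    (hb : ∀ k, b k = (memLp_cellExp k).toLp (cellExp k))
    (c : (Fin 3 → ℤ) → ℂ) (s : Finset (Fin 3 → ℤ)) :
    (memLp_cellSum c s).toLp _ = ∑ k ∈ s, c k • b k := by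
  classical
  induction s using Finset.induction_on with
  | empty => simp
  | insert k s hk ih =>
    rw [Finset.sum_insert hk, ← ih, hb, ← MemLp.toLp_const_smul, ← MemLp.toLp_add]
    simp_rw [Finset.sum_insert hk]
    rfl

lemma eLpNorm_cellSum_sq (c : (Fin 3 → ℤ) → ℂ) (s : Finset (Fin 3 → ℤ)) :
    eLpNorm (fun y => ∑ k ∈ s, c k * cellExp k y) 2 cellMeasure ^ 2 = ∑ k ∈ s, ‖c k‖ₑ ^ 2 := by
  obtain ⟨b, hb⟩ := exists_cellBasis
  have h1 := toLp_cellSum hb c s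
  have h2 : ‖∑ k ∈ s, c k • b k‖ ^ 2 = ∑ k ∈ s, ‖c k‖ ^ 2 := by
    have := b.orthonormal.inner_sum c c s
    rw [inner_self_eq_norm_sq_to_K] at this
    have h3 : ∀ k, (starRingEnd ℂ) (c k) * c k = ((‖c k‖ ^ 2 : ℝ) : ℂ) := fun k => by
      rw [← Complex.normSq_eq_conj_mul_self, Complex.normSq_eq_norm_sq]
    simp_rw [h3, ← Complex.ofReal_sum] at this
    refine Complex.ofReal_injective ?_
    rw [Complex.ofReal_pow]
    exact this
  rw [← h1, Lp.norm_toLp] at h2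
  have hfin : eLpNorm (fun y => ∑ k ∈ s, c k * cellExp k y) 2 cellMeasure ≠ ⊤ :=
    (memLp_cellSum c s).2.ne
  rw [← ENNReal.toReal_pow] at h2
  rw [← ENNReal.ofReal_toReal (ENNReal.pow_ne_top hfin (n := 2)), h2,
    ENNReal.ofReal_sum_of_nonneg fun k _ => by positivity]
  refine Finset.sum_congr rfl fun k _ => ?_
  rw [ENNReal.ofReal_pow (norm_nonneg _), ofReal_norm]

lemma basis_inner_toLp {b : HilbertBasis (Fin 3 → ℤ) ℂ (Lp ℂ 2 cellMeasure)}
    (hb : ∀ k, b k = (memLp_cellExp k).toLp (cellExp k)) (hf : MemLp f 2 cellMeasure)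
    (k : Fin 3 → ℤ) : inner ℂ (b k) (hf.toLp f) = cellCoeff f k := by
  rw [hb, inner_toLp]
  refine integral_congr_ae (ae_of_all _ fun y => ?_)
  simp only [RCLike.inner_apply, conj_cellExp]
  ring

lemma sum_cellCoeff_sq_le (hf : MemLp f 2 cellMeasure) (s : Finset (Fin 3 → ℤ)) :
    ∑ k ∈ s, ‖cellCoeff f k‖ₑ ^ 2 ≤ eLpNorm f 2 cellMeasure ^ 2 := by
  obtain ⟨b, hb⟩ := exists_cellBasis
  have h := b.orthonormal.sum_inner_products_le (x := hf.toLp f) (s := s)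
  simp_rw [basis_inner_toLp hb hf, Lp.norm_toLp] at h
  rw [← ENNReal.toReal_pow] at h
  have h2 := ENNReal.ofReal_le_ofReal h
  rw [ENNReal.ofReal_toReal (ENNReal.pow_ne_top hf.2.ne (n := 2)),
    ENNReal.ofReal_sum_of_nonneg fun k _ => by positivity] at h2
  refine le_trans (le_of_eq (Finset.sum_congr rfl fun k _ => ?_)) h2
  rw [ENNReal.ofReal_pow (norm_nonneg _), ofReal_norm]

lemma tendsto_cellSeries (hf : MemLp f 2 cellMeasure) :
    Tendsto (fun s : Finset (Fin 3 → ℤ) =>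
      eLpNorm (fun y => f y - ∑ k ∈ s, cellCoeff f k * cellExp k y) 2 cellMeasure)
      atTop (𝓝 0) := by
  obtain ⟨b, hb⟩ := exists_cellBasis
  have h := b.hasSum_repr (hf.toLp f)
  simp_rw [b.repr_apply_apply, basis_inner_toLp hb hf] at h
  have h1 := tendsto_iff_norm_sub_tendsto_zero.1 (tendsto_sum_of_hasSum h)
  have h2 := ENNReal.tendsto_ofReal h1
  rw [ENNReal.ofReal_zero] at h2
  refine h2.congr fun s => ?_
  rw [← toLp_cellSum hb, ← MemLp.toLp_sub, Lp.norm_toLp,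
    ENNReal.ofReal_toReal ((memLp_cellSum _ s).sub hf).2.ne, eLpNorm_sub_comm]
  rfl

/-- Triangle inequality and Bessel. Being uniform in `s`, the bound serves as the majorant when
slices are integrated over x. -/
lemma eLpNorm_sub_cellSeries_le (hf : MemLp f 2 cellMeasure) (s : Finset (Fin 3 → ℤ)) :
    eLpNorm (fun y => f y - ∑ k ∈ s, cellCoeff f k * cellExp k y) 2 cellMeasure ≤
      2 * eLpNorm f 2 cellMeasure := by
  refine (eLpNorm_sub_le hf.1 (memLp_cellSum (p := 2) _ s).1 (by norm_num)).trans ?_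
  rw [two_mul]
  gcongr
  have h := (eLpNorm_cellSum_sq (cellCoeff f) s).trans_le (sum_cellCoeff_sq_le hf s)
  exact (ENNReal.pow_le_pow_left_iff two_ne_zero).1 h

end Slices

/-! ### Fourier series with a parameter -/

section Parameter

variable {μ : Measure E3} {f : E3 → E3 → ℂ}

lemma aestronglyMeasurable_cellCoeff
    (hf : AEStronglyMeasurable (Function.uncurry f) (μ.prod cellMeasure)) (k : Fin 3 → ℤ) :
    AEStronglyMeasurable (fun x => cellCoeff (f x) k) μ := by
  have h : AEStronglyMeasurable (fun p : E3 × E3 => cellExp (-k) p.2 * f p.1 p.2)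
      (μ.prod cellMeasure) :=
    (((contDiff_cellExp (-k)).continuous.comp continuous_snd).aestronglyMeasurable).mul hf
  exact h.integral_prod_right'

lemma aestronglyMeasurable_cellSum {c : (Fin 3 → ℤ) → E3 → ℂ}
    (hc : ∀ k, AEStronglyMeasurable (c k) μ) (s : Finset (Fin 3 → ℤ)) :
    AEStronglyMeasurable (fun p : E3 × E3 => ∑ k ∈ s, c k p.1 * cellExp k p.2)
      (μ.prod cellMeasure) := by
  refine Finset.aestronglyMeasurable_fun_sum s fun k _ => ?_
  exact (hc k).comp_fst.mul
    ((contDiff_cellExp k).continuous.comp continuous_snd).aestronglyMeasurable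

variable [SFinite μ]

lemma eLpNorm_prod_cellSum_sq {c : (Fin 3 → ℤ) → E3 → ℂ}
    (hc : ∀ k, AEStronglyMeasurable (c k) μ) (s : Finset (Fin 3 → ℤ)) :
    eLpNorm (fun p : E3 × E3 => ∑ k ∈ s, c k p.1 * cellExp k p.2) 2 (μ.prod cellMeasure) ^ 2 =
      ∑ k ∈ s, ∫⁻ x, ‖c k x‖ₑ ^ 2 ∂μ := by
  rw [eLpNorm_prod_sq (aestronglyMeasurable_cellSum hc s)]
  simp_rw [eLpNorm_cellSum_sq]
  exact lintegral_finsetSum' s fun k _ => (hc k).enorm.pow_const 2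

lemma sum_lintegral_cellCoeff_sq_le (hf : MemLp (Function.uncurry f) 2 (μ.prod cellMeasure))
    (s : Finset (Fin 3 → ℤ)) :
    ∑ k ∈ s, ∫⁻ x, ‖cellCoeff (f x) k‖ₑ ^ 2 ∂μ ≤
      eLpNorm (Function.uncurry f) 2 (μ.prod cellMeasure) ^ 2 := by
  rw [← lintegral_finsetSum' s fun k _ =>
    (aestronglyMeasurable_cellCoeff hf.1 k).enorm.pow_const 2, eLpNorm_prod_sq hf.1]
  refine lintegral_mono_ae ?_
  filter_upwards [ae_memLp_slice hf] with x hx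
  exact sum_cellCoeff_sq_le hx s

/-- The series converges on almost every slice, and the squared remainders are dominated by the
integrable 4‖f x‖². Dominated convergence holds along finite sets of frequencies since there are
countably many frequencies. -/
theorem tendsto_cellSeries_prod (hf : MemLp (Function.uncurry f) 2 (μ.prod cellMeasure)) :
    Tendsto (fun s : Finset (Fin 3 → ℤ) =>
      eLpNorm (fun p : E3 × E3 => f p.1 p.2 - ∑ k ∈ s, cellCoeff (f p.1) k * cellExp k p.2) 2
        (μ.prod cellMeasure)) atTop (𝓝 0) := by
  have hm : ∀ s : Finset (Fin 3 → ℤ), AEStronglyMeasurable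
      (fun p : E3 × E3 => f p.1 p.2 - ∑ k ∈ s, cellCoeff (f p.1) k * cellExp k p.2)
      (μ.prod cellMeasure) := fun s => by
    have h1 := aestronglyMeasurable_cellSum (aestronglyMeasurable_cellCoeff hf.1) s
    exact hf.1.sub h1
  refine tendsto_eLpNorm_two_of_sq ?_
  simp_rw [eLpNorm_prod_sq (hm _)]
  have hfin : ∫⁻ x, (2 * eLpNorm (f x) 2 cellMeasure) ^ 2 ∂μ ≠ ⊤ := by
    have h1 : ∫⁻ x, eLpNorm (f x) 2 cellMeasure ^ 2 ∂μ =
      eLpNorm (Function.uncurry f) 2 (μ.prod cellMeasure) ^ 2 := (eLpNorm_prod_sq hf.1).symm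
    simp_rw [mul_pow]
    rw [lintegral_const_mul' _ _ (by norm_num), h1]
    exact ENNReal.mul_ne_top (by norm_num) (ENNReal.pow_ne_top hf.2.ne)
  have hle : ∀ s : Finset (Fin 3 → ℤ), ∀ᵐ x ∂μ,
      eLpNorm (fun y => f x y - ∑ k ∈ s, cellCoeff (f x) k * cellExp k y) 2 cellMeasure ^ 2 ≤
        (2 * eLpNorm (f x) 2 cellMeasure) ^ 2 := fun s => by
    filter_upwards [ae_memLp_slice hf] with x hx
    exact pow_le_pow_left' (eLpNorm_sub_cellSeries_le hx s) 2
  have hlim : ∀ᵐ x ∂μ, Tendsto (fun s : Finset (Fin 3 → ℤ) =>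
      eLpNorm (fun y => f x y - ∑ k ∈ s, cellCoeff (f x) k * cellExp k y) 2 cellMeasure ^ 2)
      atTop (𝓝 0) := by
    filter_upwards [ae_memLp_slice hf] with x hx
    have := ((ENNReal.continuous_pow 2).tendsto 0).comp (tendsto_cellSeries hx)
    rw [zero_pow two_ne_zero] at this
    exact this
  have key := tendsto_lintegral_filter_of_dominated_convergence' _
    (Eventually.of_forall fun s => aemeasurable_eLpNorm_slice_sq (hm s))
    (Eventually.of_forall hle) hfin hlim
  rwa [lintegral_zero] at key

/-- Parametrized Riesz–Fischer theorem. -/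
theorem exists_tendsto_cellSum {c : (Fin 3 → ℤ) → E3 → ℂ}
    (hc : ∀ k, AEStronglyMeasurable (c k) μ) (M : ENNReal) (hM : M ≠ ⊤)
    (hs : ∀ s : Finset (Fin 3 → ℤ), ∑ k ∈ s, ∫⁻ x, ‖c k x‖ₑ ^ 2 ∂μ ≤ M) :
    ∃ g : E3 → E3 → ℂ, MemLp (Function.uncurry g) 2 (μ.prod cellMeasure) ∧
      Tendsto (fun s : Finset (Fin 3 → ℤ) =>
        eLpNorm (fun p : E3 × E3 => g p.1 p.2 - ∑ k ∈ s, c k p.1 * cellExp k p.2) 2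
          (μ.prod cellMeasure)) atTop (𝓝 0) := by
  have hfin : ∀ k, ∫⁻ x, ‖c k x‖ₑ ^ 2 ∂μ ≠ ⊤ := fun k =>
    ((by simpa using hs {k} : ∫⁻ x, ‖c k x‖ₑ ^ 2 ∂μ ≤ M).trans_lt hM.lt_top).ne
  have hmem : ∀ s : Finset (Fin 3 → ℤ),
      MemLp (fun p : E3 × E3 => ∑ k ∈ s, c k p.1 * cellExp k p.2) 2 (μ.prod cellMeasure) := by
    refine fun s => ⟨aestronglyMeasurable_cellSum hc s, ?_⟩
    have h := eLpNorm_prod_cellSum_sq hc s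
    by_contra hcon
    rw [not_lt_top_iff.1 hcon] at h
    have := (hs s).trans_lt hM.lt_top
    simp [← h] at this
  have hmem1 : ∀ k, MemLp (fun p : E3 × E3 => c k p.1 * cellExp k p.2) 2 (μ.prod cellMeasure) :=
    fun k => by simpa using hmem {k}
  have hsum : ∀ s : Finset (Fin 3 → ℤ), (hmem s).toLp _ = ∑ k ∈ s, (hmem1 k).toLp _ := by
    classical
    intro s
    induction s using Finset.induction_on with
    | empty => simp; rfl
    | insert k s hk ih =>
      rw [Finset.sum_insert hk, ← ih, ← MemLp.toLp_add]
      simp_rw [Finset.sum_insert hk]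
      rfl
  have hsumm : Summable fun k => (∫⁻ x, ‖c k x‖ₑ ^ 2 ∂μ).toReal := by
    refine ENNReal.summable_toReal (ne_top_of_le_ne_top hM ?_)
    rw [ENNReal.tsum_eq_iSup_sum]
    exact iSup_le hs
  -- By Parseval in y the squared norm of a finite sum is the sum of the squared norms of the
  -- coefficients.
  have hS : Summable fun k => (hmem1 k).toLp _ := by
    refine summable_of_norm_sum_sq_le hsumm fun t => ?_
    rw [← hsum, Lp.norm_toLp, ← ENNReal.toReal_pow, eLpNorm_prod_cellSum_sq hc,
      ENNReal.toReal_sum fun k _ => hfin k]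
  obtain ⟨g, hg⟩ := hS
  refine ⟨fun x y => g (x, y), Lp.memLp g, ?_⟩
  have h1 := ENNReal.tendsto_ofReal (tendsto_iff_norm_sub_tendsto_zero.1 (tendsto_sum_of_hasSum hg))
  rw [ENNReal.ofReal_zero] at h1
  refine h1.congr fun s => ?_
  rw [← hsum, ← norm_neg, neg_sub, Lp.norm_def, ENNReal.ofReal_toReal (Lp.eLpNorm_ne_top _)]
  refine eLpNorm_congr_ae ?_
  filter_upwards [Lp.coeFn_sub g ((hmem s).toLp _), (hmem s).coeFn_toLp] with p h1 h2
  rw [h1, Pi.sub_apply, h2]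

end Parameter

/-! ### Gradients of trigonometric polynomials -/

/-- The linear form `y ↦ k · y`, with complex values. -/
def freqForm (k : Fin 3 → ℤ) : E3 →L[ℝ] ℂ :=
  ∑ i, (k i : ℂ) • (Complex.ofRealCLM ∘L (EuclideanSpace.proj i : E3 →L[ℝ] ℝ))

lemma freqForm_apply (k : Fin 3 → ℤ) (y : E3) : freqForm k y = ∑ i, (k i : ℂ) * (y i : ℂ) := by
  simp [freqForm]

lemma freqForm_single (k : Fin 3 → ℤ) (j : Fin 3) :
    freqForm k (EuclideanSpace.single j 1) = k j := by
  rw [freqForm_apply, Finset.sum_eq_single j]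
  · simp
  · intro i _ hi; simp [hi]
  · simp

lemma hasFDerivAt_cellExp (k : Fin 3 → ℤ) (y : E3) :
    HasFDerivAt (cellExp k) ((2 * Real.pi * Complex.I * cellExp k y) • freqForm k) y := by
  have h1 : HasFDerivAt (fun y => 2 * Real.pi * Complex.I * freqForm k y)
      ((2 * Real.pi * Complex.I) • freqForm k) y := (freqForm k).hasFDerivAt.const_mul _
  have h2 := h1.cexp
  have h3 : cellExp k = fun y => Complex.exp (2 * Real.pi * Complex.I * freqForm k y) := by
    ext y; rw [freqForm_apply]; rfl
  rw [h3]
  have h4 : (2 * Real.pi * Complex.I * Complex.exp (2 * Real.pi * Complex.I * freqForm k y)) •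
      freqForm k = Complex.exp (2 * Real.pi * Complex.I * freqForm k y) •
        (2 * Real.pi * Complex.I) • freqForm k := by
    rw [smul_smul, mul_comm]
  rw [h4]
  exact h2

lemma gradOf_cellSum (c : (Fin 3 → ℤ) → ℂ) (s : Finset (Fin 3 → ℤ)) (y : E3) :
    gradOf (fun y => ∑ k ∈ s, c k * cellExp k y) y =
      WithLp.toLp 2 fun j => ∑ k ∈ s, 2 * Real.pi * Complex.I * (k j) * c k * cellExp k y := by
  have h : HasFDerivAt (fun y => ∑ k ∈ s, c k * cellExp k y)
      (∑ k ∈ s, c k • ((2 * Real.pi * Complex.I * cellExp k y) • freqForm k)) y :=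
    HasFDerivAt.fun_sum fun k _ => (hasFDerivAt_cellExp k y).const_mul (c k)
  ext j
  simp only [gradOf, h.fderiv, sum_apply, smul_apply,
    freqForm_single, smul_eq_mul]
  exact Finset.sum_congr rfl fun k _ => by ring

/-! ### Fourier coefficients of vector fields -/

/-- The Fourier coefficients in `y` of the components of a field depending on `(x, y)`. -/
def vecCoeff (G : E3 → E3 → C3) (k : Fin 3 → ℤ) (x : E3) (i : Fin 3) : ℂ :=
  cellCoeff (fun y => G x y i) k

/-- The square of the length of a frequency. -/
def freqSq (k : Fin 3 → ℤ) : ℤ := ∑ i, k i ^ 2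

lemma freqSq_pos {k : Fin 3 → ℤ} (hk : k ≠ 0) : 0 < freqSq k := by
  obtain ⟨i, hi⟩ := Function.ne_iff.1 hk
  exact Finset.sum_pos' (fun j _ => sq_nonneg _) ⟨i, Finset.mem_univ _, by
    have : k i ≠ 0 := hi
    positivity⟩

/-- An integer n satisfies |n| ≤ n². This crude estimate suffices to bound the potential by the
field. -/
lemma abs_le_freqSq (k : Fin 3 → ℤ) (i : Fin 3) : |k i| ≤ freqSq k := by
  refine le_trans ?_ (Finset.single_le_sum (f := fun i => k i ^ 2) (fun j _ => sq_nonneg _)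
    (Finset.mem_univ i))
  rw [← sq_abs]
  exact Int.le_self_sq _

/-- The Fourier coefficients of the potential of a curl-free field with coefficients `a`. -/
def potCoeff (a : Fin 3 → ℂ) (k : Fin 3 → ℤ) : ℂ :=
  (∑ i, (k i : ℂ) * a i) / (2 * Real.pi * Complex.I * freqSq k)

lemma norm_potCoeff_le (a : Fin 3 → ℂ) (k : Fin 3 → ℤ) : ‖potCoeff a k‖ ≤ ∑ i, ‖a i‖ := by
  by_cases hk : k = 0
  · subst hk
    simp only [potCoeff, Pi.zero_apply, Int.cast_zero, zero_mul, Finset.sum_const_zero, zero_div,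
      norm_zero]
    positivity
  have hN : (0 : ℝ) < freqSq k := by exact_mod_cast freqSq_pos hk
  have hnum : ‖∑ i, (k i : ℂ) * a i‖ ≤ freqSq k * ∑ i, ‖a i‖ := by
    rw [Finset.mul_sum]
    refine norm_sum_le_of_le _ fun i _ => ?_
    rw [norm_mul]
    refine mul_le_mul_of_nonneg_right ?_ (norm_nonneg _)
    rw [Complex.norm_intCast]
    exact_mod_cast abs_le_freqSq k i
  have hden : ‖(2 * Real.pi * Complex.I * freqSq k : ℂ)‖ = 2 * Real.pi * freqSq k := by
    simp [abs_of_pos Real.pi_pos, abs_of_pos hN]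
  rw [potCoeff, norm_div, hden, div_le_iff₀ (by positivity)]
  refine hnum.trans ?_
  have h1 : (1 : ℝ) ≤ 2 * Real.pi := by linarith [Real.pi_gt_three]
  have h2 : 0 ≤ freqSq k * ∑ i, ‖a i‖ := by positivity
  nlinarith

/-- The factor 3 is Cauchy–Schwarz over the three components. Together with Bessel this gives a
square integrable potential. -/
lemma enorm_potCoeff_sq_le (a : Fin 3 → ℂ) (k : Fin 3 → ℤ) :
    ‖potCoeff a k‖ₑ ^ 2 ≤ 3 * ∑ i, ‖a i‖ₑ ^ 2 := by
  have h1 : ‖potCoeff a k‖ ^ 2 ≤ 3 * ∑ i, ‖a i‖ ^ 2 := by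
    refine (pow_le_pow_left₀ (norm_nonneg _) (norm_potCoeff_le a k) 2).trans ?_
    have := sq_sum_le_card_mul_sum_sq (s := Finset.univ) (f := fun i : Fin 3 => ‖a i‖)
    simpa using this
  have h2 := ENNReal.ofReal_le_ofReal h1
  rw [ENNReal.ofReal_mul (by norm_num), ENNReal.ofReal_sum_of_nonneg fun i _ => by positivity] at h2
  simpa [ENNReal.ofReal_pow] using h2

/-- The hypothesis says that `a` is parallel to `k`, so that k_j (k·a) = |k|² a_j. -/
lemma potCoeff_grad {a : Fin 3 → ℂ} {k : Fin 3 → ℤ} (hk : k ≠ 0)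
    (h : ∀ i j, (k j : ℂ) * a i = k i * a j) (j : Fin 3) :
    2 * Real.pi * Complex.I * (k j) * potCoeff a k = a j := by
  have hN : (freqSq k : ℂ) ≠ 0 := by exact_mod_cast (freqSq_pos hk).ne'
  have hpi : (Real.pi : ℂ) ≠ 0 := by exact_mod_cast Real.pi_ne_zero
  have h1 : (k j : ℂ) * ∑ i, (k i : ℂ) * a i = freqSq k * a j := by
    rw [Finset.mul_sum, freqSq]
    push_cast
    rw [Finset.sum_mul]
    refine Finset.sum_congr rfl fun i _ => ?_
    linear_combination (k i : ℂ) * h i j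
  have hI := Complex.I_ne_zero
  rw [potCoeff]
  field_simp
  linear_combination h1

lemma eq_zero_of_curl_div {a : Fin 3 → ℂ} {k : Fin 3 → ℤ} (hk : k ≠ 0)
    (h : ∀ i j, (k j : ℂ) * a i = k i * a j) (hdiv : ∑ i, (k i : ℂ) * a i = 0) (j : Fin 3) :
    a j = 0 := by
  rw [← potCoeff_grad hk h j, potCoeff, hdiv]
  simp

/-! ### Fields constrained by curl and divergence in y -/

section Structure

variable {Ω : Set E3} {G : E3 → E3 → C3}

/-- The product measure on `Ω × Y`. -/
abbrev prodMeasure (Ω : Set E3) : Measure (E3 × E3) := (volume.restrict Ω).prod cellMeasure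

lemma eLpNorm_two_sq_eq_sum {α : Type*} [MeasurableSpace α] {μ : Measure α} {f : α → C3}
    (hf : ∀ i, AEStronglyMeasurable (fun x => f x i) μ) :
    eLpNorm f 2 μ ^ 2 = ∑ i, eLpNorm (fun x => f x i) 2 μ ^ 2 := by
  simp_rw [eLpNorm_two_sq]
  rw [← lintegral_finsetSum' _ fun i _ => (hf i).enorm.pow_const 2]
  refine lintegral_congr fun x => ?_
  have h : ‖f x‖ ^ 2 = ∑ i, ‖f x i‖ ^ 2 := by
    rw [EuclideanSpace.norm_eq, Real.sq_sqrt (by positivity)]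
  have h2 := congrArg ENNReal.ofReal h
  rw [ENNReal.ofReal_sum_of_nonneg fun i _ => by positivity] at h2
  simpa [ENNReal.ofReal_pow] using h2

lemma MemL2Prod.component (hG : MemL2Prod Ω G) (i : Fin 3) :
    MemLp (Function.uncurry fun x y => G x y i) 2 (prodMeasure Ω) :=
  memLp_piLp_iff.1 hG i

lemma aestronglyMeasurable_vecCoeff (hG : MemL2Prod Ω G) (k : Fin 3 → ℤ) (i : Fin 3) :
    AEStronglyMeasurable (fun x => vecCoeff G k x i) (volume.restrict Ω) :=
  aestronglyMeasurable_cellCoeff (f := fun x y => G x y i) (hG.component i).1 k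

lemma memLp_vecCoeff (hG : MemL2Prod Ω G) (k : Fin 3 → ℤ) (i : Fin 3) :
    MemLp (fun x => vecCoeff G k x i) 2 (volume.restrict Ω) := by
  refine ⟨aestronglyMeasurable_vecCoeff hG k i, ?_⟩
  have h := sum_lintegral_cellCoeff_sq_le (hG.component i) {k}
  rw [Finset.sum_singleton, ← eLpNorm_two_sq] at h
  have h2 := h.trans_lt (ENNReal.pow_lt_top (hG.component i).2)
  by_contra hcon
  have h3 : eLpNorm (fun x => cellCoeff (fun y => G x y i) k) 2 (volume.restrict Ω) = ⊤ :=
    not_lt_top_iff.1 hcon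
  simp [h3] at h2

/-- The mean of a field over the cell. -/
def cellMean (G : E3 → E3 → C3) (x : E3) : C3 := WithLp.toLp 2 (vecCoeff G 0 x)

lemma memLp_cellMean (hG : MemL2Prod Ω G) : MemLp (cellMean G) 2 (volume.restrict Ω) :=
  memLp_piLp_iff.2 fun i => memLp_vecCoeff hG 0 i

/-- The remainder of the Fourier series of a field. -/
def fourierTail (G : E3 → E3 → C3) (s : Finset (Fin 3 → ℤ)) (p : E3 × E3) : C3 :=
  WithLp.toLp 2 fun j => G p.1 p.2 j - ∑ k ∈ s, vecCoeff G k p.1 j * cellExp k p.2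

lemma aestronglyMeasurable_fourierTail_component (hG : MemL2Prod Ω G) (s : Finset (Fin 3 → ℤ))
    (j : Fin 3) : AEStronglyMeasurable (fun p => fourierTail G s p j) (prodMeasure Ω) := by
  have h1 := aestronglyMeasurable_cellSum
    (fun k => aestronglyMeasurable_vecCoeff hG k j) s
  exact (hG.component j).1.sub h1

lemma aestronglyMeasurable_fourierTail (hG : MemL2Prod Ω G) (s : Finset (Fin 3 → ℤ)) :
    AEStronglyMeasurable (fourierTail G s) (prodMeasure Ω) := by
  have h : AEMeasurable (fun p j => fourierTail G s p j) (prodMeasure Ω) :=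
    aemeasurable_pi_iff.2 fun j =>
      (aestronglyMeasurable_fourierTail_component hG s j).aemeasurable
  have h2 : Measurable (WithLp.toLp 2 : (Fin 3 → ℂ) → C3) := by fun_prop
  exact (h2.comp_aemeasurable h).aestronglyMeasurable

lemma tendsto_fourierTail (hG : MemL2Prod Ω G) :
    Tendsto (fun s => eLpNorm (fourierTail G s) 2 (prodMeasure Ω) ^ 2) atTop (𝓝 0) := by
  simp_rw [fun s => eLpNorm_two_sq_eq_sum (aestronglyMeasurable_fourierTail_component hG s)]
  have h : ∀ j, Tendsto (fun s => eLpNorm (fun p => fourierTail G s p j) 2 (prodMeasure Ω) ^ 2)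
      atTop (𝓝 0) := fun j => by
    have := ((ENNReal.continuous_pow 2).tendsto 0).comp (tendsto_cellSeries_prod (hG.component j))
    rw [zero_pow two_ne_zero] at this
    exact this
  have h2 := tendsto_finsetSum Finset.univ fun j _ => h j
  simpa using h2

lemma ae_snd_mem_halfOpenCell : ∀ᵐ p ∂(prodMeasure Ω), p.2 ∈ halfOpenCell :=
  Measure.quasiMeasurePreserving_snd.ae (p := fun y => y ∈ halfOpenCell) ae_mem_halfOpenCell

/-- A square integrable field that is curl-free in `y` is a mean plus a gradient. -/
theorem exists_potential (hG : MemL2Prod Ω G)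
    (hcurl : ∀ᵐ x ∂(volume.restrict Ω), ∀ k i j,
      (k j : ℂ) * vecCoeff G k x i = k i * vecCoeff G k x j) :
    ∃ (φ : E3 → E3 → ℂ) (gradφ : E3 → E3 → C3), MemL2H1PerWithGrad Ω φ gradφ ∧
      ∀ᵐ p ∂(prodMeasure Ω), G p.1 p.2 = cellMean G p.1 + gradφ p.1 p.2 := by
  let c : (Fin 3 → ℤ) → E3 → ℂ := fun k x => potCoeff (vecCoeff G k x) k
  have hc : ∀ k, AEStronglyMeasurable (c k) (volume.restrict Ω) := fun k => by
    have h : AEStronglyMeasurable (fun x => ∑ i, (k i : ℂ) * vecCoeff G k x i)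
        (volume.restrict Ω) :=
      Finset.aestronglyMeasurable_fun_sum _ fun i _ =>
        (aestronglyMeasurable_vecCoeff hG k i).const_mul _
    exact h.mul_const (2 * Real.pi * Complex.I * freqSq k : ℂ)⁻¹
  let M : ENNReal := 3 * ∑ i, eLpNorm (Function.uncurry fun x y => G x y i) 2 (prodMeasure Ω) ^ 2
  have hM : M ≠ ⊤ := ENNReal.mul_ne_top (by norm_num)
    (ENNReal.sum_ne_top.2 fun i _ => ENNReal.pow_ne_top (hG.component i).2.ne)
  have hs : ∀ s : Finset (Fin 3 → ℤ), ∑ k ∈ s, ∫⁻ x in Ω, ‖c k x‖ₑ ^ 2 ≤ M := by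
    intro s
    calc ∑ k ∈ s, ∫⁻ x in Ω, ‖c k x‖ₑ ^ 2
        ≤ ∑ k ∈ s, ∫⁻ x in Ω, 3 * ∑ i, ‖vecCoeff G k x i‖ₑ ^ 2 :=
          Finset.sum_le_sum fun k _ => lintegral_mono fun x => enorm_potCoeff_sq_le _ k
      _ = ∑ k ∈ s, 3 * ∑ i, ∫⁻ x in Ω, ‖vecCoeff G k x i‖ₑ ^ 2 := by
          refine Finset.sum_congr rfl fun k _ => ?_
          rw [lintegral_const_mul' _ _ (by norm_num), lintegral_finsetSum' _ fun i _ =>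
            (aestronglyMeasurable_vecCoeff hG k i).enorm.pow_const 2]
      _ = 3 * ∑ i, ∑ k ∈ s, ∫⁻ x in Ω, ‖vecCoeff G k x i‖ₑ ^ 2 := by
          rw [← Finset.mul_sum, Finset.sum_comm]
      _ ≤ M := by
          refine mul_le_mul_right (Finset.sum_le_sum fun i _ => ?_) _
          exact sum_lintegral_cellCoeff_sq_le (hG.component i) s
  obtain ⟨g, hg, hglim⟩ := exists_tendsto_cellSum hc M hM hs
  let A : Finset (Fin 3 → ℤ) → E3 → ENNReal := fun s x =>
    eLpNorm (fun y => g x y - ∑ k ∈ s, c k x * cellExp k y) 2 cellMeasure ^ 2 +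
      eLpNorm (fun y => fourierTail G s (x, y)) 2 cellMeasure ^ 2
  have hm1 : ∀ s : Finset (Fin 3 → ℤ), AEStronglyMeasurable
      (fun p : E3 × E3 => g p.1 p.2 - ∑ k ∈ s, c k p.1 * cellExp k p.2) (prodMeasure Ω) :=
    fun s => by
      have h1 := aestronglyMeasurable_cellSum hc s
      exact hg.1.sub h1
  have hA1 : ∀ s, AEMeasurable (fun x =>
      eLpNorm (fun y => g x y - ∑ k ∈ s, c k x * cellExp k y) 2 cellMeasure ^ 2)
      (volume.restrict Ω) := fun s => by
    have h := aemeasurable_eLpNorm_slice_sq (hm1 s)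
    exact h
  have hA : ∀ s, AEMeasurable (A s) (volume.restrict Ω) := fun s => by
    have h := aemeasurable_eLpNorm_slice_sq (aestronglyMeasurable_fourierTail hG s)
    exact (hA1 s).add h
  have hAlim : Tendsto (fun s => ∫⁻ x in Ω, A s x) atTop (𝓝 0) := by
    have h1 := ((ENNReal.continuous_pow 2).tendsto 0).comp hglim
    have h2 := h1.add (tendsto_fourierTail hG)
    rw [zero_pow two_ne_zero, add_zero] at h2
    refine h2.congr fun s => ?_
    rw [Function.comp_apply, eLpNorm_prod_sq (hm1 s),
      eLpNorm_prod_sq (aestronglyMeasurable_fourierTail hG s), ← lintegral_add_left' (hA1 s)]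
  -- Frequency 0 is always kept in the sum, so that subtracting the Fourier sum also subtracts the
  -- mean.
  have hins : Tendsto (fun s : Finset (Fin 3 → ℤ) => insert 0 s) atTop atTop :=
    tendsto_atTop_mono (fun s => Finset.subset_insert 0 s) tendsto_id
  have hex := ae_forall_exists_lt (fun s => hA (insert 0 s)) (hAlim.comp hins)
  -- Periodicity is required at every point, not only almost everywhere, so both representatives are
  -- extended periodically from the half-open cell.
  refine ⟨fun x y => g x (cellPart y), fun x y => G x (cellPart y) - cellMean G x,
    ⟨?_, ?_, ?_⟩, ?_⟩
  · refine MemLp.ae_eq ?_ hg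
    filter_upwards [ae_snd_mem_halfOpenCell] with p hp
    simp [Function.uncurry, cellPart_of_mem hp]
  · refine MemLp.ae_eq ?_ (MemLp.sub hG ((memLp_cellMean hG).comp_fst cellMeasure))
    filter_upwards [ae_snd_mem_halfOpenCell] with p hp
    simp [Function.uncurry, cellPart_of_mem hp]
  · filter_upwards [hex, ae_memLp_slice hg, ae_memLp_slice hG, hcurl] with x hx hgx hGx hcx
    have e1 : (fun y => g x (cellPart y)) =ᵐ[cellMeasure] g x := by
      filter_upwards [ae_mem_halfOpenCell] with y hy
      rw [cellPart_of_mem hy]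
    have e2 : (fun y => G x (cellPart y) - cellMean G x) =ᵐ[cellMeasure]
        fun y => G x y - cellMean G x := by
      filter_upwards [ae_mem_halfOpenCell] with y hy
      rw [cellPart_of_mem hy]
    refine ⟨isYPeriodic_comp_cellPart _, isYPeriodic_comp_cellPart fun y => G x y - cellMean G x,
      hgx.ae_eq e1.symm, (hGx.sub (memLp_const _)).ae_eq e2.symm, fun δ hδ => ?_⟩
    obtain ⟨s, hs⟩ := hx (δ ^ 2) (by positivity)
    refine ⟨fun y => ∑ k ∈ insert 0 s, c k x * cellExp k y,
      ContDiff.sum fun k _ => contDiff_const.mul (contDiff_cellExp k), fun m y => ?_, ?_, ?_⟩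
    · exact Finset.sum_congr rfl fun k _ => by rw [isYPeriodic_cellExp k m y]
    · refine lt_of_pow_lt_pow_left' 2 (lt_of_le_of_lt ?_ hs)
      refine le_trans (le_of_eq ?_) le_self_add
      congr 1
      refine eLpNorm_congr_ae ?_
      filter_upwards [e1] with y hy
      rw [Pi.sub_apply, hy]
    · refine lt_of_pow_lt_pow_left' 2 (lt_of_le_of_lt ?_ hs)
      refine le_trans (le_of_eq ?_) le_add_self
      congr 1
      refine eLpNorm_congr_ae ?_
      filter_upwards [e2] with y hy
      rw [Pi.sub_apply, hy, gradOf_cellSum]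
      ext j
      simp only [PiLp.sub_apply, cellMean, fourierTail]
      rw [sub_sub]
      congr 1
      -- At frequency 0 the field contributes its mean and the gradient contributes nothing; at the
      -- other frequencies the terms agree by `potCoeff_grad`.
      rw [← Finset.insert_erase (Finset.mem_insert_self 0 s)]
      rw [Finset.sum_insert (Finset.notMem_erase _ _), Finset.sum_insert (Finset.notMem_erase _ _)]
      have h0 : cellExp 0 y = 1 := by simp [cellExp]
      rw [h0]
      simp only [Pi.zero_apply, Int.cast_zero, mul_zero, zero_mul, zero_add, mul_one]
      congr 1
      refine Finset.sum_congr rfl fun k hk => ?_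
      rw [potCoeff_grad (Finset.ne_of_mem_erase hk) (hcx k)]
  · filter_upwards [ae_snd_mem_halfOpenCell] with p hp
    simp [cellPart_of_mem hp]

/-- A square integrable field that is curl-free and divergence-free in `y` is independent of
`y`. -/
theorem eq_cellMean_of_curl_div (hG : MemL2Prod Ω G)
    (hcurl : ∀ᵐ x ∂(volume.restrict Ω), ∀ k i j,
      (k j : ℂ) * vecCoeff G k x i = k i * vecCoeff G k x j)
    (hdiv : ∀ᵐ x ∂(volume.restrict Ω), ∀ k, ∑ i, (k i : ℂ) * vecCoeff G k x i = 0) :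
    ∀ᵐ p ∂(prodMeasure Ω), G p.1 p.2 = cellMean G p.1 := by
  have hz : ∀ᵐ p ∂(prodMeasure Ω), ∀ k : Fin 3 → ℤ, k ≠ 0 → ∀ j, vecCoeff G k p.1 j = 0 := by
    refine Measure.quasiMeasurePreserving_fst.ae (p := fun x => ∀ k : Fin 3 → ℤ, k ≠ 0 → ∀ j,
      vecCoeff G k x j = 0) ?_
    filter_upwards [hcurl, hdiv] with x h1 h2 k hk j
    exact eq_zero_of_curl_div hk (h1 k) (h2 k) j
  -- All nonzero frequencies are absent, so the remainder does not change once frequency 0 is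
  -- included. Since it also tends to zero, it is zero.
  have hconst : ∀ s : Finset (Fin 3 → ℤ),
      fourierTail G (insert 0 s) =ᵐ[prodMeasure Ω] fourierTail G {0} := fun s => by
    filter_upwards [hz] with p hp
    ext j
    simp only [fourierTail]
    congr 1
    refine (Finset.sum_subset (by simp) fun k _ hk => ?_).symm
    rw [hp k (by simpa using hk), zero_mul]
  have hins : Tendsto (fun s : Finset (Fin 3 → ℤ) => insert 0 s) atTop atTop :=
    tendsto_atTop_mono (fun s => Finset.subset_insert 0 s) tendsto_id
  have hlim := (tendsto_fourierTail hG).comp hins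
  have h0 : eLpNorm (fourierTail G {0}) 2 (prodMeasure Ω) ^ 2 = 0 := by
    refine tendsto_nhds_unique (tendsto_const_nhds (x := _) (f := atTop)) (hlim.congr fun s => ?_)
    rw [Function.comp_apply, eLpNorm_congr_ae (hconst s)]
  rw [pow_eq_zero_iff two_ne_zero, eLpNorm_eq_zero_iff (aestronglyMeasurable_fourierTail hG _)
    two_ne_zero] at h0
  filter_upwards [h0] with p hp
  ext j
  have := congrArg (fun v : C3 => v j) hp
  simpa [fourierTail, cellMean, cellExp, sub_eq_zero] using this

end Structure

lemma TwoScaleConverges.congr {Ω : Set E3} {d : ℕ → ℝ} {u : ℕ → E3 → C3} {u₀ v₀ : E3 → E3 → C3}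
    (h : TwoScaleConverges Ω d u u₀) (huv : ∀ᵐ p ∂(prodMeasure Ω), u₀ p.1 p.2 = v₀ p.1 p.2) :
    TwoScaleConverges Ω d u v₀ := by
  refine ⟨h.1, MemLp.ae_eq huv h.2.1, fun Ψ hΨ => ?_⟩
  convert h.2.2 Ψ hΨ using 2
  refine integral_congr_ae ?_
  filter_upwards [Measure.ae_ae_of_ae_prod huv] with x hx
  refine integral_congr_ae ?_
  filter_upwards [hx] with y hy
  rw [hy]

/-! ### Horizontal planes -/

/-- The embedding of the plane as the horizontal plane at height `a`. -/
def planeEmb (a : ℝ) (q : E2) : E3 := !₂[q 0, q 1, a]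

lemma isometry_planeEmb (a : ℝ) : Isometry (planeEmb a) := by
  refine Isometry.of_dist_eq fun p q => ?_
  rw [EuclideanSpace.dist_eq, EuclideanSpace.dist_eq, Fin.sum_univ_three, Fin.sum_univ_two]
  simp [planeEmb]

lemma planeEmb_horiz (x : E3) : planeEmb (x 2) (horiz x) = x := by
  ext i; fin_cases i <;> simp [planeEmb, horiz]

lemma horiz_planeEmb (a : ℝ) (q : E2) : horiz (planeEmb a q) = q := by
  ext i; fin_cases i <;> simp [planeEmb, horiz]

lemma continuous_horiz : Continuous horiz := by
  unfold horiz
  refine (PiLp.continuous_toLp 2 _).comp (continuous_pi fun i => ?_)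
  fin_cases i <;> simp <;> fun_prop

lemma range_planeEmb (a : ℝ) : range (planeEmb a) = {x | x 2 = a} := by
  ext x
  constructor
  · rintro ⟨q, rfl⟩; simp [planeEmb]
  · rintro rfl; exact ⟨horiz x, planeEmb_horiz x⟩

lemma sheet_eq_image (S : Set E2) (d : ℝ) (k : ℤ) : sheet S d k = planeEmb (k * d) '' S := by
  ext x
  constructor
  · rintro ⟨h1, h2⟩; exact ⟨horiz x, h1, by rw [← h2]; exact planeEmb_horiz x⟩
  · rintro ⟨q, hq, rfl⟩
    exact ⟨by rwa [horiz_planeEmb], by simp [planeEmb]⟩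

lemma measure_sheet (S : Set E2) (d : ℝ) (k : ℤ) : (μHE[2] : Measure E3) (sheet S d k) = volume S := by
  rw [sheet_eq_image, (isometry_planeEmb _).euclideanHausdorffMeasure_image,
    EuclideanSpace.euclideanHausdorffMeasure_eq_volume]

lemma measurableSet_sheet {S : Set E2} (hS : IsOpen S) (d : ℝ) (k : ℤ) :
    MeasurableSet (sheet S d k) := by
  have h1 : MeasurableSet {x : E3 | horiz x ∈ S} := (hS.preimage continuous_horiz).measurableSet
  have h2 : MeasurableSet {x : E3 | x 2 = k * d} :=
    (isClosed_singleton.preimage (by fun_prop : Continuous fun x : E3 => x 2)).measurableSet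
  exact h1.inter h2

lemma measurableSet_layers {S : Set E2} (hS : IsOpen S) (L d : ℝ) :
    MeasurableSet (layers S L d) :=
  MeasurableSet.biUnion (to_countable _) fun k _ => measurableSet_sheet hS d k

lemma layers_subset {S : Set E2} {L d : ℝ} (hd : 0 < d) : layers S L d ⊆ domainΩ S L := by
  intro x hx
  simp only [layers, mem_iUnion] at hx
  obtain ⟨k, hk, h1, h2⟩ := hx
  exact ⟨h1, by rw [h2]; exact ⟨hk.1, hk.2.trans (by linarith)⟩⟩

/-- At most 2⌊L/d⌋ + 1 sheets, each an isometric copy of S. The resulting growth like 1/d has to be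
compensated in the sheet integrals. -/
lemma measure_layers_le (S : Set E2) {L d : ℝ} (hL : 0 < L) (hd : 0 < d) :
    (μHE[2] : Measure E3) (layers S L d) ≤ ENNReal.ofReal (2 * L / d + 1) * volume S := by
  have hm0 : 0 ≤ ⌊L / d⌋ := Int.floor_nonneg.2 (by positivity)
  have hsub : layers S L d ⊆ ⋃ k ∈ Finset.Icc (-⌊L / d⌋) ⌊L / d⌋, sheet S d k := by
    refine biUnion_subset_biUnion_left fun k hk => ?_
    have h1 : -L < k * d := hk.1
    have h2 : k * d < L := hk.2.trans (by linarith)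
    rw [Finset.mem_coe, Finset.mem_Icc]
    constructor
    · rw [neg_le]
      refine Int.le_floor.2 ?_
      rw [le_div_iff₀ hd]
      push_cast
      linarith
    · refine Int.le_floor.2 ?_
      rw [le_div_iff₀ hd]
      exact h2.le
  refine (measure_mono hsub).trans ((measure_biUnion_finset_le _ _).trans ?_)
  simp_rw [measure_sheet]
  rw [Finset.sum_const, nsmul_eq_mul, Int.card_Icc]
  refine mul_le_mul_left ?_ _
  rw [← ENNReal.ofReal_natCast]
  refine ENNReal.ofReal_le_ofReal ?_
  have h3 : ((⌊L / d⌋ + 1 - -⌊L / d⌋).toNat : ℝ) = 2 * (⌊L / d⌋ : ℝ) + 1 := by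
    have h4 : (((⌊L / d⌋ + 1 - -⌊L / d⌋).toNat : ℤ) : ℝ) = ((⌊L / d⌋ + 1 - -⌊L / d⌋ : ℤ) : ℝ) := by
      rw [Int.toNat_of_nonneg (by omega)]
    rw [Int.cast_natCast] at h4
    rw [h4]; push_cast; ring
  rw [h3]
  have := Int.floor_le (L / d)
  have h5 : 2 * L / d = 2 * (L / d) := by ring
  rw [h5]; linarith

/-- The splitting `ℝ³ ≃ ℝ × ℝ²` into height and horizontal part. -/
def heightEquiv : E3 ≃ᵐ ℝ × E2 :=
  (MeasurableEquiv.toLp 2 (Fin 3 → ℝ)).symm.trans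
    ((MeasurableEquiv.piFinSuccAbove (fun _ : Fin 3 => ℝ) 2).trans
      ((MeasurableEquiv.refl ℝ).prodCongr (MeasurableEquiv.toLp 2 (Fin 2 → ℝ))))

lemma measurePreserving_heightEquiv : MeasurePreserving heightEquiv volume volume := by
  have h1 := EuclideanSpace.volume_preserving_symm_measurableEquiv_toLp (Fin 3)
  have h2 := volume_preserving_piFinSuccAbove (fun _ : Fin 3 => ℝ) 2
  have h3 := (MeasurePreserving.id (volume : Measure ℝ)).prod (PiLp.volume_preserving_toLp (Fin 2))
  exact h3.comp (h2.comp h1)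

lemma heightEquiv_symm_apply (t : ℝ) (q : E2) : heightEquiv.symm (t, q) = planeEmb t q := by
  rw [MeasurableEquiv.symm_apply_eq]
  refine Prod.ext ?_ ?_
  · rfl
  · ext i; fin_cases i <;> rfl

/-! ### Divergence theorem on half-spaces -/

section Divergence

variable {g : E3 → ℂ}

lemma continuous_fderiv_apply_of_contDiff (hg : ContDiff ℝ ∞ g) (v : E3) :
    Continuous fun x => fderiv ℝ g x v :=
  (hg.continuous_fderiv (by simp)).clm_apply continuous_const

lemma hasCompactSupport_fderiv_apply (hgc : HasCompactSupport g) (v : E3) :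
    HasCompactSupport fun x => fderiv ℝ g x v :=
  hgc.fderiv_apply ℝ v

lemma integrable_fderiv_apply (hg : ContDiff ℝ ∞ g) (hgc : HasCompactSupport g) (v : E3) :
    Integrable fun x => fderiv ℝ g x v :=
  (continuous_fderiv_apply_of_contDiff hg v).integrable_of_hasCompactSupport
    (hasCompactSupport_fderiv_apply hgc v)

/-- The indicator of `H` is constant along v, so its derivative in that direction is zero and
integration by parts leaves no term. -/
lemma setIntegral_fderiv_eq_zero (hg : ContDiff ℝ ∞ g) (hgc : HasCompactSupport g) {v : E3}
    {H : Set E3} (hH : MeasurableSet H) (hinv : ∀ x (t : ℝ), x + t • v ∈ H ↔ x ∈ H) :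
    ∫ x in H, fderiv ℝ g x v = 0 := by
  have hi := integrable_fderiv_apply hg hgc v
  have hgi := hg.continuous.integrable_of_hasCompactSupport hgc (μ := volume)
  have hind : ∀ h : E3 → ℂ, (fun x => ContinuousLinearMap.lsmul ℝ ℝ (H.indicator (1 : E3 → ℝ) x)
      (h x)) = H.indicator h := fun h => by
    ext x; by_cases hx : x ∈ H <;> simp [hx]
  have key := integral_bilinear_hasLineDerivAt_right_eq_neg_left_of_integrable
    (μ := (volume : Measure E3)) (f := H.indicator (1 : E3 → ℝ)) (f' := 0) (g := g)
    (g' := fun x => fderiv ℝ g x v) (v := v) (B := ContinuousLinearMap.lsmul ℝ ℝ)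
    (by simp) (by rw [hind]; exact hi.indicator hH) (by rw [hind]; exact hgi.indicator hH)
    (fun x _ => by
      have : (fun t : ℝ => H.indicator (1 : E3 → ℝ) (x + t • v)) =
          fun _ => H.indicator (1 : E3 → ℝ) x := by
        ext t
        by_cases hx : x ∈ H
        · rw [indicator_of_mem hx, indicator_of_mem ((hinv x t).2 hx)]; rfl
        · rw [indicator_of_notMem hx, indicator_of_notMem (fun h => hx ((hinv x t).1 h))]
      rw [HasLineDerivAt, this]
      exact hasDerivAt_const _ _)
    (fun x _ => ((hg.differentiable (by simp)) x).hasFDerivAt.hasLineDerivAt v)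
  rw [hind] at key
  rw [← integral_indicator hH, key]
  simp

/-- Fubini along vertical lines and the fundamental theorem of calculus on each; compact support
removes the contribution at −∞. -/
lemma setIntegral_fderiv_vertical (hg : ContDiff ℝ ∞ g) (hgc : HasCompactSupport g) (a : ℝ) :
    ∫ x in {x : E3 | x 2 < a}, fderiv ℝ g x (EuclideanSpace.single 2 1) =
      ∫ q : E2, g (planeEmb a q) := by
  set v : E3 := EuclideanSpace.single 2 1 with hv
  have hi := integrable_fderiv_apply hg hgc v
  have hmp := measurePreserving_heightEquiv.symm
  have hset : heightEquiv.symm ⁻¹' {x : E3 | x 2 < a} = Iio a ×ˢ univ := by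
    ext ⟨t, q⟩
    simp [heightEquiv_symm_apply, planeEmb]
  have hmapv : ∀ h : E3 → ℂ, ∫ x in {x : E3 | x 2 < a}, h x =
      ∫ p in Iio a ×ˢ (univ : Set E2), h (planeEmb p.1 p.2) := fun h => by
    rw [← hmp.setIntegral_preimage_emb heightEquiv.symm.measurableEmbedding, hset]
    simp only [← heightEquiv_symm_apply]
  have hint : Integrable (fun p : ℝ × E2 => fderiv ℝ g (planeEmb p.1 p.2) v) := by
    have := hmp.integrable_comp_of_integrable hi
    refine this.congr (ae_of_all _ fun p => ?_)
    simp [← heightEquiv_symm_apply]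
  rw [hmapv, Measure.volume_eq_prod, ← Measure.prod_restrict, Measure.restrict_univ]
  have hint2 : Integrable (fun p : ℝ × E2 => fderiv ℝ g (planeEmb p.1 p.2) v)
      ((volume.restrict (Iio a)).prod volume) := by
    refine hint.mono_measure ?_
    have h : (volume.restrict (Iio a)).prod (volume : Measure E2) =
        ((volume : Measure ℝ).prod volume).restrict (Iio a ×ˢ univ) := by
      rw [← Measure.prod_restrict, Measure.restrict_univ]
    rw [h]
    exact Measure.restrict_le_self
  rw [integral_prod_symm _ hint2]
  refine integral_congr_ae (ae_of_all _ fun q => ?_)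
  have hline : ∀ t : ℝ, planeEmb t q = planeEmb 0 q + t • v := fun t => by
    ext i; fin_cases i <;> simp [planeEmb, hv]
  have hfun : (fun t : ℝ => planeEmb t q) = fun t => planeEmb 0 q + t • v := funext hline
  have hderiv : ∀ t : ℝ, HasDerivAt (fun t => g (planeEmb t q)) (fderiv ℝ g (planeEmb t q) v) t := by
    intro t
    have h1 : HasDerivAt (fun t : ℝ => planeEmb t q) v t := by
      rw [hfun]
      have := ((hasDerivAt_id t).smul_const v).const_add (planeEmb 0 q)
      simpa using this
    exact ((hg.differentiable (by simp)) _).hasFDerivAt.comp_hasDerivAt t h1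
  have hc : ContDiff ℝ 1 fun t : ℝ => g (planeEmb t q) := by
    have h1 : ContDiff ℝ 1 fun t : ℝ => planeEmb t q := by
      rw [hfun]
      exact contDiff_const.add (contDiff_id.smul contDiff_const)
    exact (hg.of_le (by simp)).comp h1
  have hcs : HasCompactSupport fun t : ℝ => g (planeEmb t q) := by
    refine hgc.comp_isClosedEmbedding (Isometry.isClosedEmbedding ?_)
    refine Isometry.of_dist_eq fun s t => ?_
    rw [EuclideanSpace.dist_eq, Fin.sum_univ_three]
    simp [planeEmb, Real.dist_eq, Real.sqrt_sq_eq_abs]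
  have := hcs.integral_Iic_deriv_eq hc a
  beta_reduce
  rw [← this, integral_Iic_eq_integral_Iio]
  exact integral_congr_ae (ae_of_all _ fun t => (hderiv t).deriv.symm)

end Divergence

lemma integral_add_add {α : Type*} [MeasurableSpace α] {μ : Measure α} {f g h : α → ℂ}
    (hf : Integrable f μ) (hg : Integrable g μ) (hh : Integrable h μ) :
    ∫ x, (f x + g x + h x) ∂μ = ∫ x, f x ∂μ + ∫ x, g x ∂μ + ∫ x, h x ∂μ := by
  rw [integral_add (f := fun x => f x + g x) (hf.add hg) hh, integral_add hf hg]

/-! ### Green's formula -/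

section Green

variable {u φ : E3 → C3}

/-- The components `u_a φ_b - u_b φ_a` of a vector product. -/
def crossComp (u φ : E3 → C3) (a b : Fin 3) (x : E3) : ℂ := u x a * φ x b - u x b * φ x a

lemma IsTestField.contDiff_component (hu : IsTestField u) (i : Fin 3) :
    ContDiff ℝ ∞ fun x => u x i :=
  (contDiff_piLp 2).1 hu.1 i

lemma IsTestField.contDiff_crossComp (hu : IsTestField u) (hφ : IsTestField φ) (a b : Fin 3) :
    ContDiff ℝ ∞ (crossComp u φ a b) :=
  ((hu.contDiff_component a).mul (hφ.contDiff_component b)).sub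
    ((hu.contDiff_component b).mul (hφ.contDiff_component a))

lemma IsTestField.hasCompactSupport_crossComp (hu : IsTestField u) (a b : Fin 3) :
    HasCompactSupport (crossComp u φ a b) := by
  refine hu.2.mono fun x hx => ?_
  contrapose! hx
  have : u x = 0 := by simpa using hx
  simp [crossComp, this]

lemma IsTestField.hasFDerivAt_component (hu : IsTestField u) (i : Fin 3) (x v : E3) :
    fderiv ℝ (fun x => u x i) x v = fderiv ℝ u x v i := by
  have h : HasFDerivAt u (fderiv ℝ u x) x := ((hu.1.differentiable (by simp)) x).hasFDerivAt
  have h2 := (((EuclideanSpace.proj i : C3 →L[ℂ] ℂ).restrictScalars ℝ).hasFDerivAt).comp x h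
  have h3 := h2.fderiv
  have : fderiv ℝ (fun x => u x i) x = _ := h3
  rw [this]
  rfl

lemma IsTestField.fderiv_crossComp (hu : IsTestField u) (hφ : IsTestField φ) (a b : Fin 3)
    (x v : E3) : fderiv ℝ (crossComp u φ a b) x v =
      u x a * fderiv ℝ φ x v b + fderiv ℝ u x v a * φ x b -
        (u x b * fderiv ℝ φ x v a + fderiv ℝ u x v b * φ x a) := by
  have hu' : ∀ i, DifferentiableAt ℝ (fun x => u x i) x := fun i =>
    (hu.contDiff_component i).differentiable (by simp) x
  have hφ' : ∀ i, DifferentiableAt ℝ (fun x => φ x i) x := fun i =>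
    (hφ.contDiff_component i).differentiable (by simp) x
  have h1 := ((hu' a).hasFDerivAt.mul (hφ' b).hasFDerivAt).sub
    ((hu' b).hasFDerivAt.mul (hφ' a).hasFDerivAt)
  have h2 : fderiv ℝ (crossComp u φ a b) x = _ := h1.fderiv
  rw [h2]
  simp [hu.hasFDerivAt_component, hφ.hasFDerivAt_component]
  ring

/-- The identity div(u × φ) = curl u · φ − u · curl φ. -/
lemma green_integrand (hu : IsTestField u) (hφ : IsTestField φ) (x : E3) :
    dot (curlOf u x) (φ x) - dot (u x) (curlOf φ x) =
      fderiv ℝ (crossComp u φ 1 2) x (EuclideanSpace.single 0 1) +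
      fderiv ℝ (crossComp u φ 2 0) x (EuclideanSpace.single 1 1) +
      fderiv ℝ (crossComp u φ 0 1) x (EuclideanSpace.single 2 1) := by
  simp only [hu.fderiv_crossComp hφ, dot, curlOf, pderivComp, Fin.sum_univ_three]
  simp
  ring

lemma integral_green (hu : IsTestField u) (hφ : IsTestField φ) :
    ∫ x, (dot (curlOf u x) (φ x) - dot (u x) (curlOf φ x)) = 0 := by
  have hi : ∀ a b v, Integrable fun x => fderiv ℝ (crossComp u φ a b) x v := fun a b v =>
    integrable_fderiv_apply (hu.contDiff_crossComp hφ a b) (hu.hasCompactSupport_crossComp a b) v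
  have hz : ∀ a b v, ∫ x, fderiv ℝ (crossComp u φ a b) x v = 0 := fun a b v => by
    have := setIntegral_fderiv_eq_zero (hu.contDiff_crossComp hφ a b)
      (hu.hasCompactSupport_crossComp a b) (v := v) MeasurableSet.univ (by simp)
    simpa using this
  simp_rw [green_integrand hu hφ]
  rw [integral_add_add (hi _ _ _) (hi _ _ _) (hi _ _ _)]
  simp [hz]

lemma integral_green_halfSpace (hu : IsTestField u) (hφ : IsTestField φ) (a : ℝ) :
    ∫ x in {x : E3 | x 2 < a}, (dot (curlOf u x) (φ x) - dot (u x) (curlOf φ x)) =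
      ∫ q : E2, crossComp u φ 0 1 (planeEmb a q) := by
  have hi : ∀ a b v, Integrable fun x => fderiv ℝ (crossComp u φ a b) x v := fun a b v =>
    integrable_fderiv_apply (hu.contDiff_crossComp hφ a b) (hu.hasCompactSupport_crossComp a b) v
  have hH : MeasurableSet {x : E3 | x 2 < a} :=
    (isOpen_Iio.preimage (by fun_prop : Continuous fun x : E3 => x 2)).measurableSet
  have hz : ∀ i j (l : Fin 3), l ≠ 2 →
      ∫ x in {x : E3 | x 2 < a}, fderiv ℝ (crossComp u φ i j) x (EuclideanSpace.single l 1) = 0 :=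
    fun i j l hl => setIntegral_fderiv_eq_zero (hu.contDiff_crossComp hφ i j)
      (hu.hasCompactSupport_crossComp i j) hH fun x t => by simp [hl.symm]
  simp_rw [green_integrand hu hφ]
  rw [integral_add_add (hi _ _ _).integrableOn (hi _ _ _).integrableOn (hi _ _ _).integrableOn,
    hz _ _ _ (by decide), hz _ _ _ (by decide), zero_add, zero_add,
    setIntegral_fderiv_vertical (hu.contDiff_crossComp hφ 0 1)
      (hu.hasCompactSupport_crossComp 0 1)]

end Green

/-! ### Smooth elements of the energy space -/

section Domain

variable {S : Set E2} {L d : ℝ}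

lemma isOpen_domainΩ (hS : IsOpen S) : IsOpen (domainΩ S L) :=
  (hS.preimage continuous_horiz).inter
    (isOpen_Ioo.preimage (by fun_prop : Continuous fun x : E3 => x 2))

lemma isBounded_domainΩ (hS : Bornology.IsBounded S) : Bornology.IsBounded (domainΩ S L) := by
  obtain ⟨R, hR⟩ := hS.subset_closedBall 0
  refine (Metric.isBounded_closedBall (x := (0 : E3)) (r := R + |L|)).subset fun x hx => ?_
  have h1 : ‖horiz x‖ ≤ R := by simpa using hR hx.1
  have h2 : |x 2| ≤ |L| := by
    have h3 := hx.2
    rw [abs_le]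
    exact ⟨by linarith [h3.1, le_abs_self L], by linarith [h3.2, le_abs_self L]⟩
  rw [mem_closedBall_zero_iff]
  have hR0 : 0 ≤ R := (norm_nonneg _).trans h1
  rw [EuclideanSpace.norm_eq, Real.sqrt_le_left (by positivity), Fin.sum_univ_three]
  rw [EuclideanSpace.norm_eq, Real.sqrt_le_left hR0, Fin.sum_univ_two] at h1
  have h4 : ‖x 2‖ ^ 2 ≤ |L| ^ 2 := pow_le_pow_left₀ (norm_nonneg _) h2 2
  simp only [horiz, PiLp.toLp_apply, Matrix.cons_val_zero, Matrix.cons_val_one] at h1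
  nlinarith [abs_nonneg L]

lemma isFiniteMeasure_surfaceMeasure_layers (hS : Bornology.IsBounded S) (hL : 0 < L)
    (hd : 0 < d) : IsFiniteMeasure (surfaceMeasure (layers S L d)) := by
  refine ⟨?_⟩
  rw [surfaceMeasure, Measure.restrict_apply_univ]
  exact (measure_layers_le S hL hd).trans_lt
    (ENNReal.mul_lt_top ENNReal.ofReal_lt_top hS.measure_lt_top)

end Domain

/-- The projection onto the horizontal components. -/
def tangential (v : C3) : C3 := !₂[v 0, v 1, 0]

lemma continuous_tangential : Continuous tangential := by
  unfold tangential
  refine (PiLp.continuous_toLp 2 _).comp (continuous_pi fun i => ?_)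
  fin_cases i <;> simp <;> fun_prop

lemma tangential_zero : tangential 0 = 0 := by
  ext i; fin_cases i <;> simp [tangential]

lemma norm_tangential_le (v : C3) : ‖tangential v‖ ≤ ‖v‖ := by
  rw [EuclideanSpace.norm_eq, EuclideanSpace.norm_eq]
  refine Real.sqrt_le_sqrt ?_
  rw [Fin.sum_univ_three, Fin.sum_univ_three]
  simp [tangential]

lemma dot_e3_tangential (v : C3) : dot (toC e3) (tangential v) = 0 := by
  simp [dot, toC, e3, tangential, Fin.sum_univ_three]

/-- The right side is the vertical component of v × w, that is, the flux left by the divergence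
theorem below a sheet. -/
lemma dot_cross_e3_tangential (v w : C3) :
    dot (cross (toC e3) (tangential v)) w = v 0 * w 1 - v 1 * w 0 := by
  simp [dot, cross, toC, e3, tangential, Fin.sum_univ_three, crossProduct]
  ring

lemma curlOf_eq_zero {u : E3 → C3} {x : E3} (hx : x ∉ tsupport u) : curlOf u x = 0 := by
  have : fderiv ℝ u x = 0 := fderiv_of_notMem_tsupport ℝ hx
  ext i
  fin_cases i <;> simp [curlOf, pderivComp, this]

lemma continuous_curlOf {u : E3 → C3} (hu : IsTestField u) : Continuous (curlOf u) := by
  have h : ∀ j i, Continuous (pderivComp u j i) := fun j i => by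
    have h1 : Continuous fun x => fderiv ℝ u x (EuclideanSpace.single j 1) :=
      (hu.1.continuous_fderiv (by simp)).clm_apply continuous_const
    exact (PiLp.continuous_apply 2 (fun _ : Fin 3 => ℂ) i).comp h1
  unfold curlOf
  refine (PiLp.continuous_toLp 2 _).comp (continuous_pi fun i => ?_)
  fin_cases i
  · exact (h 1 2).sub (h 2 1)
  · exact (h 2 0).sub (h 0 2)
  · exact (h 0 1).sub (h 1 0)

lemma hasCompactSupport_curlOf {u : E3 → C3} (hu : IsTestField u) :
    HasCompactSupport (curlOf u) :=
  hu.2.mono' fun x hx => by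
    by_contra h
    exact hx (curlOf_eq_zero h)

lemma green_integrand_eq_zero {u φ : E3 → C3} {x : E3} (hx : x ∉ tsupport u) :
    dot (curlOf u x) (φ x) - dot (u x) (curlOf φ x) = 0 := by
  rw [curlOf_eq_zero hx, image_eq_zero_of_notMem_tsupport hx, zero_dot, zero_dot, sub_zero]

/-- Smooth compactly supported fields belong to the energy space. -/
def XSpace.ofTestField {S : Set E2} {L d : ℝ} (hSb : Bornology.IsBounded S)
    (hL : 0 < L) (hd : 0 < d) (u : E3 → C3) (hu : IsTestField u)
    (hsupp : tsupport u ⊆ domainΩ S L) : XSpace S L d where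
  field := u
  curl := curlOf u
  -- The support is a compact subset of the open set Ω, so nothing reaches ∂Ω.
  bdTrace := 0
  shTrace := fun x => tangential (u x)
  memLp_field := (hu.1.continuous.memLp_of_hasCompactSupport hu.2).restrict _
  memLp_curl := ((continuous_curlOf hu).memLp_of_hasCompactSupport
    (hasCompactSupport_curlOf hu)).restrict _
  memLp_bdTrace := MemLp.zero
  memLp_shTrace := by
    have := isFiniteMeasure_surfaceMeasure_layers hSb hL hd
    have hc : Continuous fun x => tangential (u x) := continuous_tangential.comp hu.1.continuous
    have hcs : HasCompactSupport fun x => tangential (u x) := hu.2.comp_left tangential_zero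
    obtain ⟨M, hM⟩ := hcs.exists_bound_of_continuous hc
    exact (memLp_top_of_bound hc.aestronglyMeasurable M (ae_of_all _ hM)).mono_exponent le_top
  weak_curl := fun φ hφ _ => by
    have h1 : Integrable (fun x => dot (curlOf u x) (φ x)) (volume.restrict (domainΩ S L)) :=
      integrable_dot (((continuous_curlOf hu).memLp_of_hasCompactSupport
        (hasCompactSupport_curlOf hu)).restrict _)
        ((hφ.1.continuous.memLp_of_hasCompactSupport hφ.2).restrict _)
    have h2 : Integrable (fun x => dot (u x) (curlOf φ x)) (volume.restrict (domainΩ S L)) :=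
      integrable_dot ((hu.1.continuous.memLp_of_hasCompactSupport hu.2).restrict _)
        (((continuous_curlOf hφ).memLp_of_hasCompactSupport
          (hasCompactSupport_curlOf hφ)).restrict _)
    rw [← sub_eq_zero, ← integral_sub h1 h2, ← integral_green hu hφ]
    exact setIntegral_eq_integral_of_forall_compl_eq_zero fun x hx =>
      green_integrand_eq_zero fun h => hx (hsupp h)
  bd_tangential := ae_of_all _ fun x => dot_zero _
  bd_green := fun φ hφ => by
    have h0 : ∀ w : C3, cross w 0 = 0 := fun w => by simp [cross]
    simp only [Pi.zero_apply, h0, zero_dot, integral_zero]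
    rw [← integral_green hu hφ]
    exact setIntegral_eq_integral_of_forall_compl_eq_zero fun x hx =>
      green_integrand_eq_zero fun h => hx (hsupp h)
  sh_tangential := ae_of_all _ fun x => dot_e3_tangential _
  sh_green := fun k hk φ hφ _ => by
    have h1 : ∫ x in {x ∈ domainΩ S L | x 2 < k * d},
        (dot (curlOf u x) (φ x) - dot (u x) (curlOf φ x)) =
        ∫ x in {x : E3 | x 2 < k * d}, (dot (curlOf u x) (φ x) - dot (u x) (curlOf φ x)) := by
      have hm : MeasurableSet {x : E3 | x 2 < k * d} :=
        (isOpen_Iio.preimage (by fun_prop : Continuous fun x : E3 => x 2)).measurableSet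
      have hsub : {x ∈ domainΩ S L | x 2 < k * d} ⊆ {x : E3 | x 2 < k * d} := fun x hx => hx.2
      exact (setIntegral_eq_of_subset_of_forall_sdiff_eq_zero hm hsub
        fun x hx => green_integrand_eq_zero fun h => hx.2 ⟨hsupp h, hx.1⟩).symm
    rw [h1, integral_green_halfSpace hu hφ]
    have h2 : ∀ x, dot (cross (toC e3) (tangential (u x))) (φ x) = crossComp u φ 0 1 x :=
      fun x => dot_cross_e3_tangential _ _
    simp_rw [h2]
    have hsub : sheet S d k ⊆ range (planeEmb (k * d)) := by
      rw [sheet_eq_image]; exact image_subset_range _ _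
    have hr : MeasurableSet (range (planeEmb (k * d))) :=
      (isometry_planeEmb (k * d)).isClosedEmbedding.isClosed_range.measurableSet
    -- The support of `u` lies in Ω, and Ω meets the plane at height k d only in the sheet. The
    -- integral may thus be taken over the whole plane, which is parametrized isometrically.
    have h3 : ∫ x, crossComp u φ 0 1 x ∂(surfaceMeasure (sheet S d k)) =
        ∫ x in range (planeEmb (k * d)), crossComp u φ 0 1 x ∂(μHE[2] : Measure E3) := by
      refine (setIntegral_eq_of_subset_of_forall_sdiff_eq_zero hr hsub fun x hx => ?_).symm
      have hx' : x ∉ tsupport u := fun h => hx.2 ⟨(hsupp h).1, by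
        have := hx.1; rw [range_planeEmb] at this; exact this⟩
      simp [crossComp, image_eq_zero_of_notMem_tsupport hx']
    rw [h3, ← (isometry_planeEmb (k * d)).map_euclideanHausdorffMeasure,
      EuclideanSpace.euclideanHausdorffMeasure_eq_volume,
      integral_map (isometry_planeEmb (k * d)).continuous.measurable.aemeasurable
        (hu.contDiff_crossComp hφ 0 1).continuous.aestronglyMeasurable]

/-! ### A priori estimates -/

section Weighted

variable {α : Type*} [MeasurableSpace α] {μ : Measure α} {u : α → C3} {w : α → ℂ}

lemma inner_self_C3 (v : C3) : inner ℂ v v = ((‖v‖ ^ 2 : ℝ) : ℂ) := by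
  rw [inner_self_eq_norm_sq_to_K]; push_cast; rfl

lemma integrable_norm_sq (hu : MemLp u 2 μ) : Integrable (fun x => ‖u x‖ ^ 2) μ :=
  hu.integrable_norm_pow two_ne_zero

lemma integrable_weighted (hw : AEStronglyMeasurable w μ) {K : ℝ} (hK : ∀ᵐ x ∂μ, ‖w x‖ ≤ K)
    (hu : MemLp u 2 μ) : Integrable (fun x => w x * inner ℂ (u x) (u x)) μ := by
  refine Integrable.bdd_mul ?_ hw hK
  exact integrable_inner_of_memLp hu hu

/-- Since ⟨u, u⟩ is real, the imaginary part falls on the weight alone. -/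
lemma integral_weighted_im_ge (hw : AEStronglyMeasurable w μ) {K c : ℝ}
    (hK : ∀ᵐ x ∂μ, ‖w x‖ ≤ K) (hu : MemLp u 2 μ) (hc : ∀ᵐ x ∂μ, c ≤ (w x).im) :
    c * ∫ x, ‖u x‖ ^ 2 ∂μ ≤ (∫ x, w x * inner ℂ (u x) (u x) ∂μ).im := by
  have hi := integrable_weighted hw hK hu
  have h1 : (∫ x, w x * inner ℂ (u x) (u x) ∂μ).im =
    ∫ x, (w x * inner ℂ (u x) (u x)).im ∂μ := (integral_im hi).symm
  rw [h1, ← integral_const_mul]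
  refine integral_mono_ae ((integrable_norm_sq hu).const_mul c) hi.im ?_
  filter_upwards [hc] with x hx
  change c * ‖u x‖ ^ 2 ≤ (w x * inner ℂ (u x) (u x)).im
  rw [inner_self_C3, Complex.im_mul_ofReal]
  exact mul_le_mul_of_nonneg_right hx (by positivity)

lemma abs_integral_weighted_re_le (hw : AEStronglyMeasurable w μ) {K C : ℝ}
    (hK : ∀ᵐ x ∂μ, ‖w x‖ ≤ K) (hu : MemLp u 2 μ) (hC : ∀ᵐ x ∂μ, |(w x).re| ≤ C) :
    |(∫ x, w x * inner ℂ (u x) (u x) ∂μ).re| ≤ C * ∫ x, ‖u x‖ ^ 2 ∂μ := by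
  have hi := integrable_weighted hw hK hu
  have h1 : (∫ x, w x * inner ℂ (u x) (u x) ∂μ).re =
    ∫ x, (w x * inner ℂ (u x) (u x)).re ∂μ := (integral_re hi).symm
  rw [h1, ← integral_const_mul, ← Real.norm_eq_abs]
  refine norm_integral_le_of_norm_le ((integrable_norm_sq hu).const_mul C) ?_
  filter_upwards [hC] with x hx
  rw [inner_self_C3, Complex.re_mul_ofReal, norm_mul, Real.norm_eq_abs, Real.norm_eq_abs,
    abs_of_nonneg (by positivity : 0 ≤ ‖u x‖ ^ 2)]
  exact mul_le_mul_of_nonneg_right hx (by positivity)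

lemma integral_const_mul_inner_self (a : ℂ) :
    ∫ x, a * inner ℂ (u x) (u x) ∂μ = a * ((∫ x, ‖u x‖ ^ 2 ∂μ : ℝ) : ℂ) := by
  rw [integral_const_mul]
  simp_rw [inner_self_C3]
  rw [integral_complex_ofReal]

lemma toReal_eLpNorm_sq (hu : MemLp u 2 μ) :
    (eLpNorm u 2 μ).toReal ^ 2 = ∫ x, ‖u x‖ ^ 2 ∂μ := by
  rw [← ENNReal.toReal_pow, eLpNorm_two_sq,
    integral_eq_lintegral_of_nonneg_ae (ae_of_all _ fun x => by positivity)
    (integrable_norm_sq hu).1]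
  congr 1
  refine lintegral_congr fun x => ?_
  rw [ENNReal.ofReal_pow (norm_nonneg _), ofReal_norm]

end Weighted

section Apriori

variable {S : Set E2} {L : ℝ}

lemma continuousOn_sigmaD {σ : E3 → E3 → ℂ} {Ω : Set E3} {K : ℝ≥0}
    (hσ : LipschitzOnWith K (Function.uncurry σ) (Ω ×ˢ univ)) (d : ℝ) :
    ContinuousOn (sigmaD σ d) Ω := by
  refine continuousOn_const.mul ?_
  exact hσ.continuousOn.comp (f := fun x => (x, d⁻¹ • x)) (by fun_prop)
    fun x hx => ⟨hx, mem_univ _⟩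

lemma norm_le_two_mul_of_abs_le {z : ℂ} {C : ℝ} (h1 : |z.re| ≤ C) (h2 : |z.im| ≤ C) :
    ‖z‖ ≤ 2 * C := (Complex.norm_le_abs_re_add_abs_im z).trans (by linarith)

/-- The real arithmetic behind the energy estimate. -/
lemma energy_bounds {freq μ c C d j e r s b : ℝ} {X Z R : ℂ} (hfreq : 0 < freq) (hμ : 0 < μ)
    (hc : 0 < c) (hC : 0 ≤ C) (hd : 0 < d) (hj0 : 0 ≤ j) (he0 : 0 ≤ e) (hlB : 0 ≤ b)
    (hsol : ((r ^ 2 / μ : ℝ) : ℂ) - X - Z - Complex.I * (b : ℂ) = Complex.I * ((freq : ℂ) * R))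
    (hrhs : ‖R‖ ≤ e * j) (hE1 : freq ^ 2 * c * e ^ 2 ≤ X.im)
    (hE2 : |X.re| ≤ freq ^ 2 * C * e ^ 2) (hS1 : freq * (c * d) * s ^ 2 ≤ Z.im)
    (hS2 : |Z.re| ≤ freq * (C * d) * s ^ 2) :
    e ≤ j / (freq * c) ∧ Real.sqrt d * s ≤ Real.sqrt (j / (freq * c) * j / c) ∧
      r ≤ Real.sqrt (μ * (freq ^ 2 * C * (j / (freq * c)) ^ 2 +
        freq * C * (j / (freq * c) * j / c) + freq * (j / (freq * c)) * j)) := by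
  have him := congrArg Complex.im hsol
  have hre := congrArg Complex.re hsol
  simp only [Complex.sub_im, Complex.sub_re, Complex.ofReal_im, Complex.ofReal_re,
    Complex.I_mul_im, Complex.I_mul_re, Complex.re_ofReal_mul, Complex.im_ofReal_mul] at him hre
  have hR1 := (Complex.abs_re_le_norm R).trans hrhs
  have hR2 := (Complex.abs_im_le_norm R).trans hrhs
  set M1 : ℝ := j / (freq * c) with hM1def
  have hR1' := abs_le.1 hR1
  have hR2' := abs_le.1 hR2
  have hfR1 : -(freq * R.re) ≤ freq * (e * j) := by nlinarith [hR1'.1]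
  have hfR2 : -(freq * R.im) ≤ freq * (e * j) := by nlinarith [hR2'.1]
  have hs20 : 0 ≤ s ^ 2 := by positivity
  -- Imaginary part of the energy identity. All three dissipative terms have the same sign; the
  -- boundary term `b` is nonnegative and is dropped.
  have hsum : freq ^ 2 * c * e ^ 2 + freq * (c * d) * s ^ 2 ≤ freq * (e * j) := by linarith
  have hfc : 0 < freq * c := by positivity
  have hsnn : 0 ≤ freq * (c * d) * s ^ 2 := by positivity
  have hM1 : e ≤ M1 := by
    rw [hM1def, le_div_iff₀ hfc]
    -- The estimate is quadratic in `e` on the left and linear on the right; a factor `freq * e` is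
    -- cancelled, which needs e ≠ 0.
    by_cases h0 : e = 0
    · rw [h0, zero_mul]; exact hj0
    · have hepos : 0 < e := lt_of_le_of_ne he0 (Ne.symm h0)
      have h1 : freq * e * (e * (freq * c)) ≤ freq * e * j := by nlinarith
      exact le_of_mul_le_mul_left h1 (by positivity)
  have hM10 : 0 ≤ M1 := he0.trans hM1
  have hej : e * j ≤ M1 * j := mul_le_mul_of_nonneg_right hM1 hj0
  have hds : d * s ^ 2 ≤ M1 * j / c := by
    rw [le_div_iff₀ hc]
    have h1 : freq * (d * s ^ 2 * c) ≤ freq * (e * j) := by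
      have : 0 ≤ freq ^ 2 * c * e ^ 2 := by positivity
      nlinarith
    exact (le_of_mul_le_mul_left h1 hfreq).trans hej
  have hM2 : Real.sqrt d * s ≤ Real.sqrt (M1 * j / c) := by
    refine Real.le_sqrt_of_sq_le ?_
    rw [mul_pow, Real.sq_sqrt hd.le]
    exact hds
  -- Real part of the energy identity, with the bounds on `e` and `d * s ^ 2` inserted.
  have hM3 : r ≤ Real.sqrt (μ * (freq ^ 2 * C * M1 ^ 2 + freq * C * (M1 * j / c) + freq * M1 * j)) := by
    refine Real.le_sqrt_of_sq_le ?_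
    have h1 := (abs_le.1 hE2).2
    have h2 := (abs_le.1 hS2).2
    have h3 : r ^ 2 / μ ≤ freq ^ 2 * C * e ^ 2 + freq * (C * d) * s ^ 2 + freq * (e * j) := by
      linarith
    have h4 : freq ^ 2 * C * e ^ 2 ≤ freq ^ 2 * C * M1 ^ 2 := by gcongr
    have h5 : freq * (C * d) * s ^ 2 ≤ freq * C * (M1 * j / c) := by
      calc freq * (C * d) * s ^ 2 = freq * C * (d * s ^ 2) := by ring
        _ ≤ _ := by gcongr
    have h6 : freq * (e * j) ≤ freq * M1 * j := by nlinarith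
    have h7 : r ^ 2 / μ ≤ freq ^ 2 * C * M1 ^ 2 + freq * C * (M1 * j / c) + freq * M1 * j := by
      linarith
    rw [div_le_iff₀ hμ] at h7
    linarith
  exact ⟨hM1, hM2, hM3⟩

/-- Uniform bounds for the solutions of the Maxwell problem. -/
theorem exists_apriori_bound (hS : IsOpen S) (freq μ lam : ℝ)
    (hfreq : 0 < freq) (hμ : 0 < μ) (hlam : 0 < lam) (c C : ℝ) (hc : 0 < c) (hC : 0 ≤ C)
    (J : E3 → C3) (hJ : MemLp J 2 (volume.restrict (domainΩ S L))) :
    ∃ M : ℝ, ∀ (d : ℝ), 0 < d → ∀ epsd sigd : E3 → ℂ,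
      AEStronglyMeasurable epsd (volume.restrict (domainΩ S L)) →
      AEStronglyMeasurable sigd (surfaceMeasure (layers S L d)) →
      (∀ x ∈ domainΩ S L, c ≤ (epsd x).im ∧ (epsd x).im ≤ C ∧ |(epsd x).re| ≤ C) →
      (∀ x ∈ layers S L d, c * d ≤ (sigd x).re ∧ (sigd x).re ≤ C * d ∧ |(sigd x).im| ≤ C * d) →
      ∀ E : XSpace S L d, IsMaxwellSolution freq μ lam epsd sigd J E →
        (eLpNorm E.field 2 (volume.restrict (domainΩ S L))).toReal ≤ M ∧
        (eLpNorm E.curl 2 (volume.restrict (domainΩ S L))).toReal ≤ M ∧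
        Real.sqrt d * (eLpNorm E.shTrace 2 (surfaceMeasure (layers S L d))).toReal ≤ M := by
  set j := (eLpNorm J 2 (volume.restrict (domainΩ S L))).toReal with hj
  have hj0 : 0 ≤ j := ENNReal.toReal_nonneg
  let M1 : ℝ := j / (freq * c)
  let M2 : ℝ := Real.sqrt (M1 * j / c)
  let M3 : ℝ := Real.sqrt (μ * (freq ^ 2 * C * M1 ^ 2 + freq * C * (M1 * j / c) + freq * M1 * j))
  refine ⟨max (max M1 M2) M3, fun d hd epsd sigd hem hsm heps hsig E hE => ?_⟩
  have hΩ : MeasurableSet (domainΩ S L) := (isOpen_domainΩ hS).measurableSet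
  have hlay : MeasurableSet (layers S L d) := measurableSet_layers hS L d
  set e := (eLpNorm E.field 2 (volume.restrict (domainΩ S L))).toReal with he
  set r := (eLpNorm E.curl 2 (volume.restrict (domainΩ S L))).toReal with hr
  set s := (eLpNorm E.shTrace 2 (surfaceMeasure (layers S L d))).toReal with hs
  have he0 : 0 ≤ e := ENNReal.toReal_nonneg
  have he2 := toReal_eLpNorm_sq E.memLp_field
  have hr2 := toReal_eLpNorm_sq E.memLp_curl
  have hs2 := toReal_eLpNorm_sq E.memLp_shTrace
  rw [← he] at he2; rw [← hr] at hr2; rw [← hs] at hs2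
  -- The solution is its own test function.
  have hsol := hE E
  rw [form] at hsol
  set B := ∫ x, ‖E.bdTrace x‖ ^ 2 ∂(surfaceMeasure (frontier (domainΩ S L))) with hB
  have hB0 : 0 ≤ B := integral_nonneg fun x => by positivity
  have hrhs := norm_integral_inner_le E.memLp_field hJ
  rw [← he, ← hj] at hrhs
  set R := ∫ x in domainΩ S L, inner ℂ (E.field x) (J x) with hR
  have haeΩ : ∀ᵐ x ∂(volume.restrict (domainΩ S L)), x ∈ domainΩ S L := ae_restrict_mem hΩ
  have haelay : ∀ᵐ x ∂(surfaceMeasure (layers S L d)), x ∈ layers S L d := ae_restrict_mem hlay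
  rw [integral_const_mul_inner_self, integral_const_mul_inner_self, ← hr2, ← hB] at hsol
  have hwe : AEStronglyMeasurable (fun x => (freq : ℂ) ^ 2 * epsd x)
      (volume.restrict (domainΩ S L)) := hem.const_mul _
  have hws : AEStronglyMeasurable (fun x => Complex.I * freq * sigd x)
      (surfaceMeasure (layers S L d)) := hsm.const_mul _
  have ere : ∀ x, ((freq : ℂ) ^ 2 * epsd x).re = freq ^ 2 * (epsd x).re := fun x => by
    rw [← Complex.ofReal_pow, Complex.re_ofReal_mul]
  have eim : ∀ x, ((freq : ℂ) ^ 2 * epsd x).im = freq ^ 2 * (epsd x).im := fun x => by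
    rw [← Complex.ofReal_pow, Complex.im_ofReal_mul]
  -- The factor i turns Re σ into an imaginary part, so the coercivity of Re σ and that of Im ε
  -- appear in the same half of the identity.
  have sre : ∀ x, (Complex.I * freq * sigd x).re = -(freq * (sigd x).im) := fun x => by
    simp
  have sim : ∀ x, (Complex.I * freq * sigd x).im = freq * (sigd x).re := fun x => by
    simp
  have hKe : ∀ᵐ x ∂(volume.restrict (domainΩ S L)),
      ‖(freq : ℂ) ^ 2 * epsd x‖ ≤ 2 * (freq ^ 2 * C) := by
    filter_upwards [haeΩ] with x hx
    obtain ⟨h1, h2, h3⟩ := heps x hx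
    refine norm_le_two_mul_of_abs_le ?_ ?_
    · rw [ere, abs_mul, abs_of_nonneg (by positivity : 0 ≤ freq ^ 2)]; gcongr
    · rw [eim, abs_mul, abs_of_nonneg (by positivity : 0 ≤ freq ^ 2), abs_of_pos (hc.trans_le h1)]
      gcongr
  have hKs : ∀ᵐ x ∂(surfaceMeasure (layers S L d)),
      ‖Complex.I * freq * sigd x‖ ≤ 2 * (freq * (C * d)) := by
    filter_upwards [haelay] with x hx
    obtain ⟨h1, h2, h3⟩ := hsig x hx
    refine norm_le_two_mul_of_abs_le ?_ ?_
    · rw [sre, abs_neg, abs_mul, abs_of_pos hfreq]; gcongr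
    · rw [sim, abs_mul, abs_of_pos hfreq, abs_of_pos ((mul_pos hc hd).trans_le h1)]
      gcongr
  have hE1 := integral_weighted_im_ge hwe hKe E.memLp_field (c := freq ^ 2 * c) (by
    filter_upwards [haeΩ] with x hx
    rw [eim]; exact mul_le_mul_of_nonneg_left (heps x hx).1 (by positivity))
  have hE2 := abs_integral_weighted_re_le hwe hKe E.memLp_field (C := freq ^ 2 * C) (by
    filter_upwards [haeΩ] with x hx
    rw [ere, abs_mul, abs_of_nonneg (by positivity : 0 ≤ freq ^ 2)]
    exact mul_le_mul_of_nonneg_left (heps x hx).2.2 (by positivity))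
  have hS1 := integral_weighted_im_ge hws hKs E.memLp_shTrace (c := freq * (c * d)) (by
    filter_upwards [haelay] with x hx
    rw [sim]; exact mul_le_mul_of_nonneg_left (hsig x hx).1 hfreq.le)
  have hS2 := abs_integral_weighted_re_le hws hKs E.memLp_shTrace (C := freq * (C * d)) (by
    filter_upwards [haelay] with x hx
    rw [sre, abs_neg, abs_mul, abs_of_pos hfreq]
    exact mul_le_mul_of_nonneg_left (hsig x hx).2.2 hfreq.le)
  rw [← he2] at hE1 hE2
  rw [← hs2] at hS1 hS2
  set X := ∫ x in domainΩ S L, (freq : ℂ) ^ 2 * epsd x * inner ℂ (E.field x) (E.field x) with hX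
  set Z := ∫ x, Complex.I * freq * sigd x * inner ℂ (E.shTrace x) (E.shTrace x)
    ∂(surfaceMeasure (layers S L d)) with hZ
  have hc1 : ((1 / μ : ℂ) * ((r ^ 2 : ℝ) : ℂ)) = ((r ^ 2 / μ : ℝ) : ℂ) := by
    push_cast; ring
  have hc2 : (Complex.I * freq * lam * (B : ℂ)) = Complex.I * ((freq * lam * B : ℝ) : ℂ) := by
    push_cast; ring
  have hc3 : Complex.I * freq * R = Complex.I * ((freq : ℂ) * R) := by ring
  rw [hc1, hc2, hc3] at hsol
  obtain ⟨hM1, hM2, hM3⟩ := energy_bounds hfreq hμ hc hC hd hj0 he0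
    (by positivity : 0 ≤ freq * lam * B) hsol hrhs hE1 hE2 hS1 hS2
  exact ⟨hM1.trans ((le_max_left _ _).trans (le_max_left _ _)), hM3.trans (le_max_right _ _),
    hM2.trans ((le_max_right _ _).trans (le_max_left _ _))⟩

end Apriori

/-! ### Oscillating test functions -/

/-- The scaled oscillating function `d η(x) exp(2π i k · x / d)`. -/
def oscFun (η : E3 → ℝ) (k : Fin 3 → ℤ) (d : ℝ) (x : E3) : ℂ :=
  d * (η x * cellExp k (d⁻¹ • x))

/-- An integer vector, viewed as a complex one. -/
def intVec (k : Fin 3 → ℤ) : C3 := WithLp.toLp 2 fun i => (k i : ℂ)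

section Osc

variable {η : E3 → ℝ} {k : Fin 3 → ℤ} {d : ℝ}

lemma contDiff_oscFun (hη : ContDiff ℝ ∞ η) : ContDiff ℝ ∞ (oscFun η k d) := by
  have h1 : ContDiff ℝ ∞ fun x => (η x : ℂ) := Complex.ofRealCLM.contDiff.comp hη
  have h2 : ContDiff ℝ ∞ fun x : E3 => cellExp k (d⁻¹ • x) :=
    (contDiff_cellExp k).comp (contDiff_const_smul d⁻¹)
  exact contDiff_const.mul (h1.mul h2)

lemma tsupport_oscFun_subset : tsupport (oscFun η k d) ⊆ tsupport η :=
  closure_mono fun x hx => by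
    contrapose! hx
    have : η x = 0 := by simpa using hx
    simp [oscFun, this]

/-- The prefactor d cancels the 1/d produced by differentiating the oscillation: the function is
O(d) and its derivative is O(1). -/
lemma fderiv_oscFun (hη : ContDiff ℝ ∞ η) (hd : d ≠ 0) (x v : E3) :
    fderiv ℝ (oscFun η k d) x v = cellExp k (d⁻¹ • x) *
      (d * (fderiv ℝ η x v : ℂ) + η x * (2 * Real.pi * Complex.I * freqForm k v)) := by
  have h1 : HasFDerivAt η (fderiv ℝ η x) x := (hη.differentiable (by simp) x).hasFDerivAt
  have h2 : HasFDerivAt (fun x => (η x : ℂ)) (Complex.ofRealCLM ∘L fderiv ℝ η x) x :=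
    Complex.ofRealCLM.hasFDerivAt.comp x h1
  have h3 : HasFDerivAt (fun x : E3 => d⁻¹ • x) (d⁻¹ • ContinuousLinearMap.id ℝ E3) x :=
    (hasFDerivAt_id x).const_smul d⁻¹
  have h4 := (hasFDerivAt_cellExp k (d⁻¹ • x)).comp x h3
  have h5 := ((h2.mul h4).const_mul (d : ℂ)).fderiv
  have h6 : fderiv ℝ (oscFun η k d) x = _ := h5
  rw [h6]
  have hd' : (d : ℂ) ≠ 0 := by exact_mod_cast hd
  simp
  field_simp
  ring

/-- A scalar function times a constant vector. -/
def constField (f : E3 → ℂ) (b : C3) (x : E3) : C3 := f x • b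

lemma fderiv_constField {f : E3 → ℂ} (hf : ContDiff ℝ ∞ f) (b : C3) (x v : E3) :
    fderiv ℝ (constField f b) x v = fderiv ℝ f x v • b := by
  have h1 : HasFDerivAt f (fderiv ℝ f x) x := (hf.differentiable (by simp) x).hasFDerivAt
  have h2 := (h1.smul_const b).fderiv
  have h3 : fderiv ℝ (constField f b) x = _ := h2
  rw [h3]
  simp

lemma curlOf_constField {f : E3 → ℂ} (hf : ContDiff ℝ ∞ f) (b : C3) (x : E3) :
    curlOf (constField f b) x = cross (gradOf f x) b := by
  ext i
  simp only [curlOf, pderivComp, fderiv_constField hf, cross, gradOf, cross_apply]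
  fin_cases i <;> simp

lemma isTestField_constField {f : E3 → ℂ} (hf : ContDiff ℝ ∞ f) (hs : HasCompactSupport f)
    (b : C3) : IsTestField (constField f b) :=
  ⟨hf.smul contDiff_const, hs.smul_right⟩

lemma tsupport_constField_subset {f : E3 → ℂ} {b : C3} :
    tsupport (constField f b) ⊆ tsupport f :=
  tsupport_smul_subset_left f fun _ => b

lemma contDiff_gradOf {f : E3 → ℂ} (hf : ContDiff ℝ ∞ f) : ContDiff ℝ ∞ (gradOf f) := by
  refine (contDiff_piLp 2).2 fun i => ?_
  exact (hf.fderiv_right (m := ∞) (by simp)).clm_apply contDiff_const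

lemma gradOf_eq_zero {f : E3 → ℂ} {x : E3} (hx : x ∉ tsupport f) : gradOf f x = 0 := by
  have : fderiv ℝ f x = 0 := by
    by_contra h
    exact hx (support_fderiv_subset ℝ h)
  ext i
  simp [gradOf, this]

lemma tsupport_gradOf_subset {f : E3 → ℂ} : tsupport (gradOf f) ⊆ tsupport f := by
  refine closure_minimal (fun x hx => ?_) (isClosed_tsupport f)
  by_contra h
  exact hx (gradOf_eq_zero h)

lemma isTestField_gradOf {f : E3 → ℂ} (hf : ContDiff ℝ ∞ f) (hs : HasCompactSupport f) :
    IsTestField (gradOf f) :=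
  ⟨contDiff_gradOf hf, hs.of_isClosed_subset (isClosed_tsupport _) tsupport_gradOf_subset⟩

lemma pderivComp_gradOf {f : E3 → ℂ} (hf : ContDiff ℝ ∞ f) (i j : Fin 3) (x : E3) :
    pderivComp (gradOf f) j i x =
      fderiv ℝ (fderiv ℝ f) x (EuclideanSpace.single j 1) (EuclideanSpace.single i 1) := by
  have h1 : DifferentiableAt ℝ (fderiv ℝ f) x :=
    ((hf.fderiv_right (m := ∞) (by simp)).differentiable (by simp)) x
  have h2 : DifferentiableAt ℝ (gradOf f) x := (contDiff_gradOf hf).differentiable (by simp) x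
  have h3 := (((EuclideanSpace.proj i : C3 →L[ℂ] ℂ).restrictScalars ℝ).hasFDerivAt).comp x
    h2.hasFDerivAt
  have h4 : HasFDerivAt (fun x => fderiv ℝ f x (EuclideanSpace.single i 1)) _ x := h3
  have h5 := h1.hasFDerivAt.clm_apply
    (hasFDerivAt_const (EuclideanSpace.single i (1 : ℝ) : E3) x)
  have h6 := congrArg (fun T => T (EuclideanSpace.single j 1)) (h4.unique h5)
  simpa [pderivComp] using h6

lemma curlOf_gradOf {f : E3 → ℂ} (hf : ContDiff ℝ ∞ f) (x : E3) : curlOf (gradOf f) x = 0 := by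
  have h : ∀ i j, pderivComp (gradOf f) j i x = pderivComp (gradOf f) i j x := fun i j => by
    rw [pderivComp_gradOf hf, pderivComp_gradOf hf]
    exact second_derivative_symmetric
      (fun y => (hf.differentiable (by simp) y).hasFDerivAt)
      (((hf.fderiv_right (m := ∞) (by simp)).differentiable (by simp)) x).hasFDerivAt _ _
  simp only [curlOf, h 2 1, h 0 2, h 1 0, sub_self]
  ext i
  fin_cases i <;> rfl

lemma gradOf_oscFun (hη : ContDiff ℝ ∞ η) (hd : d ≠ 0) (x : E3) :
    gradOf (oscFun η k d) x = cellExp k (d⁻¹ • x) •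
      ((d : ℂ) • gradOf (fun x => (η x : ℂ)) x +
        (η x : ℂ) • (2 * Real.pi * Complex.I : ℂ) • intVec k) := by
  have h1 : HasFDerivAt η (fderiv ℝ η x) x := (hη.differentiable (by simp) x).hasFDerivAt
  have h2 : fderiv ℝ (fun x => (η x : ℂ)) x = Complex.ofRealCLM ∘L fderiv ℝ η x :=
    (Complex.ofRealCLM.hasFDerivAt.comp x h1).fderiv
  ext i
  simp [gradOf, fderiv_oscFun hη hd, freqForm_single, intVec, h2, mul_add]

lemma cross_smul_add (a t : ℂ) (u v b : C3) :
    cross (a • (t • u + v)) b = a • (t • cross u b + cross v b) := by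
  simp [cross]

lemma cross_smul_left (a : ℂ) (u b : C3) : cross (a • u) b = a • cross u b := by
  simp [cross]

lemma continuous_cross_left (b : C3) : Continuous fun u => cross u b := by
  unfold cross
  simp only [cross_apply]
  fun_prop

lemma zero_cross (b : C3) : cross 0 b = 0 := by simp [cross]

/-- The curl splits into a slow part carrying a factor d and an O(1) part along k × b, the form
needed for `TwoScaleConverges.tendsto_oscillating`. -/
lemma curlOf_osc (hη : ContDiff ℝ ∞ η) (hd : d ≠ 0) (b : C3) (x : E3) :
    curlOf (constField (oscFun η k d) b) x = cellExp k (d⁻¹ • x) •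
      ((d : ℂ) • cross (gradOf (fun x => (η x : ℂ)) x) b +
        (η x : ℂ) • (2 * Real.pi * Complex.I : ℂ) • cross (intVec k) b) := by
  rw [curlOf_constField (contDiff_oscFun hη), gradOf_oscFun hη hd, cross_smul_add,
    cross_smul_left, cross_smul_left]

end Osc

/-! ### Two-scale limits against oscillating fields -/

section Limits

variable {Ω : Set E3} {d : ℕ → ℝ} {u : ℕ → E3 → C3} {u₀ : E3 → E3 → C3}

lemma isTwoScaleTest_cellExp_smul (k : Fin 3 → ℤ) {w : E3 → C3} (hw : Continuous w)
    (hwΩ : ∀ x ∉ Ω, w x = 0) : IsTwoScaleTest Ω fun x y => cellExp k y • w x := by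
  refine ⟨?_, fun x m y => ?_, fun x hx y => ?_⟩
  · exact ((contDiff_cellExp k).continuous.comp continuous_snd).smul (hw.comp continuous_fst)
  · simp only
    rw [isYPeriodic_cellExp k m y]
  · simp only
    rw [hwΩ x hx, smul_zero]

lemma IsTwoScaleTest.memLp_oscillating (hΩb : Bornology.IsBounded Ω) {Ψ : E3 → E3 → C3}
    (hΨ : IsTwoScaleTest Ω Ψ) (d : ℝ) :
    MemLp (fun x => Ψ x (d⁻¹ • x)) 2 (volume.restrict Ω) := by
  obtain ⟨C, -, hC⟩ := hΨ.exists_bound hΩb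
  have : IsFiniteMeasure (volume.restrict Ω) := ⟨by
    rw [Measure.restrict_apply_univ]; exact hΩb.measure_lt_top⟩
  have hc : Continuous fun x : E3 => Ψ x (d⁻¹ • x) :=
    hΨ.1.comp (f := fun x : E3 => (x, d⁻¹ • x)) (by fun_prop)
  exact (memLp_top_of_bound hc.aestronglyMeasurable C
    (ae_of_all _ fun p => hC _ _)).mono_exponent le_top

lemma dot_smul (a : ℂ) (v w : C3) : dot v (a • w) = a * dot v w := by
  simp only [dot, PiLp.smul_apply, smul_eq_mul, Finset.mul_sum]
  exact Finset.sum_congr rfl fun i _ => by ring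

lemma smul_dot (a : ℂ) (v w : C3) : dot (a • v) w = a * dot v w := by
  simp only [dot, PiLp.smul_apply, smul_eq_mul, Finset.mul_sum]
  exact Finset.sum_congr rfl fun i _ => by ring

lemma dot_add (v w z : C3) : dot v (w + z) = dot v w + dot v z := by
  simp only [dot, PiLp.add_apply, mul_add, Finset.sum_add_distrib]

/-- `w₁` and `w₂` give two test functions independent of d. The integrals against the first
converge, so the factor d makes that part vanish in the limit. -/
lemma TwoScaleConverges.tendsto_oscillating (h : TwoScaleConverges Ω d u u₀)
    (hΩb : Bornology.IsBounded Ω) (hd0 : Tendsto d atTop (𝓝 0))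
    (k : Fin 3 → ℤ) {w₁ w₂ : E3 → C3} (hw₁ : Continuous w₁) (hw₂ : Continuous w₂)
    (h₁ : ∀ x ∉ Ω, w₁ x = 0) (h₂ : ∀ x ∉ Ω, w₂ x = 0) :
    Tendsto (fun n => ∫ x in Ω, dot (u n x)
      (cellExp k ((d n)⁻¹ • x) • ((d n : ℂ) • w₁ x + w₂ x))) atTop
      (𝓝 (∫ x in Ω, ∫ y in unitCell, dot (u₀ x y) (cellExp k y • w₂ x))) := by
  have t1 := isTwoScaleTest_cellExp_smul (Ω := Ω) k hw₁ h₁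
  have t2 := isTwoScaleTest_cellExp_smul (Ω := Ω) k hw₂ h₂
  have l1 := h.2.2 _ t1
  have l2 := h.2.2 _ t2
  have hdc : Tendsto (fun n => (d n : ℂ)) atTop (𝓝 0) := by
    have := (Complex.continuous_ofReal.tendsto 0).comp hd0
    simpa [Function.comp_def] using this
  have l3 := (hdc.mul l1).add l2
  rw [zero_mul, zero_add] at l3
  refine l3.congr fun n => ?_
  have i1 := integrable_dot (h.1 n) (t1.memLp_oscillating hΩb (d n))
  have i2 := integrable_dot (h.1 n) (t2.memLp_oscillating hΩb (d n))
  rw [← integral_const_mul, ← integral_add (i1.const_mul _) i2]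
  refine integral_congr_ae (ae_of_all _ fun x => ?_)
  simp only [smul_add, dot_add, dot_smul]
  ring

end Limits

/-! ### Vanishing Fourier coefficients -/

/-- Arbitrary cut-offs η localize the identity in x. As `dot` does not conjugate, integrating
against `cellExp k` produces the coefficient of frequency −k. -/
lemma ae_sum_vecCoeff_eq_zero {Ω : Set E3} (hΩ : IsOpen Ω) (hΩb : Bornology.IsBounded Ω)
    {G : E3 → E3 → C3} (hG : MemL2Prod Ω G) (k : Fin 3 → ℤ) (v : C3)
    (h : ∀ η : E3 → ℝ, ContDiff ℝ ∞ η → HasCompactSupport η → tsupport η ⊆ Ω →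
      ∫ x in Ω, ∫ y in unitCell, dot (G x y) (cellExp k y • (η x : ℂ) • v) = 0) :
    ∀ᵐ x ∂(volume.restrict Ω), ∑ i, v i * vecCoeff G (-k) x i = 0 := by
  have : IsFiniteMeasure (volume.restrict Ω) := ⟨by
    rw [Measure.restrict_apply_univ]; exact hΩb.measure_lt_top⟩
  have hint : Integrable (fun x => ∑ i, v i * vecCoeff G (-k) x i) (volume.restrict Ω) :=
    integrable_finsetSum _ fun i _ =>
      ((memLp_vecCoeff hG (-k) i).integrable (by norm_num)).const_mul _
  have hslice : ∀ᵐ x ∂(volume.restrict Ω), ∀ i, MemLp (fun y => G x y i) 2 cellMeasure := by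
    rw [ae_all_iff]
    intro i
    exact ae_memLp_slice (f := fun x y => G x y i) (hG.component i)
  have hae := hΩ.ae_eq_zero_of_integral_contDiff_smul_eq_zero (μ := volume.restrict Ω)
    hint.integrableOn.locallyIntegrableOn fun η hη hηc hηs => by
      rw [← h η hη hηc hηs]
      refine integral_congr_ae ?_
      filter_upwards [hslice] with x hx
      have hi : ∀ i, Integrable (fun y => (η x : ℂ) * (v i * (cellExp k y * G x y i)))
          cellMeasure := fun i => by
        have h1 : Integrable (fun y => cellExp k y * G x y i) cellMeasure :=
          Integrable.bdd_mul (c := 1) ((hx i).integrable (by norm_num))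
            (contDiff_cellExp k).continuous.aestronglyMeasurable
            (ae_of_all _ fun y => (norm_cellExp k y).le)
        exact (h1.const_mul _).const_mul _
      have h2 : ∀ y, dot (G x y) (cellExp k y • (η x : ℂ) • v) =
          ∑ i, (η x : ℂ) * (v i * (cellExp k y * G x y i)) := fun y => by
        simp only [dot, PiLp.smul_apply, smul_eq_mul]
        exact Finset.sum_congr rfl fun i _ => by ring
      simp_rw [h2]
      change _ = ∫ y, _ ∂cellMeasure
      rw [integral_finsetSum _ fun i _ => hi i, Complex.real_smul, Finset.mul_sum]
      refine Finset.sum_congr rfl fun i _ => ?_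
      rw [integral_const_mul, integral_const_mul, vecCoeff, cellCoeff, neg_neg]
  filter_upwards [hae, ae_restrict_mem hΩ.measurableSet] with x hx hxΩ using hx hxΩ

/-! ### Estimates for the Maxwell system -/

section Estimates

variable {α : Type*} [MeasurableSpace α] {μ : Measure α}

lemma norm_integral_weighted_inner_le {f g : α → C3} {w : α → ℂ} {K : ℝ}
    (hw : AEStronglyMeasurable w μ) (hK : ∀ᵐ x ∂μ, ‖w x‖ ≤ K) (hK0 : 0 ≤ K)
    (hf : MemLp f 2 μ) (hg : MemLp g 2 μ) :
    ‖∫ x, w x * inner ℂ (f x) (g x) ∂μ‖ ≤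
      K * ((eLpNorm f 2 μ).toReal * (eLpNorm g 2 μ).toReal) := by
  have hle : eLpNorm (fun x => w x • g x) 2 μ ≤ ENNReal.ofReal K * eLpNorm g 2 μ :=
    eLpNorm_le_mul_eLpNorm_of_ae_le_mul (by
      filter_upwards [hK] with x hx
      rw [norm_smul]
      exact mul_le_mul_of_nonneg_right hx (norm_nonneg _)) 2
  have hfin : ENNReal.ofReal K * eLpNorm g 2 μ ≠ ⊤ := ENNReal.mul_ne_top ENNReal.ofReal_ne_top
    hg.2.ne
  have hwg : MemLp (fun x => w x • g x) 2 μ := ⟨hw.smul hg.1, hle.trans_lt hfin.lt_top⟩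
  have h1 : ∀ x, w x * inner ℂ (f x) (g x) = inner ℂ (f x) (w x • g x) := fun x => by
    rw [inner_smul_right]
  simp_rw [h1]
  refine (norm_integral_inner_le hf hwg).trans ?_
  have h2 : (eLpNorm (fun x => w x • g x) 2 μ).toReal ≤ K * (eLpNorm g 2 μ).toReal := by
    have := ENNReal.toReal_mono hfin hle
    rwa [ENNReal.toReal_mul, ENNReal.toReal_ofReal hK0] at this
  calc _ ≤ (eLpNorm f 2 μ).toReal * (K * (eLpNorm g 2 μ).toReal) :=
        mul_le_mul_of_nonneg_left h2 ENNReal.toReal_nonneg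
    _ = _ := by ring

lemma toReal_eLpNorm_le_of_bound [IsFiniteMeasure μ] {f : α → C3} {B : ℝ} (hB : 0 ≤ B)
    (hf : ∀ x, ‖f x‖ ≤ B) : (eLpNorm f 2 μ).toReal ≤ B * Real.sqrt (μ univ).toReal := by
  have h := eLpNorm_le_of_ae_bound (p := 2) (μ := μ) (ae_of_all _ hf)
  have hfin : μ univ ^ (2 : ENNReal).toReal⁻¹ * ENNReal.ofReal B ≠ ⊤ :=
    ENNReal.mul_ne_top (ENNReal.rpow_ne_top_of_nonneg (by simp) (measure_ne_top _ _))
      ENNReal.ofReal_ne_top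
  have h2 := ENNReal.toReal_mono hfin h
  rw [ENNReal.toReal_mul, ENNReal.toReal_ofReal hB, ← ENNReal.toReal_rpow] at h2
  rw [Real.sqrt_eq_rpow, mul_comm]
  simpa using h2

end Estimates

section Maxwell

variable {S : Set E2} {L d : ℝ}

lemma toReal_surfaceMeasure_layers_le (hSb : Bornology.IsBounded S) (hL : 0 < L) (hd : 0 < d) :
    (surfaceMeasure (layers S L d) univ).toReal ≤ (2 * L / d + 1) * (volume S).toReal := by
  rw [surfaceMeasure, Measure.restrict_apply_univ]
  have hfin : ENNReal.ofReal (2 * L / d + 1) * volume S ≠ ⊤ :=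
    ENNReal.mul_ne_top ENNReal.ofReal_ne_top hSb.measure_lt_top.ne
  have h := ENNReal.toReal_mono hfin (measure_layers_le S hL hd)
  rwa [ENNReal.toReal_mul, ENNReal.toReal_ofReal (by positivity)] at h

/-- Testing the Maxwell system with a smooth field of size `d`. -/
lemma norm_integral_curl_test_le (hS : IsOpen S) (hSb : Bornology.IsBounded S) (hL : 0 < L)
    (hd : 0 < d) {freq μ lam C M N : ℝ} (hfreq : 0 < freq) (hμ : 0 < μ) (hC : 0 ≤ C) (hN : 0 ≤ N)
    {J : E3 → C3} (hJ : MemLp J 2 (volume.restrict (domainΩ S L))) {epsd sigd : E3 → ℂ}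
    (hem : AEStronglyMeasurable epsd (volume.restrict (domainΩ S L)))
    (hsm : AEStronglyMeasurable sigd (surfaceMeasure (layers S L d)))
    (heps : ∀ x ∈ domainΩ S L, ‖epsd x‖ ≤ C) (hsig : ∀ x ∈ layers S L d, ‖sigd x‖ ≤ C * d)
    {E : XSpace S L d} (hE : IsMaxwellSolution freq μ lam epsd sigd J E)
    (hM1 : (eLpNorm E.field 2 (volume.restrict (domainΩ S L))).toReal ≤ M)
    (hM2 : Real.sqrt d * (eLpNorm E.shTrace 2 (surfaceMeasure (layers S L d))).toReal ≤ M)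
    {u : E3 → C3} (hu : IsTestField u) (hsupp : tsupport u ⊆ domainΩ S L)
    (huN : ∀ x, ‖u x‖ ≤ d * N) :
    ‖∫ x in domainΩ S L, inner ℂ (curlOf u x) (E.curl x)‖ ≤
      μ * (d * (freq ^ 2 * C * (N * Real.sqrt (volume (domainΩ S L)).toReal * M) +
        freq * C * (N * Real.sqrt ((2 * L + d) * (volume S).toReal) * M) +
        freq * (N * Real.sqrt (volume (domainΩ S L)).toReal *
          (eLpNorm J 2 (volume.restrict (domainΩ S L))).toReal))) := by
  have hΩ : MeasurableSet (domainΩ S L) := (isOpen_domainΩ hS).measurableSet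
  have hlay : MeasurableSet (layers S L d) := measurableSet_layers hS L d
  have hfinΩ : IsFiniteMeasure (volume.restrict (domainΩ S L)) := ⟨by
    rw [Measure.restrict_apply_univ]; exact (isBounded_domainΩ hSb).measure_lt_top⟩
  have hfinL := isFiniteMeasure_surfaceMeasure_layers hSb hL hd
  have hdN : 0 ≤ d * N := by positivity
  have huL2 : MemLp u 2 (volume.restrict (domainΩ S L)) :=
    (hu.1.continuous.memLp_of_hasCompactSupport hu.2).restrict _
  have hsol := hE (XSpace.ofTestField hSb hL hd u hu hsupp)
  have hshL2 := (XSpace.ofTestField hSb hL hd u hu hsupp).memLp_shTrace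
  -- The test field has zero trace on ∂Ω, so the term with λ drops out.
  simp only [form, XSpace.ofTestField, Pi.zero_apply, inner_zero_left, mul_zero, integral_zero,
    sub_zero] at hsol hshL2
  rw [integral_const_mul] at hsol
  have hnu : (eLpNorm u 2 (volume.restrict (domainΩ S L))).toReal ≤
      d * N * Real.sqrt (volume (domainΩ S L)).toReal := by
    have := toReal_eLpNorm_le_of_bound (μ := volume.restrict (domainΩ S L)) hdN huN
    rwa [Measure.restrict_apply_univ] at this
  have hnt : (eLpNorm (fun x => tangential (u x)) 2 (surfaceMeasure (layers S L d))).toReal ≤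
      d * N * Real.sqrt ((2 * L / d + 1) * (volume S).toReal) := by
    refine (toReal_eLpNorm_le_of_bound hdN fun x => (norm_tangential_le _).trans (huN x)).trans ?_
    exact mul_le_mul_of_nonneg_left
      (Real.sqrt_le_sqrt (toReal_surfaceMeasure_layers_le hSb hL hd)) hdN
  have b1 := norm_integral_weighted_inner_le (w := fun x => (freq : ℂ) ^ 2 * epsd x)
    (K := freq ^ 2 * C) (hem.const_mul _) (by
      filter_upwards [ae_restrict_mem hΩ] with x hx
      rw [norm_mul, norm_pow, Complex.norm_real, Real.norm_of_nonneg hfreq.le]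
      exact mul_le_mul_of_nonneg_left (heps x hx) (by positivity)) (by positivity)
    huL2 E.memLp_field
  have b2 := norm_integral_weighted_inner_le (w := fun x => Complex.I * freq * sigd x)
    (K := freq * (C * d)) (hsm.const_mul _) (by
      filter_upwards [(ae_restrict_mem hlay : ∀ᵐ x ∂(surfaceMeasure (layers S L d)), _)] with x hx
      rw [norm_mul, norm_mul, Complex.norm_I, one_mul, Complex.norm_real,
        Real.norm_of_nonneg hfreq.le]
      exact mul_le_mul_of_nonneg_left (hsig x hx) hfreq.le) (by positivity)
    hshL2 E.memLp_shTrace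
  have b3 := norm_integral_inner_le huL2 hJ
  set P := ∫ x in domainΩ S L, inner ℂ (curlOf u x) (E.curl x)
  set X := ∫ x in domainΩ S L, (freq : ℂ) ^ 2 * epsd x * inner ℂ (u x) (E.field x)
  set Z := ∫ x, Complex.I * freq * sigd x * inner ℂ (tangential (u x)) (E.shTrace x)
    ∂(surfaceMeasure (layers S L d))
  set R := ∫ x in domainΩ S L, inner ℂ (u x) (J x)
  have hμ' : (μ : ℂ) ≠ 0 := by exact_mod_cast hμ.ne'
  have hP : P = μ * (X + Z + Complex.I * freq * R) := by
    rw [← hsol]; field_simp; ring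
  have hsplit : ‖P‖ ≤ μ * (‖X‖ + ‖Z‖ + freq * ‖R‖) := by
    rw [hP, norm_mul, Complex.norm_real, Real.norm_of_nonneg hμ.le]
    refine mul_le_mul_of_nonneg_left ((norm_add₃_le).trans ?_) hμ.le
    rw [norm_mul, norm_mul, Complex.norm_I, one_mul, Complex.norm_real,
      Real.norm_of_nonneg hfreq.le]
  refine hsplit.trans (mul_le_mul_of_nonneg_left ?_ hμ.le)
  have hM0 : 0 ≤ M := ENNReal.toReal_nonneg.trans hM1
  have c1 : ‖X‖ ≤ freq ^ 2 * C * (d * N * Real.sqrt (volume (domainΩ S L)).toReal * M) :=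
    b1.trans (by gcongr)
  have c3 : ‖R‖ ≤ d * N * Real.sqrt (volume (domainΩ S L)).toReal *
      (eLpNorm J 2 (volume.restrict (domainΩ S L))).toReal :=
    b3.trans (mul_le_mul_of_nonneg_right hnu ENNReal.toReal_nonneg)
  -- Powers of d in the sheet term: d from the conductivity, d from the test field, 1/√d from the
  -- square root of the area and 1/√d from the trace bound leave one factor d.
  have hsq : Real.sqrt d * Real.sqrt ((2 * L / d + 1) * (volume S).toReal) =
      Real.sqrt ((2 * L + d) * (volume S).toReal) := by
    rw [← Real.sqrt_mul hd.le]
    congr 1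
    field_simp
  have c2 : ‖Z‖ ≤ freq * C * (d * N * Real.sqrt ((2 * L + d) * (volume S).toReal) * M) := by
    refine b2.trans ?_
    rw [← hsq]
    set s := (eLpNorm E.shTrace 2 (surfaceMeasure (layers S L d))).toReal
    set q := Real.sqrt ((2 * L / d + 1) * (volume S).toReal)
    set t := (eLpNorm (fun x => tangential (u x)) 2 (surfaceMeasure (layers S L d))).toReal
    have hs : 0 ≤ s := ENNReal.toReal_nonneg
    have hq : 0 ≤ q := Real.sqrt_nonneg _
    have hdd : d = Real.sqrt d * Real.sqrt d := (Real.mul_self_sqrt hd.le).symm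
    calc freq * (C * d) * (t * s) ≤ freq * (C * d) * (d * N * q * s) := by gcongr
      _ = freq * C * (d * N * q * (d * s)) := by ring
      _ = freq * C * (d * N * (Real.sqrt d * q) * (Real.sqrt d * s)) := by
          rw [show d * s = Real.sqrt d * Real.sqrt d * s by rw [← hdd]]; ring
      _ ≤ _ := by gcongr
  calc ‖X‖ + ‖Z‖ + freq * ‖R‖ ≤ _ + _ + freq * _ :=
        add_le_add (add_le_add c1 c2) (mul_le_mul_of_nonneg_left c3 hfreq.le)
    _ = _ := by ring

end Maxwell

/-! ### Constraints on the two-scale limits -/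

section Constraints

variable {Ω : Set E3} {d : ℕ → ℝ}

lemma eq_zero_of_notMem {η : E3 → ℝ} (hs : tsupport η ⊆ Ω) {x : E3} (hx : x ∉ Ω) :
    (η x : ℂ) = 0 := by
  rw [image_eq_zero_of_notMem_tsupport fun h => hx (hs h), Complex.ofReal_zero]

lemma contDiff_ofReal_comp {η : E3 → ℝ} (hη : ContDiff ℝ ∞ η) :
    ContDiff ℝ ∞ fun x => (η x : ℂ) :=
  Complex.ofRealCLM.contDiff.comp hη

lemma gradOf_ofReal_eq_zero {η : E3 → ℝ} (hs : tsupport η ⊆ Ω) {x : E3} (hx : x ∉ Ω) :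
    gradOf (fun x => (η x : ℂ)) x = 0 := by
  refine gradOf_eq_zero fun h => hx (hs ?_)
  exact (closure_mono fun y hy => by
    contrapose! hy
    have : η y = 0 := by simpa using hy
    simp [this]) h

lemma hasCompactSupport_oscFun {η : E3 → ℝ} (hs : HasCompactSupport η) (k : Fin 3 → ℤ) (d : ℝ) :
    HasCompactSupport (oscFun η k d) :=
  hs.of_isClosed_subset (isClosed_tsupport _) tsupport_oscFun_subset

lemma conjV_conjV (v : C3) : conjV (conjV v) = v := by
  ext i; simp [conjV]

lemma conjV_add (v w : C3) : conjV (v + w) = conjV v + conjV w := by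
  ext i; simp [conjV]

lemma conjV_smul (a : ℂ) (v : C3) : conjV (a • v) = (starRingEnd ℂ a) • conjV v := by
  ext i; simp [conjV]

lemma conjV_zero : conjV 0 = 0 := by
  ext i; simp [conjV]

lemma norm_oscFun_smul_le {η : E3 → ℝ} {A : ℝ} (hA : ∀ x, ‖η x‖ ≤ A) (k : Fin 3 → ℤ) {d : ℝ}
    (hd : 0 < d) (b : C3) (x : E3) : ‖constField (oscFun η k d) b x‖ ≤ d * (A * ‖b‖) := by
  rw [constField, oscFun, norm_smul, norm_mul, norm_mul, norm_cellExp, Complex.norm_real,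
    Complex.norm_real, Real.norm_of_nonneg hd.le, mul_one, mul_assoc]
  have := hA x
  gcongr

variable {u w : ℕ → E3 → C3} {u₀ w₀ : E3 → E3 → C3}

/-- The limit of fields with two-scale convergent curls is curl free in the fast variable. -/
lemma ae_cross_vecCoeff_eq_zero (hΩ : IsOpen Ω) (hΩb : Bornology.IsBounded Ω) (hd : ∀ n, 0 < d n)
    (hd0 : Tendsto d atTop (𝓝 0)) (hu : TwoScaleConverges Ω d u u₀)
    (hw : TwoScaleConverges Ω d w w₀)
    (hcurl : ∀ n φ, IsTestField φ → tsupport φ ⊆ Ω →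
      ∫ x in Ω, dot (w n x) (φ x) = ∫ x in Ω, dot (u n x) (curlOf φ x))
    (k : Fin 3 → ℤ) (b : C3) :
    ∀ᵐ x ∂(volume.restrict Ω),
      ∑ i, ((2 * Real.pi * Complex.I : ℂ) • cross (intVec k) b) i * vecCoeff u₀ (-k) x i = 0 := by
  refine ae_sum_vecCoeff_eq_zero hΩ hΩb hu.2.1 k _ fun η hη hηc hηs => ?_
  have hηC := contDiff_ofReal_comp hη
  have l1 := hu.tendsto_oscillating hΩb hd0 k
    (w₁ := fun x => cross (gradOf (fun x => (η x : ℂ)) x) b)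
    (w₂ := fun x => (η x : ℂ) • (2 * Real.pi * Complex.I : ℂ) • cross (intVec k) b)
    ((continuous_cross_left b).comp (contDiff_gradOf hηC).continuous)
    (hηC.continuous.smul continuous_const)
    (fun x hx => by rw [gradOf_ofReal_eq_zero hηs hx, zero_cross])
    (fun x hx => by rw [eq_zero_of_notMem hηs hx, zero_smul])
  -- The test field itself consists only of the part with the factor d, so its pairing with the
  -- curls tends to zero.
  have l2 := hw.tendsto_oscillating hΩb hd0 k
    (w₁ := fun x => (η x : ℂ) • b) (w₂ := fun _ => 0)
    (hηC.continuous.smul continuous_const) continuous_const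
    (fun x hx => by rw [eq_zero_of_notMem hηs hx, zero_smul]) (fun _ _ => rfl)
  simp only [smul_zero, dot_zero, integral_zero, add_zero] at l2
  refine tendsto_nhds_unique l1 (l2.congr fun n => ?_)
  have h := hcurl n (constField (oscFun η k (d n)) b)
    (isTestField_constField (contDiff_oscFun hη) (hasCompactSupport_oscFun hηc k _) b)
    (tsupport_constField_subset.trans (tsupport_oscFun_subset.trans hηs))
  simp_rw [curlOf_osc hη (hd n).ne'] at h
  rw [← h]
  refine integral_congr_ae (ae_of_all _ fun x => ?_)
  simp only [constField, oscFun]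
  congr 1
  module

/-- The limit of curls is divergence free in the fast variable. -/
lemma ae_dot_vecCoeff_eq_zero (hΩ : IsOpen Ω) (hΩb : Bornology.IsBounded Ω) (hd : ∀ n, 0 < d n)
    (hd0 : Tendsto d atTop (𝓝 0)) (hw : TwoScaleConverges Ω d w w₀)
    (hcurl : ∀ n φ, IsTestField φ → tsupport φ ⊆ Ω →
      ∫ x in Ω, dot (w n x) (φ x) = ∫ x in Ω, dot (u n x) (curlOf φ x)) (k : Fin 3 → ℤ) :
    ∀ᵐ x ∂(volume.restrict Ω),
      ∑ i, ((2 * Real.pi * Complex.I : ℂ) • intVec k) i * vecCoeff w₀ (-k) x i = 0 := by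
  refine ae_sum_vecCoeff_eq_zero hΩ hΩb hw.2.1 k _ fun η hη hηc hηs => ?_
  have hηC := contDiff_ofReal_comp hη
  have l1 := hw.tendsto_oscillating hΩb hd0 k
    (w₁ := gradOf (fun x => (η x : ℂ)))
    (w₂ := fun x => (η x : ℂ) • (2 * Real.pi * Complex.I : ℂ) • intVec k)
    (contDiff_gradOf hηC).continuous
    (hηC.continuous.smul continuous_const)
    (fun x hx => gradOf_ofReal_eq_zero hηs hx)
    (fun x hx => by rw [eq_zero_of_notMem hηs hx, zero_smul])
  refine tendsto_nhds_unique l1 (tendsto_const_nhds.congr fun n => ?_)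
  have hf : ContDiff ℝ ∞ (oscFun η k (d n)) := contDiff_oscFun hη
  -- A gradient has no curl, so the pairing vanishes for every n and not merely in the limit.
  have h := hcurl n (gradOf (oscFun η k (d n)))
    (isTestField_gradOf hf (hasCompactSupport_oscFun hηc k _))
    (tsupport_gradOf_subset.trans (tsupport_oscFun_subset.trans hηs))
  simp_rw [curlOf_gradOf hf, dot_zero, integral_zero, gradOf_oscFun hη (hd n).ne'] at h
  exact h.symm

/-- The limit in the hypothesis is to come from the Maxwell equation, which is sesquilinear: the
conjugated test field oscillates with −k, and the coefficient at frequency k appears. -/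
lemma ae_cross_vecCoeff_eq_zero_of_tendsto (hΩ : IsOpen Ω) (hΩb : Bornology.IsBounded Ω)
    (hd : ∀ n, 0 < d n) (hd0 : Tendsto d atTop (𝓝 0)) (hw : TwoScaleConverges Ω d w w₀)
    (k : Fin 3 → ℤ) (b : C3)
    (hlim : ∀ η : E3 → ℝ, ContDiff ℝ ∞ η → HasCompactSupport η → tsupport η ⊆ Ω →
      Tendsto (fun n => ∫ x in Ω, inner ℂ (curlOf (constField (oscFun η k (d n)) b) x) (w n x))
        atTop (𝓝 0)) :
    ∀ᵐ x ∂(volume.restrict Ω),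
      ∑ i, conjV ((2 * Real.pi * Complex.I : ℂ) • cross (intVec k) b) i * vecCoeff w₀ k x i = 0 := by
  have key := ae_sum_vecCoeff_eq_zero hΩ hΩb hw.2.1 (-k)
    (conjV ((2 * Real.pi * Complex.I : ℂ) • cross (intVec k) b)) fun η hη hηc hηs => by
      have hηC := contDiff_ofReal_comp hη
      have l1 := hw.tendsto_oscillating hΩb hd0 (-k)
        (w₁ := fun x => conjV (cross (gradOf (fun x => (η x : ℂ)) x) b))
        (w₂ := fun x => (η x : ℂ) • conjV ((2 * Real.pi * Complex.I : ℂ) • cross (intVec k) b))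
        (continuous_conjV.comp
          ((continuous_cross_left b).comp (contDiff_gradOf hηC).continuous))
        (hηC.continuous.smul continuous_const)
        (fun x hx => by rw [gradOf_ofReal_eq_zero hηs hx, zero_cross, conjV_zero])
        (fun x hx => by rw [eq_zero_of_notMem hηs hx, zero_smul])
      refine tendsto_nhds_unique l1 ((hlim η hη hηc hηs).congr fun n => ?_)
      refine integral_congr_ae (ae_of_all _ fun x => ?_)
      simp only
      rw [dot_eq_inner]
      simp only [conjV_smul, conjV_add, conjV_conjV, conj_cellExp, neg_neg, Complex.conj_ofReal,
        Complex.conj_conj, curlOf_osc hη (hd n).ne']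
  simpa only [neg_neg] using key

end Constraints

/-- The three unit vectors give the components of k × a up to sign and the factor t. -/
lemma cross_intVec_single (k : Fin 3 → ℤ) (a : Fin 3 → ℂ) (t : ℂ) (ht : t ≠ 0)
    (h : ∀ l : Fin 3, ∑ i, (t • cross (intVec k) (EuclideanSpace.single l 1)) i * a i = 0) :
    ∀ i j, (k j : ℂ) * a i = k i * a j := by
  have h0 := h 0
  have h1 := h 1
  have h2 := h 2
  simp [cross, intVec, cross_apply, Fin.sum_univ_three, mul_assoc] at h0 h1 h2
  intro i j
  refine mul_left_cancel₀ ht ?_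
  fin_cases i <;> fin_cases j <;> simp only [Fin.isValue, Fin.zero_eta, Fin.mk_one, Fin.reduceFinMk]
  · linear_combination h2
  · linear_combination -h1
  · linear_combination -h2
  · linear_combination h0
  · linear_combination h1
  · linear_combination -h0

/-- The vectors k and e_l are real, so conjugation acts only on the scalar. -/
lemma conjV_smul_cross_intVec_single (k : Fin 3 → ℤ) (t : ℂ) (l : Fin 3) :
    conjV (t • cross (intVec k) (EuclideanSpace.single l 1)) =
      (starRingEnd ℂ t) • cross (intVec k) (EuclideanSpace.single l 1) := by
  rw [conjV_smul]
  congr 1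
  ext i
  fin_cases l <;> fin_cases i <;> simp [conjV, cross, intVec, cross_apply]

lemma TwoScaleConverges.const_smul {Ω : Set E3} {d : ℕ → ℝ} {u : ℕ → E3 → C3}
    {u₀ : E3 → E3 → C3} (h : TwoScaleConverges Ω d u u₀) (a : ℂ) :
    TwoScaleConverges Ω d (fun n x => a • u n x) (fun x y => a • u₀ x y) := by
  refine ⟨fun n => (h.1 n).const_smul a, MemLp.const_smul (f := Function.uncurry u₀) h.2.1 a,
    fun Ψ hΨ => ?_⟩
  simp only [smul_dot, integral_const_mul]
  exact (h.2.2 Ψ hΨ).const_mul a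

end LayeredMaxwell

end

/-! ### Assembly of the proof -/

theorem lemma4p1
    (S : Set E2) (hS : IsBoundedLipschitzDomain S) (L : ℝ) (hL : 0 < L)
    (freq μ lam : ℝ) (hfreq : 0 < freq) (hμ : 0 < μ) (hlam : 0 < lam)
    (ε σ : E3 → E3 → ℂ)
    (hεper : ∀ x ∈ domainΩ S L, IsYPeriodic (ε x))
    (hσper : ∀ x ∈ domainΩ S L, IsYPeriodic (σ x))
    (hεmeas : ∀ d : ℝ, 0 < d → AEMeasurable (epsD ε d) (volume.restrict (domainΩ S L)))
    (hσlip : ∃ K : ℝ≥0, LipschitzOnWith K (Function.uncurry σ) (domainΩ S L ×ˢ univ))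
    (c C : ℝ) (hc : 0 < c)
    (hε : ∀ d : ℝ, 0 < d → ∀ x ∈ domainΩ S L,
      c ≤ (epsD ε d x).im ∧ (epsD ε d x).im ≤ C ∧ |(epsD ε d x).re| ≤ C)
    (hσ : ∀ d : ℝ, 0 < d → ∀ x ∈ layers S L d,
      c ≤ 1 / d * (sigmaD σ d x).re ∧ 1 / d * (sigmaD σ d x).re ≤ C ∧
        |1 / d * (sigmaD σ d x).im| ≤ C)
    (J : E3 → C3) (hJ : MemLp J 2 (volume.restrict (domainΩ S L)))
    (d : ℕ → ℝ) (hd : ∀ n, 0 < d n) (hd0 : Tendsto d atTop (𝓝 0))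
    (E : ∀ n, XSpace S L (d n))
    (hE : ∀ n, IsMaxwellSolution freq μ lam (epsD ε (d n)) (sigmaD σ (d n)) J (E n)) :
    ∃ ι : ℕ → ℕ, StrictMono ι ∧
      ∃ (𝓔 𝓗 : E3 → C3) (φ : E3 → E3 → ℂ) (gradφ : E3 → E3 → C3),
        MemLp 𝓔 2 (volume.restrict (domainΩ S L)) ∧
        MemLp 𝓗 2 (volume.restrict (domainΩ S L)) ∧
        MemL2H1PerWithGrad (domainΩ S L) φ gradφ ∧
        TwoScaleConverges (domainΩ S L) (fun n => d (ι n))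
          (fun n => (E (ι n)).field) (fun x y => 𝓔 x + gradφ x y) ∧
        TwoScaleConverges (domainΩ S L) (fun n => d (ι n))
          (fun n => magneticField freq μ (E (ι n))) (fun x _ => 𝓗 x) := by
  have hΩ : IsOpen (domainΩ S L) := isOpen_domainΩ hS.1
  have hΩb : Bornology.IsBounded (domainΩ S L) := isBounded_domainΩ hS.2.1
  -- For empty Ω the bounds do not force C ≥ 0, so C is replaced by its positive part.
  have hCm : C ≤ max C 0 := le_max_left _ _
  have hC0 : 0 ≤ max C 0 := le_max_right _ _
  have hem : ∀ n, AEStronglyMeasurable (epsD ε (d n)) (volume.restrict (domainΩ S L)) :=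
    fun n => (hεmeas (d n) (hd n)).aestronglyMeasurable
  have hsm : ∀ n, AEStronglyMeasurable (sigmaD σ (d n)) (surfaceMeasure (layers S L (d n))) :=
    fun n => by
      -- The sheets are null sets of ℝ³, so measurability of σ on them is obtained from its
      -- continuity in Ω.
      obtain ⟨K, hK⟩ := hσlip
      exact ((continuousOn_sigmaD hK (d n)).mono (layers_subset (hd n))).aestronglyMeasurable
        (measurableSet_layers hS.1 L (d n))
  have hε' : ∀ n, ∀ x ∈ domainΩ S L, c ≤ (epsD ε (d n) x).im ∧
      (epsD ε (d n) x).im ≤ max C 0 ∧ |(epsD ε (d n) x).re| ≤ max C 0 := fun n x hx => by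
    obtain ⟨h1, h2, h3⟩ := hε (d n) (hd n) x hx
    exact ⟨h1, h2.trans hCm, h3.trans hCm⟩
  have hσ' : ∀ n, ∀ x ∈ layers S L (d n), c * d n ≤ (sigmaD σ (d n) x).re ∧
      (sigmaD σ (d n) x).re ≤ max C 0 * d n ∧
      |(sigmaD σ (d n) x).im| ≤ max C 0 * d n := fun n x hx => by
    obtain ⟨h1, h2, h3⟩ := hσ (d n) (hd n) x hx
    rw [one_div, inv_mul_eq_div] at h1 h2 h3
    rw [abs_div, abs_of_pos (hd n)] at h3
    exact ⟨(le_div_iff₀ (hd n)).1 h1, (div_le_iff₀ (hd n)).1 (h2.trans hCm),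
      (div_le_iff₀ (hd n)).1 (h3.trans hCm)⟩
  have hεn : ∀ n, ∀ x ∈ domainΩ S L, ‖epsD ε (d n) x‖ ≤ 2 * max C 0 := fun n x hx => by
    obtain ⟨h1, h2, h3⟩ := hε' n x hx
    exact norm_le_two_mul_of_abs_le h3 (by rwa [abs_of_pos (hc.trans_le h1)])
  have hσn : ∀ n, ∀ x ∈ layers S L (d n), ‖sigmaD σ (d n) x‖ ≤ 2 * max C 0 * d n :=
    fun n x hx => by
      obtain ⟨h1, h2, h3⟩ := hσ' n x hx
      rw [mul_assoc]
      exact norm_le_two_mul_of_abs_le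
        (by rwa [abs_of_pos ((mul_pos hc (hd n)).trans_le h1)]) h3
  obtain ⟨M, hM⟩ := exists_apriori_bound hS.1 freq μ lam hfreq hμ hlam c (max C 0) hc hC0 J hJ
  have hb := fun n => hM (d n) (hd n) _ _ (hem n) (hsm n) (hε' n) (hσ' n) (E n) (hE n)
  obtain ⟨ι₁, hι₁, E₀, hE₀⟩ := exists_twoScaleConverges_subseq hΩ.measurableSet hΩb hd hd0
    (fun n => (E n).memLp_field) M fun n => (hb n).1
  obtain ⟨ι₂, hι₂, W₀, hW₀⟩ := exists_twoScaleConverges_subseq hΩ.measurableSet hΩb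
    (fun n => hd (ι₁ n)) (hd0.comp hι₁.tendsto_atTop)
    (fun n => (E (ι₁ n)).memLp_curl) M fun n => (hb (ι₁ n)).2.1
  have hE₁ := hE₀.subseq hι₂
  have hdι : ∀ n, 0 < d (ι₁ (ι₂ n)) := fun n => hd _
  have hdι0 : Tendsto (fun n => d (ι₁ (ι₂ n))) atTop (𝓝 0) :=
    hd0.comp (hι₁.comp hι₂).tendsto_atTop
  have hcurl : ∀ n φ, IsTestField φ → tsupport φ ⊆ domainΩ S L →
      ∫ x in domainΩ S L, dot ((E (ι₁ (ι₂ n))).curl x) (φ x) =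
        ∫ x in domainΩ S L, dot ((E (ι₁ (ι₂ n))).field x) (curlOf φ x) :=
    fun n φ h1 h2 => (E _).weak_curl φ h1 h2
  have ht : (2 * Real.pi * Complex.I : ℂ) ≠ 0 := Complex.two_pi_I_ne_zero
  have hEcurl : ∀ᵐ x ∂(volume.restrict (domainΩ S L)), ∀ k i j,
      ((k : Fin 3 → ℤ) j : ℂ) * vecCoeff E₀ k x i = k i * vecCoeff E₀ k x j := by
    rw [ae_all_iff]
    intro k
    have h : ∀ᵐ x ∂(volume.restrict (domainΩ S L)), ∀ l : Fin 3,
        ∑ i, ((2 * Real.pi * Complex.I : ℂ) • cross (intVec (-k)) (EuclideanSpace.single l 1)) i *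
          vecCoeff E₀ k x i = 0 := by
      rw [ae_all_iff]
      intro l
      have := ae_cross_vecCoeff_eq_zero hΩ hΩb hdι hdι0 hE₁ hW₀ hcurl (-k)
        (EuclideanSpace.single l 1)
      simpa only [neg_neg] using this
    filter_upwards [h] with x hx i j
    have := cross_intVec_single (-k) _ _ ht hx i j
    simpa using this
  have hWdiv : ∀ᵐ x ∂(volume.restrict (domainΩ S L)), ∀ k,
      ∑ i, ((k : Fin 3 → ℤ) i : ℂ) * vecCoeff W₀ k x i = 0 := by
    rw [ae_all_iff]
    intro k
    have h := ae_dot_vecCoeff_eq_zero hΩ hΩb hdι hdι0 hW₀ hcurl (-k)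
    filter_upwards [h] with x hx
    simp only [neg_neg, PiLp.smul_apply, smul_eq_mul, mul_assoc, ← Finset.mul_sum] at hx
    simpa [intVec, Real.pi_ne_zero] using hx
  -- The only constraint on the limits that uses the Maxwell equation itself rather than the
  -- definition of the weak curl.
  have hWcurl : ∀ᵐ x ∂(volume.restrict (domainΩ S L)), ∀ k i j,
      ((k : Fin 3 → ℤ) j : ℂ) * vecCoeff W₀ k x i = k i * vecCoeff W₀ k x j := by
    rw [ae_all_iff]
    intro k
    have h : ∀ᵐ x ∂(volume.restrict (domainΩ S L)), ∀ l : Fin 3,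
        ∑ i, ((starRingEnd ℂ (2 * Real.pi * Complex.I)) •
          cross (intVec k) (EuclideanSpace.single l 1)) i * vecCoeff W₀ k x i = 0 := by
      rw [ae_all_iff]
      intro l
      have := ae_cross_vecCoeff_eq_zero_of_tendsto hΩ hΩb hdι hdι0 hW₀ k
        (EuclideanSpace.single l 1) fun η hη hηc hηs => by
          obtain ⟨A, hA⟩ := hηc.exists_bound_of_continuous hη.continuous
          have hA0 : 0 ≤ A := (norm_nonneg _).trans (hA 0)
          have hbound := fun n => norm_integral_curl_test_le hS.1 hS.2.1 hL (hdι n) (lam := lam)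
            (C := 2 * max C 0) (M := M) (N := A * ‖(EuclideanSpace.single l 1 : C3)‖)
            hfreq hμ (by positivity) (by positivity) hJ (hem _) (hsm _)
            (hεn _) (hσn _)
            (hE _) (hb _).1 (hb _).2.2
            (isTestField_constField (contDiff_oscFun hη) (hasCompactSupport_oscFun hηc k _)
              (EuclideanSpace.single l 1))
            (tsupport_constField_subset.trans (tsupport_oscFun_subset.trans hηs))
            (norm_oscFun_smul_le hA k (hdι n) _)
          -- The bound has the form μ · t · (continuous function of t) evaluated at t = d, hence
          -- tends to zero.
          refine squeeze_zero_norm hbound ?_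
          refine Tendsto.comp (g := fun t : ℝ => μ * (t * (_ + freq * (2 * max C 0) *
            (A * ‖(EuclideanSpace.single l 1 : C3)‖ *
              Real.sqrt ((2 * L + t) * (volume S).toReal) * M) + _))) ?_ hdι0
          refine Continuous.tendsto' (by fun_prop) 0 0 (by simp)
      simpa only [conjV_smul_cross_intVec_single] using this
    filter_upwards [h] with x hx i j
    exact cross_intVec_single k _ _ (by simp) hx i j
  obtain ⟨φ, gradφ, hφ, hdec⟩ := exists_potential hE₀.2.1 hEcurl
  have hW₁ := eq_cellMean_of_curl_div hW₀.2.1 hWcurl hWdiv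
  refine ⟨fun n => ι₁ (ι₂ n), hι₁.comp hι₂, cellMean E₀,
    fun x => (1 / (Complex.I * freq * μ) : ℂ) • cellMean W₀ x, φ, gradφ,
    memLp_cellMean hE₀.2.1, (memLp_cellMean hW₀.2.1).const_smul (1 / (Complex.I * freq * μ) : ℂ), hφ, ?_, ?_⟩
  · exact hE₁.congr hdec
  · exact (hW₀.congr hW₁).const_smul _
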